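/- Let $Q$ be a smooth manifold of dimension $m$, with a fixed volume form $\nu$, and let $\tau_A:A\to Q$ be an oriented smooth real vector bundle of rank $n$ with a Lie algebroid structure $([\![\cdot,\cdot]\!]_A,\rho_A)$: a Lie bracket on $\Gamma(A)$ and a vector bundle morphism $\rho_A:A\to TQ$ with $[\![X,fY]\!]_A=f[\![X,Y]\!]_A+\rho_A(X)(f)\,Y$. Let $\tau:A^*\to Q$ be the dual bundle with its linear Poisson bracket, which is characterized by $\{\hat X,\hat Y\}=-\widehat{[\![X,Y]\!]_A}$, $\{f\circ\tau,\hat X\}=\rho_A(X)(f)\circ\tau$, $\{f\circ\tau,g\circ\tau\}=0$ for $X,Y\in\Gamma(A)$ and $f,g\in C^\infty(Q)$, where $\hat X(\alpha)=\alpha(X(\tau(\alpha)))$. The hamiltonian vector field $\mathcal H_\varphi$ of $\varphi\in C^\infty(A^*)$ is given by $\mathcal H_\varphi(\psi)=\{\psi,\varphi\}$. A vector field $X$ preserves a form $\Phi$ if $\mathcal L_X\Phi=0$. For $\sigma\in C^\infty(Q)$, $d^A\sigma\in\Gamma(A^*)$ is given by $(d^A\sigma)(X)=\rho_A(X)(\sigma)$.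 For a volume form $\nu'$ on $Q$ and a nowhere vanishing $\Lambda\in\Gamma(\Lambda^nA)$, let $\nu'\wedge\Lambda$ be the volume form on $A^*$ with $(\nu'\wedge\Lambda)(\tilde Z_1,\dots,\tilde Z_m,\alpha_1^{\mathbf v},\dots,\alpha_n^{\mathbf v})=\nu'(Z_1,\dots,Z_m)\,\Lambda(\alpha_1,\dots,\alpha_n)$ for vector fields $\tilde Z_i$ on $A^*$ projecting to $Z_i$ on $Q$ and vertical lifts $\alpha_j^{\mathbf v}$ of sections $\alpha_j$ of $A^*$. The modular section $\mathcal M^{(\nu',\Lambda)}\in\Gamma(A^*)$ is the section whose vertical lift is the vector field $\varphi\mapsto\operatorname{div}_{\nu'\wedge\Lambda}(\mathcal H_\varphi)$. $A$ is unimodular if $\mathcal M^{(\nu',\Lambda)}=-d^A\sigma$ for some $\sigma\in C^\infty(Q)$ and some (equivalently, all) $\nu',\Lambda$ as above. Let $\mathcal G$ be a bundle metric on $A$, let $\Lambda^{\mathcal G}\in\Gamma(\Lambda^nA)$ be the section with value $1$ on the positively oriented orthonormal bases of the fibres of $A^*$, let $V\in C^\infty(Q)$, and let $H:A^*\to\mathbb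 R$, $H(\alpha)=\tfrac12\mathcal G(\alpha,\alpha)+V(\tau(\alpha))$. A volume form $\Phi$ on $A^*$ is of basic type if $\Phi=e^{\mu\circ\tau}\,\nu\wedge\Lambda^{\mathcal G}$ for some $\mu\in C^\infty(Q)$. Then $A$ is unimodular if and only if $\mathcal H_H$ preserves a volume form of basic type on $A^*$. Moreover, for every $\sigma\in C^\infty(Q)$ with $\mathcal M^{(\nu,\Lambda^{\mathcal G})}=-d^A\sigma$, the vector field $\mathcal H_H$ preserves the volume form $e^{\sigma\circ\tau}\,\nu\wedge\Lambda^{\mathcal G}$ on $A^*$. -/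

import Mathlib

open Bundle Module
open scoped Manifold ContDiff

noncomputable section

set_option linter.unusedSectionVars false
set_option linter.style.haveILetI false

namespace LieAlgd

section Forms

variable {E : Type*} [NormedAddCommGroup E] [NormedSpace ℝ E]
  {H : Type*} [TopologicalSpace H] (I : ModelWithCorners ℝ E H)
  {M : Type*} [TopologicalSpace M] [ChartedSpace H M]
  {ι : Type*}

/-- The derivative `v(f)` of a real function `f` along a tangent vector `v`. -/
def dirDeriv (f : M → ℝ) (x : M) (v : TangentSpace I x) : ℝ :=
  mfderiv I 𝓘(ℝ, ℝ) f x v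

variable [IsManifold I ∞ M]

/-- The vector field `Z` on `M` is smooth at `x`. -/
def SmoothFieldAt (Z : ∀ x : M, TangentSpace I x) (x : M) : Prop :=
  haveI : IsManifold I 1 M := IsManifold.of_le (n := ∞) (by simp)
  ContMDiffAt I I.tangent ∞ (fun y => (⟨y, Z y⟩ : TangentBundle I M)) x

/-- A volume form is a nowhere vanishing smooth form of top degree. A form is smooth when its
value on smooth (local) vector fields is a smooth function. -/
structure IsVolumeForm [Fintype ι] (Φ : ∀ x : M, TangentSpace I x [⋀^ι]→ₗ[ℝ] ℝ) : Prop where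
  top_degree : Fintype.card ι = finrank ℝ E
  smooth : ∀ (x : M) (Z : ι → ∀ y : M, TangentSpace I y), (∀ i, SmoothFieldAt I (Z i) x) →
    ContMDiffAt I 𝓘(ℝ, ℝ) ∞ (fun y => Φ y (fun i => Z i y)) x
  ne_zero : ∀ x, Φ x ≠ 0

variable [Fintype ι] [DecidableEq ι]

/-- The value at `x` of `(ℒ_X Φ)(Z₁, …, Z_d)`, that is of
`X (Φ (Z₁, …, Z_d)) - ∑ i, Φ (Z₁, …, [X, Z_i], …, Z_d)`. -/
def lieDerivForm (X : ∀ x : M, TangentSpace I x)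
    (Φ : ∀ x : M, TangentSpace I x [⋀^ι]→ₗ[ℝ] ℝ) (Z : ι → ∀ y : M, TangentSpace I y) (x : M) : ℝ :=
  dirDeriv I (fun y => Φ y (fun i => Z i y)) x (X x)
    - ∑ i, Φ x (Function.update (fun j => Z j x) i (VectorField.mlieBracket I X (Z i) x))

/-- The function `δ` is the divergence of `X` with respect to `Φ`, that is `ℒ_X Φ = δ Φ`. -/
def IsDivergence (Φ : ∀ x : M, TangentSpace I x [⋀^ι]→ₗ[ℝ] ℝ)
    (X : ∀ x : M, TangentSpace I x) (δ : M → ℝ) : Prop :=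
  ∀ (x : M) (Z : ι → ∀ y : M, TangentSpace I y), (∀ i, SmoothFieldAt I (Z i) x) →
    lieDerivForm I X Φ Z x = δ x * Φ x (fun i => Z i x)

/-- The vector field `X` preserves the form `Φ`, that is `ℒ_X Φ = 0`. -/
def Preserves (X : ∀ x : M, TangentSpace I x)
    (Φ : ∀ x : M, TangentSpace I x [⋀^ι]→ₗ[ℝ] ℝ) : Prop :=
  ∀ (x : M) (Z : ι → ∀ y : M, TangentSpace I y), (∀ i, SmoothFieldAt I (Z i) x) →
    lieDerivForm I X Φ Z x = 0

end Forms

section DualBundle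

variable {Q : Type*} [TopologicalSpace Q]
  (F : Type*) [NormedAddCommGroup F] [NormedSpace ℝ F]
  (A : Q → Type*) [∀ q, AddCommGroup (A q)] [∀ q, Module ℝ (A q)] [∀ q, TopologicalSpace (A q)]

/-- The fibre `A*_q` of the dual bundle of `A`. -/
abbrev DualFib (q : Q) : Type _ := A q →L[ℝ] Bundle.Trivial Q ℝ q

/-- The total space of the dual bundle `A*`, a bundle with model fibre `F*`. -/
abbrev DualTot : Type _ := TotalSpace (F →L[ℝ] ℝ) (DualFib A)

/-- The model with corners (without boundary) of the manifold `A*`. -/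
abbrev dualModel (E : Type*) [NormedAddCommGroup E] [NormedSpace ℝ E]
    (F : Type*) [NormedAddCommGroup F] [NormedSpace ℝ F] :
    ModelWithCorners ℝ (E × (F →L[ℝ] ℝ)) (ModelProd E (F →L[ℝ] ℝ)) :=
  𝓘(ℝ, E).prod 𝓘(ℝ, F →L[ℝ] ℝ)

end DualBundle

section Algebroid

variable {E : Type*} [NormedAddCommGroup E] [NormedSpace ℝ E]
  {Q : Type*} [TopologicalSpace Q] [ChartedSpace E Q]
  {F : Type*} [NormedAddCommGroup F] [NormedSpace ℝ F]
  {A : Q → Type*} [∀ q, AddCommGroup (A q)] [∀ q, Module ℝ (A q)] [∀ q, TopologicalSpace (A q)]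
  [∀ q, IsTopologicalAddGroup (A q)] [∀ q, ContinuousSMul ℝ (A q)]
  [TopologicalSpace (TotalSpace F A)] [FiberBundle F A] [VectorBundle ℝ F A]

/-- The product `f X` of a smooth function and a smooth section of `A`. -/
def smulSec (f : C^∞⟮𝓘(ℝ, E), Q; ℝ⟯) (X : Cₛ^∞⟮𝓘(ℝ, E); F, A⟯) : Cₛ^∞⟮𝓘(ℝ, E); F, A⟯ :=
  ⟨(f : Q → ℝ) • (X : ∀ q, A q), f.contMDiff.smul_section X.contMDiff⟩

variable (E F A) in
/-- A Lie algebroid structure on the smooth vector bundle `A` over `Q` (with model fibre `F`): a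
Lie bracket on the space of smooth sections and a smooth vector bundle morphism `A → TQ` over the
identity, the anchor, with `⟦X, f Y⟧ = f ⟦X, Y⟧ + ρ(X)(f) Y`. -/
structure LieAlgebroid [IsManifold 𝓘(ℝ, E) ∞ Q] where
  bracket : Cₛ^∞⟮𝓘(ℝ, E); F, A⟯ →ₗ[ℝ] Cₛ^∞⟮𝓘(ℝ, E); F, A⟯ →ₗ[ℝ] Cₛ^∞⟮𝓘(ℝ, E); F, A⟯
  bracket_self : ∀ X, bracket X X = 0
  jacobi : ∀ X Y Z,
    bracket X (bracket Y Z) + bracket Y (bracket Z X) + bracket Z (bracket X Y) = 0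
  anchor : ∀ q, A q →L[ℝ] TangentSpace 𝓘(ℝ, E) q
  anchor_smooth :
    haveI : IsManifold 𝓘(ℝ, E) 1 Q := IsManifold.of_le (n := ∞) (by simp)
    ContMDiff (𝓘(ℝ, E).prod 𝓘(ℝ, F)) 𝓘(ℝ, E).tangent ∞
      (fun a : TotalSpace F A => (⟨a.proj, anchor a.proj a.2⟩ : TangentBundle 𝓘(ℝ, E) Q))
  leibniz : ∀ (X Y : Cₛ^∞⟮𝓘(ℝ, E); F, A⟯) (f : C^∞⟮𝓘(ℝ, E), Q; ℝ⟯) (q : Q),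
    bracket X (smulSec f Y) q
      = f q • bracket X Y q + dirDeriv 𝓘(ℝ, E) f q (anchor q (X q)) • Y q

/-- The linear function `X̂ : A* → ℝ` of a section `X` of `A`. -/
def linFun (X : Cₛ^∞⟮𝓘(ℝ, E); F, A⟯) (α : DualTot F A) : ℝ := α.2 (X α.proj)

/-- The vertical lift `α^v(γ) = d/dt|_{t=0} (γ + t α(q)) ∈ T_γ A*`, for `γ ∈ A*_q`, of a section `α`
of `A*`. -/
def vertLift (α : ∀ q, DualFib A q) (γ : DualTot F A) : TangentSpace (dualModel E F) γ :=
  mfderiv 𝓘(ℝ, ℝ) (dualModel E F)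
    (fun t : ℝ => (⟨γ.proj, γ.2 + t • α γ.proj⟩ : DualTot F A)) 0 (1 : ℝ)

/-- The projection of `T_γ A*`, with `γ ∈ A*_q`, onto its vertical subspace `A*_q` along the
horizontal subspace given by the local trivialization of `A*` at `q`. -/
def vertProj (γ : DualTot F A) : TangentSpace (dualModel E F) γ →ₗ[ℝ] DualFib A γ.proj :=
  let e := trivializationAt (F →L[ℝ] ℝ) (DualFib A) γ.proj
  (e.symmL ℝ γ.proj).toLinearMap ∘ₗ
    (mfderiv (dualModel E F) 𝓘(ℝ, F →L[ℝ] ℝ) (fun β : DualTot F A => (e β).2) γ).toLinearMap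

/-- The form `ν ∧ Λ` on `A*`, for `ν` an `m`-form on `Q` and `Λ` a section of `Λⁿ A`, which is seen as
a family of alternating `n`-forms on the fibres of `A*`. It is the exterior product (shuffle sum) of
the pullback of `ν` and of `Λ` composed with a projection on vertical vectors. For `m = dim Q` it does
not depend on the latter, and it is characterized by
`(ν ∧ Λ)(Z̃₁, …, Z̃_m, α₁^v, …, α_n^v) = ν(Z₁, …, Z_m) Λ(α₁, …, α_n)` for `Z̃_i` projectable on `Z_i`. -/
def wedgeVol {m n : ℕ} (ν : ∀ q : Q, TangentSpace 𝓘(ℝ, E) q [⋀^Fin m]→ₗ[ℝ] ℝ)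
    (Λ : ∀ q : Q, DualFib A q [⋀^Fin n]→ₗ[ℝ] ℝ) (γ : DualTot F A) :
    TangentSpace (dualModel E F) γ [⋀^Fin m ⊕ Fin n]→ₗ[ℝ] ℝ :=
  (LinearMap.mul' ℝ ℝ).compAlternatingMap <|
    AlternatingMap.domCoprod
      ((ν γ.proj).compLinearMap
        (mfderiv (dualModel E F) 𝓘(ℝ, E) (fun β : DualTot F A => β.proj) γ).toLinearMap)
      ((Λ γ.proj).compLinearMap (vertProj γ))

variable (E F) in
/-- `Λ` is a nowhere vanishing smooth section of the top exterior power `Λⁿ A`. -/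
structure IsVolumeSection (Λ : ∀ q : Q, DualFib A q [⋀^Fin (finrank ℝ F)]→ₗ[ℝ] ℝ) : Prop where
  smooth : ∀ (q : Q) (α : Fin (finrank ℝ F) → ∀ y, DualFib A y),
    (∀ i, ContMDiffAt 𝓘(ℝ, E) (dualModel E F) ∞ (fun y => (⟨y, α i y⟩ : DualTot F A)) q) →
    ContMDiffAt 𝓘(ℝ, E) 𝓘(ℝ, ℝ) ∞ (fun y => Λ y (fun i => α i y)) q
  ne_zero : ∀ q, Λ q ≠ 0

namespace LieAlgebroid

variable [IsManifold 𝓘(ℝ, E) ∞ Q] [ContMDiffVectorBundle ∞ F A 𝓘(ℝ, E)] (L : LieAlgebroid E F A)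

/-- The differential `d^A σ` of a function: `(d^A σ)(X) = ρ(X)(σ)`. -/
def dA (σ : C^∞⟮𝓘(ℝ, E), Q; ℝ⟯) (q : Q) : DualFib A q :=
  (mfderiv 𝓘(ℝ, E) 𝓘(ℝ, ℝ) σ q).comp (L.anchor q)

/-- The linear Poisson bracket `{φ, ψ}` on `A*`, at `α`. It is a derivation in each argument, hence
it depends only on the differentials of `φ` and `ψ` at `α`; these are differentials of functions
`X̂ + f ∘ τ` and `Ŷ + g ∘ τ`, for which the rules `{X̂, Ŷ} = -⟦X, Y⟧^`, `{f ∘ τ, X̂} = ρ(X)(f) ∘ τ` and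
`{f ∘ τ, g ∘ τ} = 0` prescribe the value. -/
def poissonBracket (φ ψ : DualTot F A → ℝ) (α : DualTot F A) : ℝ :=
  Classical.epsilon fun r : ℝ =>
    ∃ (X Y : Cₛ^∞⟮𝓘(ℝ, E); F, A⟯) (f g : C^∞⟮𝓘(ℝ, E), Q; ℝ⟯),
      (∀ v, dirDeriv (dualModel E F) φ α v
        = dirDeriv (dualModel E F) (fun β => linFun X β + f β.proj) α v) ∧
      (∀ v, dirDeriv (dualModel E F) ψ α v
        = dirDeriv (dualModel E F) (fun β => linFun Y β + g β.proj) α v) ∧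
      r = - linFun (L.bracket X Y) α + dirDeriv 𝓘(ℝ, E) f α.proj (L.anchor α.proj (Y α.proj))
        - dirDeriv 𝓘(ℝ, E) g α.proj (L.anchor α.proj (X α.proj))

/-! The definition of the Poisson bracket makes sense: every differential of a function on `A*` is
the differential of a function `X̂ + f ∘ τ`, and the value of the bracket does not depend on the
choices (`exists_affine`, `poissonBracket_eq`). -/

section WellDefined

theorem linFun_smooth (X : Cₛ^∞⟮𝓘(ℝ, E); F, A⟯) :
    ContMDiff (dualModel E F) 𝓘(ℝ, ℝ) ∞ (linFun X) := by
  intro α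
  have h1 : ContMDiffAt (dualModel E F) (𝓘(ℝ, E).prod 𝓘(ℝ, F →L[ℝ] ℝ)) ∞
      (fun m : DualTot F A => TotalSpace.mk' (F →L[ℝ] ℝ)
        (E := fun x : Q => (A x →L[ℝ] Bundle.Trivial Q ℝ x)) m.proj m.2) α := contMDiffAt_id
  have h2 : ContMDiffAt (dualModel E F) (𝓘(ℝ, E).prod 𝓘(ℝ, F)) ∞
      (fun m : DualTot F A => TotalSpace.mk' F (E := A) m.proj (X m.proj)) α :=
    (X.contMDiff _).comp α (contMDiffAt_proj _)
  have h3 := h1.clm_bundle_apply h2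
  have h4 := (contMDiffAt_totalSpace.mp h3).2
  exact h4

theorem dirDeriv_congr' {f g : Q → ℝ} {q : Q} (h : f =ᶠ[nhds q] g) (v : TangentSpace 𝓘(ℝ, E) q) :
    dirDeriv 𝓘(ℝ, E) f q v = dirDeriv 𝓘(ℝ, E) g q v := by
  unfold dirDeriv
  rw [h.mfderiv_eq]
  rfl

theorem sec_sum_apply {ι : Type*} (s : Finset ι) (X : ι → Cₛ^∞⟮𝓘(ℝ, E); F, A⟯) (q : Q) :
    (∑ i ∈ s, X i) q = ∑ i ∈ s, X i q := by
  have h := map_sum (ContMDiffSection.coeAddHom 𝓘(ℝ, E) F ∞ A) X s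
  have h2 := congrFun h q
  rw [Finset.sum_apply] at h2
  exact h2

theorem dirDeriv_mul {f g : Q → ℝ} {q : Q} (hf : MDifferentiableAt 𝓘(ℝ, E) 𝓘(ℝ, ℝ) f q)
    (hg : MDifferentiableAt 𝓘(ℝ, E) 𝓘(ℝ, ℝ) g q) (v : TangentSpace 𝓘(ℝ, E) q) :
    dirDeriv 𝓘(ℝ, E) (fun y => f y * g y) q v
      = f q * dirDeriv 𝓘(ℝ, E) g q v + g q * dirDeriv 𝓘(ℝ, E) f q v := by
  unfold dirDeriv
  have := (hf.hasMFDerivAt.mul hg.hasMFDerivAt).mfderiv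
  have h2 := congrArg (fun l : TangentSpace 𝓘(ℝ, E) q →L[ℝ] ℝ => l v) this
  exact h2

variable [FiniteDimensional ℝ E] [FiniteDimensional ℝ F] [T2Space Q]

theorem exists_frame (q : Q) (X : Cₛ^∞⟮𝓘(ℝ, E); F, A⟯) :
    ∃ (e : Fin (finrank ℝ F) → Cₛ^∞⟮𝓘(ℝ, E); F, A⟯)
      (h : Fin (finrank ℝ F) → C^∞⟮𝓘(ℝ, E), Q; ℝ⟯) (χ : C^∞⟮𝓘(ℝ, E), Q; ℝ⟯),
      (χ : Q → ℝ) =ᶠ[nhds q] 1 ∧ smulSec χ X = ∑ i, smulSec (h i) (e i) ∧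
      (X q = 0 → ∀ i, h i q = 0) := by
  let t := trivializationAt F A q
  let b := finBasis ℝ F
  have hq : q ∈ t.baseSet := FiberBundle.mem_baseSet_trivializationAt' q
  obtain ⟨c, hc, -⟩ := (SmoothBumpFunction.nhds_basis_support (I := 𝓘(ℝ, E))
    (t.open_baseSet.mem_nhds hq)).mem_iff.mp (t.open_baseSet.mem_nhds hq)
  have hcs : ContMDiff 𝓘(ℝ, E) 𝓘(ℝ, ℝ) ∞ c := c.contMDiff
  haveI : ContMDiffVectorBundle 1 F A 𝓘(ℝ, E) := ContMDiffVectorBundle.of_le (n := ∞) (by simp)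
  refine ⟨fun i => ⟨(c : Q → ℝ) • t.localFrame b i, ?_⟩,
    fun i => ⟨fun y => c y * t.localFrameCoeff 𝓘(ℝ, E) b i y (X y), ?_⟩,
    ⟨fun y => c y * c y, ?_⟩, ?_, ?_, ?_⟩
  · exact hcs.contMDiffOn.smul_section_of_tsupport t.open_baseSet hc
      (t.contMDiffOn_localFrame_baseSet _ b i)
  · refine contMDiff_of_tsupport fun y hy => ?_
    have hy' : y ∈ t.baseSet := hc (closure_mono (by
      intro z hz hz'
      exact hz (by simp [hz'])) hy)
    exact hcs.contMDiffAt.smul (contMDiffAt_localFrameCoeff b hy' X.contMDiff.contMDiffAt i)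
  · exact hcs.mul hcs
  · filter_upwards [c.eventuallyEq_one] with y hy
    simp [hy]
  · ext y
    rw [sec_sum_apply]
    show (c y * c y) • X y = ∑ i, (c y * t.localFrameCoeff 𝓘(ℝ, E) b i y (X y)) •
      (c y • t.localFrame b i y)
    by_cases hy : y ∈ t.baseSet
    · conv_lhs => rw [t.eq_sum_localFrameCoeff_smul (I := 𝓘(ℝ, E)) (b := b) (s := X) hy]
      rw [Finset.smul_sum]
      refine Finset.sum_congr rfl fun i _ => ?_
      simp only [smul_smul]
      congr 1
      ring
    · have : c y = 0 := by
        by_contra h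
        exact hy (hc (subset_tsupport _ h))
      simp [this]
  · intro hX i
    show c q * t.localFrameCoeff 𝓘(ℝ, E) b i q (X q) = 0
    simp [hX]

theorem dirDeriv_add {f g : Q → ℝ} {q : Q} (hf : MDifferentiableAt 𝓘(ℝ, E) 𝓘(ℝ, ℝ) f q)
    (hg : MDifferentiableAt 𝓘(ℝ, E) 𝓘(ℝ, ℝ) g q) (v : TangentSpace 𝓘(ℝ, E) q) :
    dirDeriv 𝓘(ℝ, E) (fun y => f y + g y) q v
      = dirDeriv 𝓘(ℝ, E) f q v + dirDeriv 𝓘(ℝ, E) g q v := by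
  unfold dirDeriv
  have := (hf.hasMFDerivAt.add hg.hasMFDerivAt).mfderiv
  exact congrArg (fun l : TangentSpace 𝓘(ℝ, E) q →L[ℝ] ℝ => l v) this

theorem dirDeriv_sum {ι : Type*} (s : Finset ι) {f : ι → Q → ℝ} {q : Q}
    (hf : ∀ i, MDifferentiableAt 𝓘(ℝ, E) 𝓘(ℝ, ℝ) (f i) q) (v : TangentSpace 𝓘(ℝ, E) q) :
    dirDeriv 𝓘(ℝ, E) (fun y => ∑ i ∈ s, f i y) q v = ∑ i ∈ s, dirDeriv 𝓘(ℝ, E) (f i) q v := by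
  classical
  have key : MDifferentiableAt 𝓘(ℝ, E) 𝓘(ℝ, ℝ) (fun y => ∑ i ∈ s, f i y) q ∧
      dirDeriv 𝓘(ℝ, E) (fun y => ∑ i ∈ s, f i y) q v = ∑ i ∈ s, dirDeriv 𝓘(ℝ, E) (f i) q v := by
    induction s using Finset.induction_on with
    | empty =>
      simp only [Finset.sum_empty]
      refine ⟨mdifferentiableAt_const, ?_⟩
      unfold dirDeriv
      rw [mfderiv_const]
      rfl
    | insert i s hi ih =>
      simp only [Finset.sum_insert hi]
      exact ⟨(hf i).add ih.1, by rw [dirDeriv_add (hf i) ih.1, ih.2]⟩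
  exact key.2

theorem bracket_skew (X Y : Cₛ^∞⟮𝓘(ℝ, E); F, A⟯) : L.bracket X Y = - L.bracket Y X := by
  have h := L.bracket_self (X + Y)
  simp only [map_add, LinearMap.add_apply, L.bracket_self, zero_add, add_zero] at h
  exact eq_neg_of_add_eq_zero_right h

theorem bracket_smul_left (f : C^∞⟮𝓘(ℝ, E), Q; ℝ⟯) (X Y : Cₛ^∞⟮𝓘(ℝ, E); F, A⟯) (q : Q) :
    L.bracket (smulSec f X) Y q = f q • L.bracket X Y q
      - dirDeriv 𝓘(ℝ, E) f q (L.anchor q (Y q)) • X q := by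
  rw [bracket_skew, bracket_skew L X Y]
  simp only [ContMDiffSection.coe_neg, Pi.neg_apply, L.leibniz]
  module

theorem curve_mdifferentiableAt (γ : DualTot F A) (β : DualFib A γ.proj) :
    MDifferentiableAt 𝓘(ℝ, ℝ) (dualModel E F)
      (fun t : ℝ => (⟨γ.proj, γ.2 + t • β⟩ : DualTot F A)) 0 := by
  rw [mdifferentiableAt_totalSpace]
  refine ⟨mdifferentiableAt_const, ?_⟩
  set e := trivializationAt (F →L[ℝ] ℝ) (DualFib A) γ.proj
  have hq : γ.proj ∈ e.baseSet := FiberBundle.mem_baseSet_trivializationAt' γ.proj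
  have h : (fun t : ℝ => (e (⟨γ.proj, γ.2 + t • β⟩ : DualTot F A)).2) =
      fun t : ℝ => (e (⟨γ.proj, γ.2⟩ : DualTot F A)).2 + t • (e (⟨γ.proj, β⟩ : DualTot F A)).2 := by
    funext t
    rw [(e.linear ℝ hq).map_add, (e.linear ℝ hq).map_smul]
  show MDifferentiableAt 𝓘(ℝ, ℝ) 𝓘(ℝ, F →L[ℝ] ℝ)
    (fun t : ℝ => (e (⟨γ.proj, γ.2 + t • β⟩ : DualTot F A)).2) 0
  rw [h, mdifferentiableAt_iff_differentiableAt]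
  fun_prop

theorem dirDeriv_comp {E₁ H₁ M₁ E₂ H₂ M₂ : Type*} [NormedAddCommGroup E₁] [NormedSpace ℝ E₁]
    [TopologicalSpace H₁] {I₁ : ModelWithCorners ℝ E₁ H₁} [TopologicalSpace M₁] [ChartedSpace H₁ M₁]
    [NormedAddCommGroup E₂] [NormedSpace ℝ E₂]
    [TopologicalSpace H₂] {I₂ : ModelWithCorners ℝ E₂ H₂} [TopologicalSpace M₂] [ChartedSpace H₂ M₂]
    {g : M₂ → ℝ} {c : M₁ → M₂} {x : M₁} {y : M₂} (hy : c x = y)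
    (hg : MDifferentiableAt I₂ 𝓘(ℝ, ℝ) g y) (hc : MDifferentiableAt I₁ I₂ c x)
    (u : TangentSpace I₁ x) :
    dirDeriv I₁ (fun z => g (c z)) x u = dirDeriv I₂ g y (mfderiv I₁ I₂ c x u) := by
  subst hy
  unfold dirDeriv
  have := mfderiv_comp x hg hc
  exact congrArg (fun l : TangentSpace I₁ x →L[ℝ] ℝ => l u) this

theorem dirDeriv_vertLift {g : DualTot F A → ℝ} (γ : DualTot F A)
    (hg : MDifferentiableAt (dualModel E F) 𝓘(ℝ, ℝ) g γ) (α : ∀ q, DualFib A q) :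
    dirDeriv (dualModel E F) g γ (vertLift α γ)
      = deriv (fun t : ℝ => g ⟨γ.proj, γ.2 + t • α γ.proj⟩) 0 := by
  have h := dirDeriv_comp (I₁ := 𝓘(ℝ, ℝ)) (by simp) hg (curve_mdifferentiableAt γ (α γ.proj)) (1 : ℝ)
  refine h.symm.trans ?_
  unfold dirDeriv
  rw [mfderiv_eq_fderiv]
  show (fderiv ℝ (fun t : ℝ => g ⟨γ.proj, γ.2 + t • α γ.proj⟩) 0) (1 : ℝ) = _
  exact fderiv_apply_one_eq_deriv

theorem eq_zero_of_forall_dual (X : Cₛ^∞⟮𝓘(ℝ, E); F, A⟯) (q : Q)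
    (h : ∀ β : DualFib A q, β (X q) = 0) : X q = 0 := by
  let e := VectorBundle.continuousLinearEquivAt ℝ F A q
  apply e.injective
  rw [map_zero]
  by_contra h'
  obtain ⟨l, hl⟩ := SeparatingDual.exists_ne_zero (R := ℝ) h'
  exact hl (h (l.comp e.toContinuousLinearMap))

theorem wd_core (α : DualTot F A) (X : Cₛ^∞⟮𝓘(ℝ, E); F, A⟯) (f : C^∞⟮𝓘(ℝ, E), Q; ℝ⟯)
    (h0 : ∀ v, dirDeriv (dualModel E F) (fun β => linFun X β + f β.proj) α v = 0)
    (Y : Cₛ^∞⟮𝓘(ℝ, E); F, A⟯) :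
    X α.proj = 0 ∧ - linFun (L.bracket X Y) α
      + dirDeriv 𝓘(ℝ, E) f α.proj (L.anchor α.proj (Y α.proj)) = 0 := by
  obtain ⟨q, a⟩ := α
  -- the section vanishes
  have hX : X q = 0 := by
    classical
    refine eq_zero_of_forall_dual X q fun β => ?_
    have h1 := h0 (vertLift (fun y => if h : y = q then h ▸ β else 0) ⟨q, a⟩)
    rw [dirDeriv_vertLift] at h1
    · have h2 : (fun t : ℝ => linFun X (⟨q, a + t • β⟩ : DualTot F A) + f q)
          = fun t : ℝ => a (X q) + t * β (X q) + f q := by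
        funext t
        rfl
      simp only [↓reduceDIte] at h1
      rw [h2] at h1
      simpa using h1
    · exact ((linFun_smooth X _).add ((f.contMDiff _).comp _ (contMDiffAt_proj _))).mdifferentiableAt
        (by simp)
  -- horizontal derivative
  let s : ∀ y, DualFib A y := FiberBundle.extend (F →L[ℝ] ℝ) a
  have hs : ContMDiffAt 𝓘(ℝ, E) (dualModel E F) ∞ (fun y => (⟨y, s y⟩ : DualTot F A)) q :=
    FiberBundle.contMDiffAt_extend 𝓘(ℝ, E) (F →L[ℝ] ℝ) a
  have hsq : s q = a := FiberBundle.extend_apply_self _ a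
  have hsX : ∀ Z : Cₛ^∞⟮𝓘(ℝ, E); F, A⟯,
      MDifferentiableAt 𝓘(ℝ, E) 𝓘(ℝ, ℝ) (fun y => s y (Z y)) q := fun Z =>
    ((linFun_smooth Z _).comp q hs).mdifferentiableAt (by simp)
  have hf : ∀ f : C^∞⟮𝓘(ℝ, E), Q; ℝ⟯, MDifferentiableAt 𝓘(ℝ, E) 𝓘(ℝ, ℝ) f q := fun f =>
    (f.contMDiff q).mdifferentiableAt (by simp)
  have hh : ∀ u, dirDeriv 𝓘(ℝ, E) (fun y => s y (X y)) q u + dirDeriv 𝓘(ℝ, E) f q u = 0 := by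
    intro u
    rw [← dirDeriv_add (hsX X) (hf f)]
    rw [← h0 (mfderiv 𝓘(ℝ, E) (dualModel E F) (fun y => (⟨y, s y⟩ : DualTot F A)) q u)]
    refine dirDeriv_comp (g := fun β : DualTot F A => linFun X β + f β.proj)
      (c := fun y => (⟨y, s y⟩ : DualTot F A)) (by rw [hsq]) ?_ (hs.mdifferentiableAt (by simp)) u
    exact ((linFun_smooth X _).add ((f.contMDiff _).comp _ (contMDiffAt_proj _))).mdifferentiableAt
        (by simp)
  obtain ⟨e, h, χ, hχ, hsum, hz⟩ := exists_frame q X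
  have hz := hz hX
  have hχd : ∀ u, dirDeriv 𝓘(ℝ, E) χ q u = 0 := fun u => by
    rw [dirDeriv_congr' hχ]
    unfold dirDeriv
    erw [mfderiv_const]
    rfl
  have e1 : ∀ u, dirDeriv 𝓘(ℝ, E) (fun y => s y (X y)) q u
      = ∑ i, dirDeriv 𝓘(ℝ, E) (h i) q u * a (e i q) := by
    intro u
    have : (fun y => s y (X y)) =ᶠ[nhds q] fun y => ∑ i, h i y * s y (e i y) := by
      filter_upwards [hχ] with y hy
      have h1 := congrArg (fun Z : Cₛ^∞⟮𝓘(ℝ, E); F, A⟯ => s y (Z y)) hsum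
      simp only [sec_sum_apply, map_sum] at h1
      have h2 : (smulSec χ X) y = X y := by
        show χ y • X y = X y
        rw [hy]; simp
      rw [h2] at h1
      rw [h1]
      refine Finset.sum_congr rfl fun i _ => ?_
      exact map_smul (s y) (h i y) (e i y)
    rw [dirDeriv_congr' this, dirDeriv_sum (f := fun i y => h i y * s y (e i y)) _
      (fun i => (hf (h i)).mul (hsX (e i)))]
    refine Finset.sum_congr rfl fun i _ => ?_
    rw [dirDeriv_mul (hf (h i)) (hsX (e i)), hz i, hsq]
    ring
  have e2 : L.bracket X Y q = - ∑ i, dirDeriv 𝓘(ℝ, E) (h i) q (L.anchor q (Y q)) • e i q := by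
    have h1 := bracket_smul_left L χ X Y q
    rw [hχd, hχ.self_of_nhds, Pi.one_apply, one_smul, zero_smul, sub_zero] at h1
    rw [← h1, hsum, map_sum, LinearMap.sum_apply, sec_sum_apply, ← Finset.sum_neg_distrib]
    refine Finset.sum_congr rfl fun i _ => ?_
    rw [bracket_smul_left, hz i]
    simp
  have e3 := hh (L.anchor q (Y q))
  rw [e1] at e3
  refine ⟨hX, ?_⟩
  rw [← e3]
  congr 1
  show - a (L.bracket X Y q) = _
  rw [e2, map_neg, neg_neg, map_sum]
  refine Finset.sum_congr rfl fun i _ => ?_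
  exact map_smul a _ _

theorem affine_mdiff (X : Cₛ^∞⟮𝓘(ℝ, E); F, A⟯) (f : C^∞⟮𝓘(ℝ, E), Q; ℝ⟯) (α : DualTot F A) :
    MDifferentiableAt (dualModel E F) 𝓘(ℝ, ℝ) (fun β => linFun X β + f β.proj) α :=
  ((linFun_smooth X _).add ((f.contMDiff _).comp _ (contMDiffAt_proj _))).mdifferentiableAt (by simp)

theorem exists_bump {q : Q} {u : Set Q} (hu : u ∈ nhds q) :
    ∃ c : SmoothBumpFunction 𝓘(ℝ, E) q, tsupport c ⊆ u := by
  obtain ⟨c, hc, -⟩ := (SmoothBumpFunction.nhds_basis_support (I := 𝓘(ℝ, E)) hu).mem_iff.mp hu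
  exact ⟨c, hc⟩

theorem eq_zero_of_affine (α : DualTot F A) (v : TangentSpace (dualModel E F) α)
    (h : ∀ (X : Cₛ^∞⟮𝓘(ℝ, E); F, A⟯) (f : C^∞⟮𝓘(ℝ, E), Q; ℝ⟯),
      dirDeriv (dualModel E F) (fun β => linFun X β + f β.proj) α v = 0) : v = 0 := by
  have hinv := isInvertible_mfderiv_extChartAt (I := dualModel E F) (mem_extChartAt_source α)
  apply hinv.injective
  refine Eq.trans ?_ (ContinuousLinearMap.map_zero _).symm
  set w := mfderiv (dualModel E F) 𝓘(ℝ, E × (F →L[ℝ] ℝ)) (extChartAt (dualModel E F) α) α v with hw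
  have hch : MDifferentiableAt (dualModel E F) 𝓘(ℝ, E × (F →L[ℝ] ℝ))
      (extChartAt (dualModel E F) α) α := mdifferentiableAt_extChartAt (mem_chart_source _ _)
  have key : ∀ l : E × (F →L[ℝ] ℝ) →L[ℝ] ℝ,
      dirDeriv (dualModel E F) (fun β => l (extChartAt (dualModel E F) α β)) α v
        = l (w : E × (F →L[ℝ] ℝ)) := by
    intro l
    have hl : MDifferentiableAt 𝓘(ℝ, E × (F →L[ℝ] ℝ)) 𝓘(ℝ, ℝ) l (extChartAt (dualModel E F) α α) :=
      l.mdifferentiableAt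
    rw [dirDeriv_comp rfl hl hch]
    unfold dirDeriv
    rw [l.mfderiv_eq]
    rfl
  have hcongr : ∀ {f g : DualTot F A → ℝ}, f =ᶠ[nhds α] g →
      dirDeriv (dualModel E F) f α v = dirDeriv (dualModel E F) g α v := by
    intro f g h
    unfold dirDeriv
    rw [h.mfderiv_eq]
    rfl
  have hproj : Filter.Tendsto (fun β : DualTot F A => β.proj) (nhds α) (nhds α.proj) :=
    (FiberBundle.continuous_proj (F →L[ℝ] ℝ) (DualFib A)).tendsto α
  let t := trivializationAt F A α.proj
  have hq : α.proj ∈ t.baseSet := FiberBundle.mem_baseSet_trivializationAt' α.proj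
  have w1 : ∀ l : E →L[ℝ] ℝ, l (w : E × (F →L[ℝ] ℝ)).1 = 0 := by
    intro l
    obtain ⟨c, hc⟩ := exists_bump (E := E) (q := α.proj) Filter.univ_mem
    let f : C^∞⟮𝓘(ℝ, E), Q; ℝ⟯ := ⟨fun y => c y • l (extChartAt 𝓘(ℝ, E) α.proj y),
      c.contMDiff_smul (l.contMDiff.comp_contMDiffOn contMDiffOn_extChartAt)⟩
    have h1 := h 0 f
    rw [← h1]
    refine (key (l.comp (.fst ℝ E (F →L[ℝ] ℝ)))).symm.trans (hcongr ?_)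
    filter_upwards [hproj.eventually c.eventuallyEq_one] with β hβ
    have : linFun (0 : Cₛ^∞⟮𝓘(ℝ, E); F, A⟯) β = 0 := map_zero β.2
    rw [this, zero_add]
    show l (extChartAt (dualModel E F) α β).1 = c β.proj • l (extChartAt 𝓘(ℝ, E) α.proj β.proj)
    rw [hβ, FiberBundle.extChartAt]
    simp [hom_trivializationAt_apply]
  have w2 : ∀ i, (w : E × (F →L[ℝ] ℝ)).2 (finBasis ℝ F i) = 0 := by
    intro i
    obtain ⟨c, hc⟩ := exists_bump (E := E) (q := α.proj) (t.open_baseSet.mem_nhds hq)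
    let X : Cₛ^∞⟮𝓘(ℝ, E); F, A⟯ := ⟨(c : Q → ℝ) • t.localFrame (finBasis ℝ F) i,
      c.contMDiff.contMDiffOn.smul_section_of_tsupport t.open_baseSet hc
      (t.contMDiffOn_localFrame_baseSet _ _ i)⟩
    have h1 := h X 0
    rw [← h1]
    refine (key ((ContinuousLinearMap.apply ℝ ℝ (finBasis ℝ F i)).comp
      (.snd ℝ E (F →L[ℝ] ℝ)))).symm.trans (hcongr ?_)
    filter_upwards [hproj.eventually c.eventuallyEq_one,
      hproj.eventually (t.open_baseSet.mem_nhds hq)] with β hβ hβ'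
    show (extChartAt (dualModel E F) α β).2 (finBasis ℝ F i)
      = β.2 (c β.proj • t.localFrame (finBasis ℝ F) i β.proj) + 0
    rw [hβ, FiberBundle.extChartAt]
    simp [hom_trivializationAt_apply, ContinuousLinearMap.inCoordinates, t]
    rw [Trivialization.localFrame_apply_of_mem_baseSet _ _ hβ']
    congr 1
    simp only [Trivialization.basisAt, Basis.map_apply]
    exact Trivialization.symmL_apply _ hβ' _
  refine Prod.ext ?_ ?_
  · by_contra h'
    obtain ⟨l, hl⟩ := SeparatingDual.exists_ne_zero (R := ℝ) h'
    exact hl (w1 l)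
  · apply ContinuousLinearMap.coe_injective
    exact (finBasis ℝ F).ext w2

/-- The linear map sending `(X, f)` to the differential of `X̂ + f ∘ τ` at `α`. -/
def affD (α : DualTot F A) : (Cₛ^∞⟮𝓘(ℝ, E); F, A⟯ × C^∞⟮𝓘(ℝ, E), Q; ℝ⟯) →ₗ[ℝ]
    Module.Dual ℝ (TangentSpace (dualModel E F) α) where
  toFun p := (mfderiv (dualModel E F) 𝓘(ℝ, ℝ) (fun β => linFun p.1 β + p.2 β.proj) α).toLinearMap
  map_add' p p' := by
    have h := ((affine_mdiff p.1 p.2 α).hasMFDerivAt.add (affine_mdiff p'.1 p'.2 α).hasMFDerivAt).mfderiv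
    have h2 : (fun β : DualTot F A => linFun (p + p').1 β + (p + p').2 β.proj) =
      (fun β => linFun p.1 β + p.2 β.proj) + fun β => linFun p'.1 β + p'.2 β.proj := by
      funext β
      show β.2 (p.1 β.proj + p'.1 β.proj) + (p.2 β.proj + p'.2 β.proj) =
        (β.2 (p.1 β.proj) + p.2 β.proj) + (β.2 (p'.1 β.proj) + p'.2 β.proj)
      rw [map_add]
      exact add_add_add_comm _ _ _ _
    rw [h2]
    exact congrArg ContinuousLinearMap.toLinearMap h
  map_smul' c p := by
    have h := ((affine_mdiff p.1 p.2 α).hasMFDerivAt.const_smul c).mfderiv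
    have h2 : (fun β : DualTot F A => linFun (c • p).1 β + (c • p).2 β.proj) =
      c • fun β => linFun p.1 β + p.2 β.proj := by
      funext β
      show β.2 (c • p.1 β.proj) + c * p.2 β.proj = c * (β.2 (p.1 β.proj) + p.2 β.proj)
      rw [map_smul]
      exact (mul_add _ _ _).symm
    rw [h2]
    exact congrArg ContinuousLinearMap.toLinearMap h

theorem affD_surj (α : DualTot F A) : Function.Surjective (affD (E := E) α) := by
  haveI : FiniteDimensional ℝ (TangentSpace (dualModel E F) α) :=
    inferInstanceAs (FiniteDimensional ℝ (E × (F →L[ℝ] ℝ)))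
  rw [← LinearMap.range_eq_top, ← Subspace.dualCoannihilator_dualAnnihilator_eq
    (W := LinearMap.range (affD (E := E) α))]
  have : (LinearMap.range (affD (E := E) α)).dualCoannihilator = ⊥ := by
    rw [eq_bot_iff]
    intro v hv
    rw [Submodule.mem_dualCoannihilator] at hv
    exact eq_zero_of_affine α v fun X f => hv _ ⟨(X, f), rfl⟩
  rw [this, Submodule.dualAnnihilator_bot]

/-- The linear map sending `(X, f)` to the value at `α` of `{X̂ + f ∘ τ, Ŷ + g ∘ τ}`. -/
def affB (α : DualTot F A) (Y : Cₛ^∞⟮𝓘(ℝ, E); F, A⟯) (g : C^∞⟮𝓘(ℝ, E), Q; ℝ⟯) :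
    (Cₛ^∞⟮𝓘(ℝ, E); F, A⟯ × C^∞⟮𝓘(ℝ, E), Q; ℝ⟯) →ₗ[ℝ] ℝ where
  toFun p := - linFun (L.bracket p.1 Y) α
        + dirDeriv 𝓘(ℝ, E) p.2 α.proj (L.anchor α.proj (Y α.proj))
        - dirDeriv 𝓘(ℝ, E) g α.proj (L.anchor α.proj (p.1 α.proj))
  map_add' p p' := by
    have h1 : linFun (L.bracket (p + p').1 Y) α
        = linFun (L.bracket p.1 Y) α + linFun (L.bracket p'.1 Y) α := by
      show linFun (L.bracket (p.1 + p'.1) Y) α = _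
      rw [map_add]
      exact map_add α.2 _ _
    have h2 := dirDeriv_add ((p.2.contMDiff α.proj).mdifferentiableAt (by simp))
      ((p'.2.contMDiff α.proj).mdifferentiableAt (by simp)) (L.anchor α.proj (Y α.proj))
    have h3 : dirDeriv 𝓘(ℝ, E) g α.proj (L.anchor α.proj ((p + p').1 α.proj)) =
        dirDeriv 𝓘(ℝ, E) g α.proj (L.anchor α.proj (p.1 α.proj)) +
        dirDeriv 𝓘(ℝ, E) g α.proj (L.anchor α.proj (p'.1 α.proj)) := by
      show dirDeriv 𝓘(ℝ, E) g α.proj (L.anchor α.proj (p.1 α.proj + p'.1 α.proj)) = _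
      rw [(L.anchor α.proj).map_add]
      exact (mfderiv 𝓘(ℝ, E) 𝓘(ℝ, ℝ) g α.proj).map_add _ _
    rw [h1, h3]
    refine (congrArg (fun z => -(_ + _) + z - (_ + _)) h2).trans ?_
    ring
  map_smul' c p := by
    have h1 : linFun (L.bracket (c • p).1 Y) α = c * linFun (L.bracket p.1 Y) α := by
      show linFun (L.bracket (c • p.1) Y) α = _
      rw [map_smul]
      exact map_smul α.2 c _
    have h2 := dirDeriv_mul (mdifferentiableAt_const (c := c))
      ((p.2.contMDiff α.proj).mdifferentiableAt (by simp)) (L.anchor α.proj (Y α.proj))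
    have h4 : dirDeriv 𝓘(ℝ, E) (fun _ : Q => c) α.proj (L.anchor α.proj (Y α.proj)) = 0 := by
      unfold dirDeriv
      rw [mfderiv_const]
      rfl
    rw [h4, mul_zero, add_zero] at h2
    have h3 : dirDeriv 𝓘(ℝ, E) g α.proj (L.anchor α.proj ((c • p).1 α.proj)) =
        c * dirDeriv 𝓘(ℝ, E) g α.proj (L.anchor α.proj (p.1 α.proj)) := by
      show dirDeriv 𝓘(ℝ, E) g α.proj (L.anchor α.proj (c • p.1 α.proj)) = _
      rw [(L.anchor α.proj).map_smul]
      exact (mfderiv 𝓘(ℝ, E) 𝓘(ℝ, ℝ) g α.proj).map_smul _ _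
    rw [h1, h3]
    refine (congrArg (fun z => -(_ * _) + z - (_ * _)) h2).trans ?_
    simp only [RingHom.id_apply, smul_eq_mul]
    ring

theorem affB_ker (α : DualTot F A) (Y : Cₛ^∞⟮𝓘(ℝ, E); F, A⟯) (g : C^∞⟮𝓘(ℝ, E), Q; ℝ⟯)
    (p : Cₛ^∞⟮𝓘(ℝ, E); F, A⟯ × C^∞⟮𝓘(ℝ, E), Q; ℝ⟯) (hp : affD α p = 0) :
    L.affB α Y g p = 0 := by
  have h := L.wd_core α p.1 p.2 (fun v => LinearMap.congr_fun hp v) Y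
  show - linFun (L.bracket p.1 Y) α
        + dirDeriv 𝓘(ℝ, E) p.2 α.proj (L.anchor α.proj (Y α.proj))
        - dirDeriv 𝓘(ℝ, E) g α.proj (L.anchor α.proj (p.1 α.proj)) = 0
  rw [h.2, h.1, (L.anchor α.proj).map_zero, zero_sub, neg_eq_zero]
  exact (mfderiv 𝓘(ℝ, E) 𝓘(ℝ, ℝ) g α.proj).map_zero

theorem affB_congr (α : DualTot F A) (Y : Cₛ^∞⟮𝓘(ℝ, E); F, A⟯) (g : C^∞⟮𝓘(ℝ, E), Q; ℝ⟯)
    (p p' : Cₛ^∞⟮𝓘(ℝ, E); F, A⟯ × C^∞⟮𝓘(ℝ, E), Q; ℝ⟯) (hp : affD α p = affD α p') :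
    L.affB α Y g p = L.affB α Y g p' := by
  rw [← sub_eq_zero, ← map_sub]
  exact L.affB_ker α Y g _ (by rw [map_sub, hp, sub_self])

theorem affB_skew (α : DualTot F A) (X Y : Cₛ^∞⟮𝓘(ℝ, E); F, A⟯) (f g : C^∞⟮𝓘(ℝ, E), Q; ℝ⟯) :
    L.affB α Y g (X, f) = - L.affB α X f (Y, g) := by
  have h : linFun (L.bracket X Y) α = - linFun (L.bracket Y X) α := by
    rw [L.bracket_skew X Y]
    exact map_neg α.2 _
  show - linFun (L.bracket X Y) α + dirDeriv 𝓘(ℝ, E) f α.proj (L.anchor α.proj (Y α.proj))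
        - dirDeriv 𝓘(ℝ, E) g α.proj (L.anchor α.proj (X α.proj)) =
      -(- linFun (L.bracket Y X) α + dirDeriv 𝓘(ℝ, E) g α.proj (L.anchor α.proj (X α.proj))
        - dirDeriv 𝓘(ℝ, E) f α.proj (L.anchor α.proj (Y α.proj)))
  rw [h]
  ring

/-- The value of the bracket does not depend on the choice of `X`, `f`, `Y`, `g`. -/
theorem poissonBracket_eq {φ ψ : DualTot F A → ℝ} {α : DualTot F A}
    {X Y : Cₛ^∞⟮𝓘(ℝ, E); F, A⟯} {f g : C^∞⟮𝓘(ℝ, E), Q; ℝ⟯}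
    (hφ : ∀ v, dirDeriv (dualModel E F) φ α v
        = dirDeriv (dualModel E F) (fun β => linFun X β + f β.proj) α v)
    (hψ : ∀ v, dirDeriv (dualModel E F) ψ α v
        = dirDeriv (dualModel E F) (fun β => linFun Y β + g β.proj) α v) :
    L.poissonBracket φ ψ α = - linFun (L.bracket X Y) α
        + dirDeriv 𝓘(ℝ, E) f α.proj (L.anchor α.proj (Y α.proj))
        - dirDeriv 𝓘(ℝ, E) g α.proj (L.anchor α.proj (X α.proj)) := by
  obtain ⟨X', Y', f', g', h1, h2, h3⟩ := Classical.epsilon_spec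
    (p := fun r : ℝ => ∃ (X Y : Cₛ^∞⟮𝓘(ℝ, E); F, A⟯) (f g : C^∞⟮𝓘(ℝ, E), Q; ℝ⟯),
      (∀ v, dirDeriv (dualModel E F) φ α v
        = dirDeriv (dualModel E F) (fun β => linFun X β + f β.proj) α v) ∧
      (∀ v, dirDeriv (dualModel E F) ψ α v
        = dirDeriv (dualModel E F) (fun β => linFun Y β + g β.proj) α v) ∧
      r = - linFun (L.bracket X Y) α + dirDeriv 𝓘(ℝ, E) f α.proj (L.anchor α.proj (Y α.proj))
        - dirDeriv 𝓘(ℝ, E) g α.proj (L.anchor α.proj (X α.proj)))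
    ⟨_, X, Y, f, g, hφ, hψ, rfl⟩
  refine h3.trans ?_
  show L.affB α Y' g' (X', f') = L.affB α Y g (X, f)
  rw [L.affB_congr α Y' g' (X', f') (X, f) (LinearMap.ext fun v => (h1 v).symm.trans (hφ v)),
    affB_skew, L.affB_congr α X f (Y', g') (Y, g) (LinearMap.ext fun v => (h2 v).symm.trans (hψ v)),
    ← affB_skew]

/-- Every differential at `α` of a function on `A*` is the one of some `X̂ + f ∘ τ`. -/
theorem exists_affine (φ : DualTot F A → ℝ) (α : DualTot F A) :
    ∃ (X : Cₛ^∞⟮𝓘(ℝ, E); F, A⟯) (f : C^∞⟮𝓘(ℝ, E), Q; ℝ⟯),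
      ∀ v, dirDeriv (dualModel E F) φ α v
        = dirDeriv (dualModel E F) (fun β => linFun X β + f β.proj) α v := by
  obtain ⟨p, hp⟩ := affD_surj (E := E) α
    (mfderiv (dualModel E F) 𝓘(ℝ, ℝ) φ α).toLinearMap
  exact ⟨p.1, p.2, fun v => (LinearMap.congr_fun hp v).symm⟩

end WellDefined

/-- The hamiltonian vector field of `H`: the vector field whose value `v` at `α` is the tangent
vector with `v(φ) = {φ, H}(α)` for all smooth functions `φ` on `A*`; it exists and is unique by
`dirDeriv_hamVF` and `hamVF_eq`. -/
def hamVF (H : DualTot F A → ℝ) (α : DualTot F A) : TangentSpace (dualModel E F) α :=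
  Classical.epsilon fun v : TangentSpace (dualModel E F) α =>
    ∀ φ : C^∞⟮dualModel E F, DualTot F A; ℝ⟯,
      dirDeriv (dualModel E F) φ α v = L.poissonBracket φ H α

section WellDefined

variable [FiniteDimensional ℝ E] [FiniteDimensional ℝ F] [T2Space Q]

theorem dirDeriv_hamVF (H : DualTot F A → ℝ) (α : DualTot F A)
    (φ : C^∞⟮dualModel E F, DualTot F A; ℝ⟯) :
    dirDeriv (dualModel E F) φ α (L.hamVF H α) = L.poissonBracket φ H α := by
  refine Classical.epsilon_spec (p := fun v : TangentSpace (dualModel E F) α =>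
    ∀ φ : C^∞⟮dualModel E F, DualTot F A; ℝ⟯,
      dirDeriv (dualModel E F) φ α v = L.poissonBracket φ H α) ?_ φ
  obtain ⟨Y, g, hH⟩ := exists_affine (E := E) H α
  obtain ⟨S, hS⟩ := (affD (E := E) α).exists_rightInverse_of_surjective
    (LinearMap.range_eq_top.mpr (affD_surj α))
  have : FiniteDimensional ℝ (TangentSpace (dualModel E F) α) :=
    inferInstanceAs (FiniteDimensional ℝ (E × (F →L[ℝ] ℝ)))
  refine ⟨(Module.evalEquiv ℝ (TangentSpace (dualModel E F) α)).symm (L.affB α Y g ∘ₗ S),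
    fun φ => ?_⟩
  obtain ⟨X, f, hφ⟩ := exists_affine (E := E) φ α
  rw [L.poissonBracket_eq hφ hH, hφ]
  have h1 := Module.apply_evalEquiv_symm_apply ℝ _ (affD (E := E) α (X, f)) (L.affB α Y g ∘ₗ S)
  refine h1.trans ?_
  exact L.affB_congr α Y g _ (X, f) (LinearMap.congr_fun hS (affD α (X, f)))

theorem hamVF_eq {H : DualTot F A → ℝ} {α : DualTot F A} {v : TangentSpace (dualModel E F) α}
    (hv : ∀ φ : C^∞⟮dualModel E F, DualTot F A; ℝ⟯,
      dirDeriv (dualModel E F) φ α v = L.poissonBracket φ H α) : L.hamVF H α = v := by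
  rw [← sub_eq_zero]
  refine eq_zero_of_affine α _ fun X f => ?_
  let φ : C^∞⟮dualModel E F, DualTot F A; ℝ⟯ := ⟨fun β => linFun X β + f β.proj,
    (linFun_smooth X).add (f.contMDiff.comp (contMDiff_proj _))⟩
  have h := (L.dirDeriv_hamVF H α φ).trans (hv φ).symm
  exact ((mfderiv (dualModel E F) 𝓘(ℝ, ℝ) φ α).map_sub _ _).trans (sub_eq_zero.mpr h)

end WellDefined

/-- The section `𝓜` of `A*` is the modular section of `A` with respect to `ν` and `Λ`: its vertical lift
is the modular vector field `H ↦ div_{ν ∧ Λ}(X_H)` of the linear Poisson structure of `A*` with respect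
to the volume form `ν ∧ Λ`. -/
def IsModularSection {m n : ℕ} (ν : ∀ q : Q, TangentSpace 𝓘(ℝ, E) q [⋀^Fin m]→ₗ[ℝ] ℝ)
    (Λ : ∀ q : Q, DualFib A q [⋀^Fin n]→ₗ[ℝ] ℝ) (𝓜 : ∀ q, DualFib A q) : Prop :=
  ∀ φ : C^∞⟮dualModel E F, DualTot F A; ℝ⟯,
    IsDivergence (dualModel E F) (wedgeVol ν Λ) (L.hamVF φ)
      (fun α => dirDeriv (dualModel E F) φ α (vertLift 𝓜 α))

/-- `A` is unimodular: its modular class vanishes, that is, the modular section with respect to some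
volumes `ν` and `Λ` is `-d^A σ` for some smooth function `σ` on `Q`. (The cohomology class of the modular
section is the same for all choices of `ν` and `Λ`.) -/
def IsUnimodular : Prop :=
  ∃ (ν : ∀ q : Q, TangentSpace 𝓘(ℝ, E) q [⋀^Fin (finrank ℝ E)]→ₗ[ℝ] ℝ)
    (Λ : ∀ q : Q, DualFib A q [⋀^Fin (finrank ℝ F)]→ₗ[ℝ] ℝ)
    (σ : C^∞⟮𝓘(ℝ, E), Q; ℝ⟯),
    IsVolumeForm 𝓘(ℝ, E) ν ∧ IsVolumeSection E F Λ ∧ L.IsModularSection ν Λ (fun q => -L.dA σ q)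

end LieAlgebroid

/-- The form `e^{μ ∘ τ} ν ∧ Λ` on `A*`. -/
def expWedgeVol {m n : ℕ} (μ : Q → ℝ) (ν : ∀ q : Q, TangentSpace 𝓘(ℝ, E) q [⋀^Fin m]→ₗ[ℝ] ℝ)
    (Λ : ∀ q : Q, DualFib A q [⋀^Fin n]→ₗ[ℝ] ℝ) (γ : DualTot F A) :
    TangentSpace (dualModel E F) γ [⋀^Fin m ⊕ Fin n]→ₗ[ℝ] ℝ :=
  Real.exp (μ γ.proj) • wedgeVol ν Λ γ

/-- The form `Φ` on `A*` is of basic type (with respect to `ν` and `Λ`): `Φ = e^{μ ∘ τ} ν ∧ Λ` for some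
smooth function `μ` on `Q`. -/
def IsBasicType {m n : ℕ} (ν : ∀ q : Q, TangentSpace 𝓘(ℝ, E) q [⋀^Fin m]→ₗ[ℝ] ℝ)
    (Λ : ∀ q : Q, DualFib A q [⋀^Fin n]→ₗ[ℝ] ℝ)
    (Φ : ∀ γ : DualTot F A, TangentSpace (dualModel E F) γ [⋀^Fin m ⊕ Fin n]→ₗ[ℝ] ℝ) : Prop :=
  ∃ μ : C^∞⟮𝓘(ℝ, E), Q; ℝ⟯, Φ = expWedgeVol μ ν Λ

section Metric

variable (𝒢 : ContMDiffRiemannianMetric 𝓘(ℝ, E) ∞ F A)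

/-- The bundle metric on the fibre `A_q`, as a bilinear form. -/
def metricForm (q : Q) : LinearMap.BilinForm ℝ (A q) :=
  LinearMap.mk₂ ℝ (fun v w => 𝒢.inner q v w) (by simp) (by simp) (by simp) (by simp)

theorem metricForm_nondegenerate (q : Q) : (metricForm 𝒢 q).Nondegenerate := by
  have key : ∀ v : A q, (∀ w, 𝒢.inner q v w = 0) → v = 0 := fun v hv => by
    by_contra h
    exact (𝒢.pos q v h).ne' (hv v)
  exact ⟨fun v hv => key v hv, fun v hv => key v fun w => (𝒢.symm q v w).trans (hv w)⟩

variable [FiniteDimensional ℝ F]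

/-- The vector `♯α ∈ A_q` with `𝒢(♯α, w) = α(w)` for all `w ∈ A_q`. -/
def sharp (q : Q) (α : DualFib A q) : A q :=
  haveI : FiniteDimensional ℝ (A q) := VectorBundle.finiteDimensional ℝ F A q
  ((metricForm 𝒢 q).toDual (metricForm_nondegenerate 𝒢 q)).symm α.toLinearMap

theorem inner_sharp (q : Q) (α : DualFib A q) (w : A q) : 𝒢.inner q (sharp 𝒢 q α) w = α w := by
  have : FiniteDimensional ℝ (A q) := VectorBundle.finiteDimensional ℝ F A q
  exact LinearMap.BilinForm.apply_toDual_symm_apply (hB := metricForm_nondegenerate 𝒢 q)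
    (f := α.toLinearMap) w

/-- The metric induced by `𝒢` on the fibre `A*_q` of the dual bundle. -/
def dualMetric (q : Q) (α β : DualFib A q) : ℝ :=
  𝒢.inner q (sharp 𝒢 q α) (sharp 𝒢 q β)

/-- The hamiltonian function of mechanical type `H(α) = ½ 𝒢(α, α) + V(τ(α))` on `A*`. -/
def mechHam (V : Q → ℝ) (α : DualTot F A) : ℝ :=
  (1 / 2) * dualMetric 𝒢 α.proj α.2 α.2 + V α.proj

theorem exists_orthonormal (q : Q) : ∃ e : Fin (finrank ℝ F) → DualFib A q,
    ∀ i j, dualMetric 𝒢 q (e i) (e j) = if i = j then 1 else 0 := by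
  have : FiniteDimensional ℝ (A q) := VectorBundle.finiteDimensional ℝ F A q
  let c : InnerProductSpace.Core ℝ (A q) := 𝒢.toRiemannianMetric.toCore q
  let : NormedAddCommGroup (A q) := c.toNormedAddCommGroup
  let : InnerProductSpace ℝ (A q) := .ofCore c.toCore
  have hn : finrank ℝ (A q) = finrank ℝ F := VectorBundle.finrank_eq ℝ F A q
  let b := (stdOrthonormalBasis ℝ (A q)).reindex (finCongr hn)
  have hb : ∀ i j, 𝒢.inner q (b i) (b j) = if i = j then 1 else 0 :=
    orthonormal_iff_ite.mp b.orthonormal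
  refine ⟨fun i => 𝒢.inner q (b i), fun i j => ?_⟩
  have hs : ∀ v : A q, sharp 𝒢 q (𝒢.inner q v) = v := fun v => by
    by_contra h
    have h1 := 𝒢.pos q _ (sub_ne_zero.mpr h)
    rw [map_sub, 𝒢.symm q _ (sharp 𝒢 q (𝒢.inner q v)), inner_sharp, 𝒢.symm q v, sub_self] at h1
    exact lt_irrefl _ h1
  rw [dualMetric, hs, hs, hb]

/-- The volume `Λ^𝒢` induced by the bundle metric `𝒢` on `A`, oriented by the nowhere vanishing section
`Λ₀` of `Λⁿ A`: the positive multiple of `Λ₀` whose value on the orthonormal bases of `A*_q` is `±1`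
(hence `1` on those that are positively oriented). -/
def metricVolume (Λ₀ : ∀ q : Q, DualFib A q [⋀^Fin (finrank ℝ F)]→ₗ[ℝ] ℝ) (q : Q) :
    DualFib A q [⋀^Fin (finrank ℝ F)]→ₗ[ℝ] ℝ :=
  |Λ₀ q (exists_orthonormal 𝒢 q).choose|⁻¹ • Λ₀ q

end Metric
end Algebroid
end LieAlgd
end

/-! The divergence of a hamiltonian vector field is a first order expression in the hamiltonian. In
coordinates the field has components `∑ j, P i j * ∂_j φ` with `P` skew, so the second derivatives
of `φ` cancel in its trace (`trace_fderiv_of_skew`). On `A*` the entries of `P` are constant or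
linear on fibres, and the density of `e^{μ ∘ τ} ν ∧ Λ` is constant on fibres. Only the fibre
derivatives of `φ` survive, with coefficients depending on the base point alone: over each point `q`
the divergence of `𝓗_φ` is `s^v(φ)` for one covector `s(q)` of `A*_q` (`exists_lieDerivForm_hamVF`,
from the chart formula `HasCoordForm.lieDerivForm_eq`).

Since `𝓗_φ(σ ∘ τ) = (d^A σ)^v(φ)` (`dirDeriv_proj_hamVF`), multiplying a volume by `e^{σ ∘ τ}` adds
`d^A σ` to this covector. Hence the modular section is `-d^A σ` exactly when every hamiltonian field
preserves `e^{σ ∘ τ} ν ∧ Λ` (`isModularSection_neg_dA_iff`). A change of volumes multiplies `ν ∧ Λ`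
by a nowhere vanishing function `ρ ∘ τ` and adds `d^A log |ρ|`, so unimodularity may be tested on
`ν` and `Λ^𝒢` (`exists_isModularSection_neg_dA`). This gives the explicit preserved volume and one
implication.

For the converse, suppose that `𝓗_H` preserves `e^{μ ∘ τ} ν ∧ Λ^𝒢`, so that `s^v(H) = 0` on the
whole fibre over `q`. At the point `s(q)` of that fibre, `s^v(H)` equals `𝒢(s(q), s(q))`, because
`H` is quadratic up to a constant (`dirDeriv_mechHam_vertLift_self`). As `𝒢` is positive definite,
`s(q) = 0`. Then all hamiltonian fields preserve the volume (`preserves_hamVF_of_mechHam`), and the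
modular section is `-d^A μ`. -/

open Bundle Module
open scoped Manifold ContDiff

noncomputable section

set_option linter.unusedSectionVars false
set_option linter.style.haveILetI false

namespace LieAlgd

/-! ### Linear algebra: top-degree alternating forms and the trace. -/

section Trace

variable {E ι : Type*} [AddCommGroup E] [Module ℝ E] [Fintype ι] [DecidableEq ι]

/-- The alternating form `z ↦ ∑ i, Δ (z₁, …, A z_i, …, z_d)`. -/
def derivForm (Δ : E [⋀^ι]→ₗ[ℝ] ℝ) (A : E →ₗ[ℝ] E) : E [⋀^ι]→ₗ[ℝ] ℝ :=
  { ∑ k, Δ.toMultilinearMap.compLinearMap (fun i => if i = k then A else LinearMap.id) with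
    map_eq_zero_of_eq' := by
      intro z i j hij hne
      have key : ∀ k, (fun l => (if l = k then A else LinearMap.id) (z l))
          = Function.update z k (A (z k)) := by
        intro k
        funext l
        by_cases h : l = k
        · subst h; simp
        · simp [h]
      simp only [MultilinearMap.toFun_eq_coe, _root_.sum_apply,
        MultilinearMap.compLinearMap_apply, key, AlternatingMap.coe_multilinearMap]
      -- If `z i = z j`, every term other than `i` and `j` still has a repeated vector; those two
      -- terms differ by a transposition and cancel.
      rw [Finset.sum_eq_add (a := i) (b := j) hne]
      · have h1 : Function.update z j (A (z j)) = Function.update z i (A (z i)) ∘ Equiv.swap i j := by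
          funext l
          by_cases hj : l = j
          · subst hj; simp [hij]
          · by_cases hi : l = i
            · subst hi; simp [hj, Ne.symm hne, hij]
            · simp [hi, hj, Equiv.swap_apply_of_ne_of_ne]
        rw [h1, Δ.map_swap _ hne, add_neg_cancel]
      · intro k _ hk
        exact Δ.map_eq_zero_of_eq _ (by simp [hk.1.symm, hk.2.symm, hij]) hne
      · simp
      · simp }

theorem derivForm_apply (Δ : E [⋀^ι]→ₗ[ℝ] ℝ) (A : E →ₗ[ℝ] E) (z : ι → E) :
    derivForm Δ A z = ∑ i, Δ (Function.update z i (A (z i))) := by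
  have key : ∀ k, (fun l => (if l = k then A else LinearMap.id) (z l))
      = Function.update z k (A (z k)) := by
    intro k
    funext l
    by_cases h : l = k
    · subst h; simp
    · simp [h]
  show (∑ k, Δ.toMultilinearMap.compLinearMap (fun i => if i = k then A else LinearMap.id)) z = _
  simp only [_root_.sum_apply, MultilinearMap.compLinearMap_apply, key,
    AlternatingMap.coe_multilinearMap]

/-- Both sides are alternating of top degree in `z`, so it is enough to compare them on permutations
of the basis. There, each `A (b (σ i))` is expanded in the basis: an off-diagonal coefficient
produces a repeated vector, so only the diagonal ones remain. -/
theorem sum_update_eq_trace_mul (b : Basis ι ℝ E) (Δ : E [⋀^ι]→ₗ[ℝ] ℝ) (A : E →ₗ[ℝ] E) (z : ι → E) :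
    ∑ i, Δ (Function.update z i (A (z i))) = (∑ i, b.repr (A (b i)) i) * Δ z := by
  rw [← derivForm_apply]
  suffices derivForm Δ A = (∑ i, b.repr (A (b i)) i) • Δ by rw [this]; rfl
  refine Basis.ext_alternating b fun v hv => ?_
  obtain ⟨σ, rfl⟩ : ∃ σ : Equiv.Perm ι, v = σ :=
    ⟨Equiv.ofBijective v (Finite.injective_iff_bijective.mp hv), rfl⟩
  rw [derivForm_apply, AlternatingMap.smul_apply, smul_eq_mul,
    ← Equiv.sum_comp σ (fun i => b.repr (A (b i)) i), Finset.sum_mul]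
  refine Finset.sum_congr rfl fun i _ => ?_
  conv_lhs => rw [← b.sum_repr (A (b (σ i)))]
  rw [Δ.map_update_sum]
  rw [Finset.sum_eq_single (σ i)]
  · rw [Δ.map_update_smul, smul_eq_mul]
    congr 2
    exact Function.update_eq_self _ _
  · intro j _ hj
    rw [Δ.map_update_smul]
    have : Δ (Function.update (fun i => b (σ i)) i (b j)) = 0 := by
      refine Δ.map_eq_zero_of_eq _ (i := i) (j := σ.symm j) ?_ ?_
      · have : σ.symm j ≠ i := fun h => hj (by rw [← h]; simp)
        simp [this]
      · intro h
        exact hj (by rw [h]; simp)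
    rw [this, smul_zero]
  · simp

end Trace

/-! ### The Lie derivative of a top-degree form in a chart. -/

section Coordinates

variable {E : Type*} [NormedAddCommGroup E] [NormedSpace ℝ E]
  {H : Type*} [TopologicalSpace H] {I : ModelWithCorners ℝ E H} [I.Boundaryless]
  {M : Type*} [TopologicalSpace M] [ChartedSpace H M]
  {ι : Type*}

variable (I) in
/-- The expression of a vector field in the preferred chart at `x`. -/
def coordRep (x : M) (Z : ∀ y : M, TangentSpace I y) : E → E :=
  VectorField.mpullbackWithin 𝓘(ℝ, E) I (extChartAt I x).symm Z (Set.range I)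

variable [IsManifold I ∞ M]

/-- Pulling back by the inverse chart applies the inverse of its derivative, which is the derivative
of the chart. -/
theorem coordRep_apply {x y : M} (hy : y ∈ (extChartAt I x).source)
    (Z : ∀ y : M, TangentSpace I y) :
    coordRep I x Z (extChartAt I x y) = mfderiv I 𝓘(ℝ, E) (extChartAt I x) y (Z y) := by
  haveI : IsManifold I 1 M := IsManifold.of_le (n := ∞) (by simp)
  have hl := mfderiv_extChartAt_comp_mfderivWithin_extChartAt_symm' (I := I) hy
  have hr := mfderivWithin_extChartAt_symm_comp_mfderiv_extChartAt' (I := I) hy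
  have h := ContinuousLinearMap.inverse_eq hr hl
  unfold coordRep
  rw [VectorField.mpullbackWithin_apply]
  -- The pullback evaluates `Z` at the image of `y` under the chart and back, which equals `y` only
  -- propositionally; generalizing that point makes the transport between tangent spaces harmless.
  have key : ∀ y', y' = y → ∀ T : TangentSpace I y' →L[ℝ] E,
      HEq T (mfderiv I 𝓘(ℝ, E) (extChartAt I x) y) →
      T (Z y') = mfderiv I 𝓘(ℝ, E) (extChartAt I x) y (Z y) := by
    rintro _ rfl T hT
    rw [eq_of_heq hT]
    rfl
  exact key _ ((extChartAt I x).left_inv hy) _ (heq_of_eq h)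

/-- The preferred chart at `x` has the identity of `E` as its derivative at `x`. This is what allows
vectors of `T_x M` and of `E` to be identified below. -/
theorem coordRep_self (x : M) (Z : ∀ y : M, TangentSpace I y) :
    coordRep I x Z (extChartAt I x x) = Z x := by
  haveI : IsManifold I 1 M := IsManifold.of_le (n := ∞) (by simp)
  rw [coordRep_apply (mem_extChartAt_source x), mfderiv_extChartAt_self]
  rfl

variable [CompleteSpace E]

theorem SmoothFieldAt.contDiffAt_coordRep {x : M} {Z : ∀ y : M, TangentSpace I y}
    (hZ : SmoothFieldAt I Z x) : ContDiffAt ℝ ∞ (coordRep I x Z) (extChartAt I x x) := by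
  haveI : IsManifold I 1 M := IsManifold.of_le (n := ∞) (by simp)
  have hZ' : ContMDiffWithinAt I I.tangent ∞ (fun y => (⟨y, Z y⟩ : TangentBundle I M)) Set.univ x :=
    hZ.contMDiffWithinAt
  haveI : IsManifold I (∞ + 1) M := inferInstanceAs (IsManifold I ∞ M)
  have h := VectorField.contMDiffWithinAt_mpullbackWithin_extChartAt_symm (n := ∞) hZ'
    uniqueMDiffOn_univ (Set.mem_univ x) le_rfl
  rw [Set.preimage_univ, Set.inter_univ] at h
  have h2 := (contMDiff_snd_tangentBundle_modelSpace E 𝓘(ℝ, E)).contMDiffAt.comp_contMDiffWithinAt _ h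
  have h3 := h2.contMDiffAt (extChartAt_target_mem_nhds x)
  exact h3.contDiffAt

theorem mlieBracket_eq_coordRep (X Z : ∀ y : M, TangentSpace I y) (x : M) :
    VectorField.mlieBracket I X Z x
      = VectorField.lieBracket ℝ (coordRep I x X) (coordRep I x Z) (extChartAt I x x) := by
  haveI : IsManifold I 1 M := IsManifold.of_le (n := ∞) (by simp)
  unfold VectorField.mlieBracket
  rw [VectorField.mlieBracketWithin_apply, mfderiv_extChartAt_self]
  have h1 : ∀ v : E, (ContinuousLinearMap.id ℝ E).inverse v = v := fun v => by
    rw [ContinuousLinearMap.inverse_id]; rfl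
  refine (h1 _).trans ?_
  rw [Set.preimage_univ, Set.univ_inter]
  show VectorField.lieBracketWithin ℝ (coordRep I x X) (coordRep I x Z) (Set.range I) _ = _
  rw [I.range_eq_univ, VectorField.lieBracketWithin_univ]

theorem dirDeriv_eq_fderiv {f : M → ℝ} {g : E → ℝ} {x : M}
    (hg : DifferentiableAt ℝ g (extChartAt I x x))
    (h : f =ᶠ[nhds x] fun y => g (extChartAt I x y)) (v : TangentSpace I x) :
    dirDeriv I f x v = fderiv ℝ g (extChartAt I x x) v := by
  haveI : IsManifold I 1 M := IsManifold.of_le (n := ∞) (by simp)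
  unfold dirDeriv
  have h2 := mfderiv_comp x (I := I) (I' := 𝓘(ℝ, E)) (I'' := 𝓘(ℝ, ℝ)) (g := g)
    hg.mdifferentiableAt (mdifferentiableAt_extChartAt (mem_chart_source _ x))
  rw [h.mfderiv_eq]
  refine (congrArg (fun l : TangentSpace I x →L[ℝ] ℝ => l v) h2).trans ?_
  rw [mfderiv_extChartAt_self, mfderiv_eq_fderiv]
  rfl

theorem dirDeriv_mul_gen {f g : M → ℝ} {x : M} (hf : MDifferentiableAt I 𝓘(ℝ, ℝ) f x)
    (hg : MDifferentiableAt I 𝓘(ℝ, ℝ) g x) (v : TangentSpace I x) :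
    dirDeriv I (fun y => f y * g y) x v = f x * dirDeriv I g x v + g x * dirDeriv I f x v := by
  unfold dirDeriv
  have := (hf.hasMFDerivAt.mul hg.hasMFDerivAt).mfderiv
  exact congrArg (fun l : TangentSpace I x →L[ℝ] ℝ => l v) this

variable [Fintype ι] [DecidableEq ι]

theorem lieDerivForm_smul {X : ∀ y : M, TangentSpace I y}
    {Φ : ∀ x : M, TangentSpace I x [⋀^ι]→ₗ[ℝ] ℝ} {f : M → ℝ} {Z : ι → ∀ y : M, TangentSpace I y} {x : M}
    (hf : MDifferentiableAt I 𝓘(ℝ, ℝ) f x)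
    (hΦ : MDifferentiableAt I 𝓘(ℝ, ℝ) (fun y => Φ y fun i => Z i y) x) :
    lieDerivForm I X (fun y => f y • Φ y) Z x
      = dirDeriv I f x (X x) * Φ x (fun i => Z i x) + f x * lieDerivForm I X Φ Z x := by
  unfold lieDerivForm
  simp only [AlternatingMap.smul_apply, smul_eq_mul]
  rw [dirDeriv_mul_gen hf hΦ, ← Finset.mul_sum]
  ring

/-- `Φ` has near `x` the expression `h • Δ` in the preferred chart at `x`. -/
def HasCoordForm (Φ : ∀ x : M, TangentSpace I x [⋀^ι]→ₗ[ℝ] ℝ) (h : M → ℝ) (Δ : E [⋀^ι]→L[ℝ] ℝ)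
    (x : M) : Prop :=
  ∀ᶠ y in nhds x, ∀ z : ι → TangentSpace I y,
    Φ y z = h y * Δ (fun i => (mfderiv I 𝓘(ℝ, E) (extChartAt I x) y (z i) : E))

theorem HasCoordForm.apply_self {Φ : ∀ x : M, TangentSpace I x [⋀^ι]→ₗ[ℝ] ℝ} {h : M → ℝ}
    {Δ : E [⋀^ι]→L[ℝ] ℝ} {x : M} (hΦ : HasCoordForm Φ h Δ x) (z : ι → TangentSpace I x) :
    Φ x z = h x * Δ z := by
  haveI : IsManifold I 1 M := IsManifold.of_le (n := ∞) (by simp)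
  rw [hΦ.self_of_nhds, mfderiv_extChartAt_self]
  rfl

theorem HasCoordForm.eventuallyEq {Φ : ∀ x : M, TangentSpace I x [⋀^ι]→ₗ[ℝ] ℝ} {h : M → ℝ}
    {Δ : E [⋀^ι]→L[ℝ] ℝ} {x : M} (hΦ : HasCoordForm Φ h Δ x) (Z : ι → ∀ y : M, TangentSpace I y) :
    (fun y => Φ y fun i => Z i y) =ᶠ[nhds x]
      fun y => h y * Δ fun i => coordRep I x (Z i) (extChartAt I x y) := by
  filter_upwards [hΦ, extChartAt_source_mem_nhds (I := I) x] with y hy hys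
  rw [hy]
  congr 2
  funext i
  rw [coordRep_apply hys]

theorem HasCoordForm.contMDiffAt {Φ : ∀ x : M, TangentSpace I x [⋀^ι]→ₗ[ℝ] ℝ} {h : M → ℝ}
    {Δ : E [⋀^ι]→L[ℝ] ℝ} {x : M} (hΦ : HasCoordForm Φ h Δ x) (hh : ContMDiffAt I 𝓘(ℝ, ℝ) ∞ h x)
    {Z : ι → ∀ y : M, TangentSpace I y} (hZ : ∀ i, SmoothFieldAt I (Z i) x) :
    ContMDiffAt I 𝓘(ℝ, ℝ) ∞ (fun y => Φ y fun i => Z i y) x := by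
  refine ContMDiffAt.congr_of_eventuallyEq ?_ (hΦ.eventuallyEq Z)
  have h1 : ContDiffAt ℝ ∞ (fun w => Δ fun i => coordRep I x (Z i) w) (extChartAt I x x) :=
    Δ.toContinuousMultilinearMap.contDiff.contDiffAt.comp _
      (contDiffAt_pi.mpr fun i => (hZ i).contDiffAt_coordRep)
  exact hh.mul (h1.contMDiffAt.comp x contMDiffAt_extChartAt)

/-- This is `ℒ_X (h Δ) = (X(h) + h tr DX) Δ` for constant `Δ`. The derivatives of the `Z i` produced
by the product rule cancel those in the brackets `[X, Z i]`; what remains is `∑ i, Δ (…, DX(Z i),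
…)`, a trace by `sum_update_eq_trace_mul`. -/
theorem HasCoordForm.lieDerivForm_eq {Φ : ∀ x : M, TangentSpace I x [⋀^ι]→ₗ[ℝ] ℝ} {h : M → ℝ}
    {Δ : E [⋀^ι]→L[ℝ] ℝ} {x : M} (hΦ : HasCoordForm Φ h Δ x) (b : Basis ι ℝ E)
    (hh : MDifferentiableAt I 𝓘(ℝ, ℝ) h x) {X : ∀ y : M, TangentSpace I y}
    {Z : ι → ∀ y : M, TangentSpace I y} (hZ : ∀ i, SmoothFieldAt I (Z i) x) :
    lieDerivForm I X Φ Z x = (dirDeriv I h x (X x)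
      + h x * ∑ i, b.repr (fderiv ℝ (coordRep I x X) (extChartAt I x x) (b i)) i)
        * Δ (fun i => Z i x) := by
  set w := extChartAt I x x
  have hZd : ∀ i, DifferentiableAt ℝ (coordRep I x (Z i)) w := fun i =>
    (hZ i).contDiffAt_coordRep.differentiableAt (by simp)
  have hΔ := HasFDerivAt.multilinear_comp Δ.toContinuousMultilinearMap
    (fun i => (hZd i).hasFDerivAt)
  have hΔm : MDifferentiableAt I 𝓘(ℝ, ℝ)
      (fun y => Δ fun i => coordRep I x (Z i) (extChartAt I x y)) x := by
    have : MDifferentiableAt 𝓘(ℝ, E) 𝓘(ℝ, ℝ) (fun w => Δ fun i => coordRep I x (Z i) w) w :=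
      hΔ.differentiableAt.mdifferentiableAt
    exact MDifferentiableAt.comp (I' := 𝓘(ℝ, E)) (f := extChartAt I x) x this
      ((contMDiffAt_extChartAt (n := ∞)).mdifferentiableAt (by simp))
  unfold lieDerivForm
  have e1 : dirDeriv I (fun y => Φ y fun i => Z i y) x (X x)
      = h x * ∑ i, Δ (Function.update (fun j => Z j x) i (fderiv ℝ (coordRep I x (Z i)) w (X x)))
        + Δ (fun i => Z i x) * dirDeriv I h x (X x) := by
    have : dirDeriv I (fun y => Φ y fun i => Z i y) x (X x) = dirDeriv I
        (fun y => h y * Δ fun i => coordRep I x (Z i) (extChartAt I x y)) x (X x) := by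
      unfold dirDeriv
      rw [(hΦ.eventuallyEq Z).mfderiv_eq]
      rfl
    rw [this, dirDeriv_mul_gen hh hΔm]
    congr 2
    · rw [dirDeriv_eq_fderiv (g := fun w => Δ fun i => coordRep I x (Z i) w) hΔ.differentiableAt
        (Filter.EventuallyEq.refl _ _)]
      refine (congrArg (fun l : E →L[ℝ] ℝ => l (X x)) hΔ.fderiv).trans ?_
      refine (_root_.sum_apply _ _ (X x : E)).trans ?_
      refine Finset.sum_congr rfl fun i _ => ?_
      show Δ (Function.update (fun j => coordRep I x (Z j) w) i _) = _
      simp only [w, coordRep_self]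
      rfl
    · simp only [coordRep_self]
  have e2 : ∀ i, Φ x (Function.update (fun j => Z j x) i (VectorField.mlieBracket I X (Z i) x))
      = h x * (Δ (Function.update (fun j => Z j x) i (fderiv ℝ (coordRep I x (Z i)) w (X x)))
        - Δ (Function.update (fun j => Z j x) i (fderiv ℝ (coordRep I x X) w (Z i x)))) := by
    intro i
    rw [hΦ.apply_self, mlieBracket_eq_coordRep]
    unfold VectorField.lieBracket
    rw [coordRep_self, coordRep_self]
    congr 1
    exact Δ.map_update_sub _ _ _ _
  rw [e1, Finset.sum_congr rfl fun i _ => e2 i, ← Finset.mul_sum, Finset.sum_sub_distrib]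
  have e3 := sum_update_eq_trace_mul b Δ.toAlternatingMap (fderiv ℝ (coordRep I x X) w).toLinearMap
    (fun j => Z j x)
  have e4 : ∑ i, Δ (Function.update (fun j => Z j x) i (fderiv ℝ (coordRep I x X) w (Z i x)))
    = (∑ i, b.repr (fderiv ℝ (coordRep I x X) w (b i)) i) * Δ (fun j => Z j x) := e3
  rw [e4]
  ring

end Coordinates

/-! ### Evaluation of an exterior product on adapted vectors. -/

section Wedge

/-- Every shuffle other than the trivial one feeds a vector of the second block to `a`, and `ha`
kills it. With `a` pulled back from the base and the second block vertical, this is the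
characterization of `ν ∧ Λ`. -/
theorem mul'_domCoprod_apply {N ιa ιb : Type*} [AddCommGroup N] [Module ℝ N] [Fintype ιa] [Fintype ιb]
    [DecidableEq ιa] [DecidableEq ιb] (a : N [⋀^ιa]→ₗ[ℝ] ℝ) (b : N [⋀^ιb]→ₗ[ℝ] ℝ) (v : ιa ⊕ ιb → N)
    (ha : ∀ u : ιa → N, (∃ i j, u i = v (Sum.inr j)) → a u = 0) :
    (LinearMap.mul' ℝ ℝ).compAlternatingMap (a.domCoprod b) v
      = a (fun i => v (Sum.inl i)) * b (fun j => v (Sum.inr j)) := by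
  show LinearMap.mul' ℝ ℝ ((∑ σ : Equiv.Perm.ModSumCongr ιa ιb,
    AlternatingMap.domCoprod.summand a b σ) v) = _
  rw [_root_.sum_apply]
  refine (congrArg _ (Finset.sum_eq_single (Quotient.mk'' 1) ?_ ?_)).trans ?_
  rotate_left 2
  · rw [AlternatingMap.domCoprod.summand_mk'']
    simp
  · intro σ _
    induction σ using Quotient.inductionOn' with | _ σ
    intro hσ
    rw [AlternatingMap.domCoprod.summand_mk'']
    -- Otherwise `σ` maps the first block into itself, hence preserves both blocks and represents
    -- the trivial coset.
    have : ∃ i j, σ (Sum.inl i) = Sum.inr j := by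
      by_contra! h
      apply hσ
      have h2 : σ ∈ (Equiv.Perm.sumCongrHom ιa ιb).range := by
        refine Equiv.Perm.mem_sumCongrHom_range_of_perm_mapsTo_inl ?_
        rintro _ ⟨i, rfl⟩
        rcases h3 : σ (Sum.inl i) with i' | j
        · exact ⟨i', rfl⟩
        · exact absurd h3 (h i j)
      refine (Quotient.sound' ?_).symm
      rw [QuotientGroup.leftRel_apply]
      simpa using h2
    obtain ⟨i, j, hij⟩ := this
    have h0 : a (fun i => v (σ (Sum.inl i))) = 0 := ha _ ⟨i, j, by simp [hij]⟩
    simp [h0]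
  · simp

end Wedge

/-! ### Charts of `A*` and vertical lifts. -/

section WedgeVol

variable {E : Type*} [NormedAddCommGroup E] [NormedSpace ℝ E]
  {Q : Type*} [TopologicalSpace Q] [ChartedSpace E Q]
  {F : Type*} [NormedAddCommGroup F] [NormedSpace ℝ F]
  {A : Q → Type*} [∀ q, AddCommGroup (A q)] [∀ q, Module ℝ (A q)] [∀ q, TopologicalSpace (A q)]
  [∀ q, IsTopologicalAddGroup (A q)] [∀ q, ContinuousSMul ℝ (A q)]
  [TopologicalSpace (TotalSpace F A)] [FiberBundle F A] [VectorBundle ℝ F A]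

theorem extChartAt_dual_apply (α β : DualTot F A)
    (hβ : β.proj ∈ (trivializationAt (F →L[ℝ] ℝ) (DualFib A) α.proj).baseSet) :
    extChartAt (dualModel E F) α β = (extChartAt 𝓘(ℝ, E) α.proj β.proj,
      (trivializationAt (F →L[ℝ] ℝ) (DualFib A) α.proj β).2) := by
  rw [FiberBundle.extChartAt]
  show (extChartAt 𝓘(ℝ, E) α.proj (trivializationAt (F →L[ℝ] ℝ) (DualFib A) α.proj β).1,
    (trivializationAt (F →L[ℝ] ℝ) (DualFib A) α.proj β).2) = _
  rw [Trivialization.coe_fst' _ hβ]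

variable [IsManifold 𝓘(ℝ, E) ∞ Q] [ContMDiffVectorBundle ∞ F A 𝓘(ℝ, E)]
  [FiniteDimensional ℝ E] [FiniteDimensional ℝ F] [T2Space Q]

theorem contMDiffAt_triv_snd (q : Q) {γ : DualTot F A}
    (hγ : γ.proj ∈ (trivializationAt (F →L[ℝ] ℝ) (DualFib A) q).baseSet) :
    ContMDiffAt (dualModel E F) 𝓘(ℝ, F →L[ℝ] ℝ) ∞
      (fun β : DualTot F A => (trivializationAt (F →L[ℝ] ℝ) (DualFib A) q β).2) γ := by
  set e := trivializationAt (F →L[ℝ] ℝ) (DualFib A) q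
  have h := e.contMDiffOn (n := ∞) (IB := 𝓘(ℝ, E))
  have h2 := (h γ (e.mem_source.mpr hγ)).contMDiffAt (e.open_source.mem_nhds (e.mem_source.mpr hγ))
  exact contMDiffAt_snd.comp γ h2

theorem mfderiv_proj_vertLift (α : ∀ q, DualFib A q) (γ : DualTot F A) :
    mfderiv (dualModel E F) 𝓘(ℝ, E) (fun β : DualTot F A => β.proj) γ (vertLift α γ) = 0 := by
  have hc := LieAlgebroid.curve_mdifferentiableAt (E := E) γ (α γ.proj)
  have hz : (⟨γ.proj, γ.2 + (0 : ℝ) • α γ.proj⟩ : DualTot F A) = γ := by simp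
  have hg : MDifferentiableAt (dualModel E F) 𝓘(ℝ, E) (fun β : DualTot F A => β.proj)
      (⟨γ.proj, γ.2 + (0 : ℝ) • α γ.proj⟩ : DualTot F A) :=
    (contMDiffAt_proj (n := ∞) _).mdifferentiableAt (by simp)
  have h := mfderiv_comp (0 : ℝ) hg hc
  rw [hz] at h
  have h2 := congrArg (fun l : ℝ →L[ℝ] E => l 1) h
  refine h2.symm.trans ?_
  have h3 : mfderiv 𝓘(ℝ, ℝ) 𝓘(ℝ, E) (fun _ : ℝ => γ.proj) 0 = 0 := mfderiv_const
  exact congrArg (fun l : ℝ →L[ℝ] E => l 1) h3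

/-- The trivialization is linear on fibres, so it turns the curve defining the vertical lift into a
straight line. The trivialization may be centred away from `γ`. -/
theorem mfderiv_triv_vertLift (q : Q) (α : ∀ q, DualFib A q) (γ : DualTot F A)
    (hγ : γ.proj ∈ (trivializationAt (F →L[ℝ] ℝ) (DualFib A) q).baseSet) :
    mfderiv (dualModel E F) 𝓘(ℝ, F →L[ℝ] ℝ)
      (fun β : DualTot F A => (trivializationAt (F →L[ℝ] ℝ) (DualFib A) q β).2) γ (vertLift α γ)
      = (trivializationAt (F →L[ℝ] ℝ) (DualFib A) q ⟨γ.proj, α γ.proj⟩).2 := by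
  set e := trivializationAt (F →L[ℝ] ℝ) (DualFib A) q
  have hc := LieAlgebroid.curve_mdifferentiableAt (E := E) γ (α γ.proj)
  have hz : (⟨γ.proj, γ.2 + (0 : ℝ) • α γ.proj⟩ : DualTot F A) = γ := by simp
  have hg : MDifferentiableAt (dualModel E F) 𝓘(ℝ, F →L[ℝ] ℝ) (fun β : DualTot F A => (e β).2)
      (⟨γ.proj, γ.2 + (0 : ℝ) • α γ.proj⟩ : DualTot F A) :=
    (contMDiffAt_triv_snd q (γ := ⟨γ.proj, γ.2 + (0 : ℝ) • α γ.proj⟩) hγ).mdifferentiableAt (by simp)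
  have h := mfderiv_comp (0 : ℝ) hg hc
  rw [hz] at h
  have h2 := congrArg (fun l : ℝ →L[ℝ] (F →L[ℝ] ℝ) => l 1) h
  refine h2.symm.trans ?_
  have h3 : ((fun β : DualTot F A => (e β).2) ∘ fun t : ℝ =>
      (⟨γ.proj, γ.2 + t • α γ.proj⟩ : DualTot F A)) =
      fun t : ℝ => (e (⟨γ.proj, γ.2⟩ : DualTot F A)).2 + t • (e (⟨γ.proj, α γ.proj⟩ : DualTot F A)).2 := by
    funext t
    show (e (⟨γ.proj, γ.2 + t • α γ.proj⟩ : DualTot F A)).2 = _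
    rw [(e.linear ℝ hγ).map_add, (e.linear ℝ hγ).map_smul]
  rw [h3]
  refine (congrArg (fun l : ℝ →L[ℝ] (F →L[ℝ] ℝ) => l 1) mfderiv_eq_fderiv).trans ?_
  refine (fderiv_apply_one_eq_deriv).trans ?_
  have h4 := ((hasDerivAt_id (0:ℝ)).smul_const
    (e (⟨γ.proj, α γ.proj⟩ : DualTot F A)).2).const_add (e (⟨γ.proj, γ.2⟩ : DualTot F A)).2
  simpa using h4.deriv

/-- The chart at `α` is the base chart together with the fibre coordinate, and the chain rule
applies to each. The point `γ` is not only `α`, since coordinate expressions of forms are needed on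
a neighbourhood. -/
theorem mfderiv_extChartAt_dual (α γ : DualTot F A)
    (hγ : γ ∈ (extChartAt (dualModel E F) α).source)
    (hγ' : γ.proj ∈ (trivializationAt (F →L[ℝ] ℝ) (DualFib A) α.proj).baseSet)
    (hγc : γ.proj ∈ (extChartAt 𝓘(ℝ, E) α.proj).source)
    (z : TangentSpace (dualModel E F) γ) :
    (mfderiv (dualModel E F) 𝓘(ℝ, E × (F →L[ℝ] ℝ)) (extChartAt (dualModel E F) α) γ z :
      E × (F →L[ℝ] ℝ))
      = (mfderiv 𝓘(ℝ, E) 𝓘(ℝ, E) (extChartAt 𝓘(ℝ, E) α.proj) γ.proj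
          (mfderiv (dualModel E F) 𝓘(ℝ, E) (fun β : DualTot F A => β.proj) γ z),
        mfderiv (dualModel E F) 𝓘(ℝ, F →L[ℝ] ℝ)
          (fun β : DualTot F A => (trivializationAt (F →L[ℝ] ℝ) (DualFib A) α.proj β).2) γ z) := by
  set e := trivializationAt (F →L[ℝ] ℝ) (DualFib A) α.proj
  have hd : MDifferentiableAt (dualModel E F) 𝓘(ℝ, E × (F →L[ℝ] ℝ))
      (extChartAt (dualModel E F) α) γ := mdifferentiableAt_extChartAt (by simpa using hγ)
  have hev : ∀ᶠ β : DualTot F A in nhds γ, β.proj ∈ e.baseSet :=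
    (FiberBundle.continuous_proj (F →L[ℝ] ℝ) (DualFib A)).tendsto γ
      (e.open_baseSet.mem_nhds hγ')
  have hp : MDifferentiableAt (dualModel E F) 𝓘(ℝ, E) (fun β : DualTot F A => β.proj) γ :=
    (contMDiffAt_proj (n := ∞) _).mdifferentiableAt (by simp)
  have hk : MDifferentiableAt 𝓘(ℝ, E) 𝓘(ℝ, E) (extChartAt 𝓘(ℝ, E) α.proj) γ.proj :=
    mdifferentiableAt_extChartAt (by simpa using hγc)
  refine Prod.ext ?_ ?_
  · have h1 := mfderiv_comp γ (I'' := 𝓘(ℝ, E))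
      (ContinuousLinearMap.fst ℝ E (F →L[ℝ] ℝ)).mdifferentiableAt hd
    have h2 : (ContinuousLinearMap.fst ℝ E (F →L[ℝ] ℝ)) ∘ (extChartAt (dualModel E F) α)
        =ᶠ[nhds γ] (extChartAt 𝓘(ℝ, E) α.proj) ∘ (fun β : DualTot F A => β.proj) := by
      filter_upwards [hev] with β hβ
      exact congrArg Prod.fst (extChartAt_dual_apply α β hβ)
    rw [h2.mfderiv_eq, mfderiv_comp γ hk hp, ContinuousLinearMap.mfderiv_eq] at h1
    exact (congrArg (fun l : E × (F →L[ℝ] ℝ) →L[ℝ] E => l z) h1).symm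
  · have h1 := mfderiv_comp γ (I'' := 𝓘(ℝ, F →L[ℝ] ℝ))
      (ContinuousLinearMap.snd ℝ E (F →L[ℝ] ℝ)).mdifferentiableAt hd
    have h2 : (ContinuousLinearMap.snd ℝ E (F →L[ℝ] ℝ)) ∘ (extChartAt (dualModel E F) α)
        =ᶠ[nhds γ] (fun β : DualTot F A => (e β).2) := by
      filter_upwards [hev] with β hβ
      exact congrArg Prod.snd (extChartAt_dual_apply α β hβ)
    rw [h2.mfderiv_eq, ContinuousLinearMap.mfderiv_eq] at h1
    exact (congrArg (fun l : E × (F →L[ℝ] ℝ) →L[ℝ] (F →L[ℝ] ℝ) => l z) h1).symm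

end WedgeVol

/-! ### Coordinate frames and the density of `ν ∧ Λ`. -/

section Density

variable {E : Type*} [NormedAddCommGroup E] [NormedSpace ℝ E]
  {Q : Type*} [TopologicalSpace Q] [ChartedSpace E Q]
  {F : Type*} [NormedAddCommGroup F] [NormedSpace ℝ F]
  {A : Q → Type*} [∀ q, AddCommGroup (A q)] [∀ q, Module ℝ (A q)] [∀ q, TopologicalSpace (A q)]
  [∀ q, IsTopologicalAddGroup (A q)] [∀ q, ContinuousSMul ℝ (A q)]
  [TopologicalSpace (TotalSpace F A)] [FiberBundle F A] [VectorBundle ℝ F A]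
  [IsManifold 𝓘(ℝ, E) ∞ Q] [ContMDiffVectorBundle ∞ F A 𝓘(ℝ, E)]
  [FiniteDimensional ℝ E] [FiniteDimensional ℝ F] [T2Space Q]

variable (F) in
/-- The basis of the dual of `F` that is dual to the chosen basis of `F`. -/
def finDualBasis : Basis (Fin (finrank ℝ F)) ℝ (F →L[ℝ] ℝ) :=
  (finBasis ℝ F).dualBasis.map LinearMap.toContinuousLinearMap

theorem finDualBasis_apply (i j : Fin (finrank ℝ F)) :
    finDualBasis F i (finBasis ℝ F j) = if j = i then 1 else 0 := by
  simp [finDualBasis, Finsupp.single_apply]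

theorem finDualBasis_repr (p : F →L[ℝ] ℝ) (i : Fin (finrank ℝ F)) :
    (finDualBasis F).repr p i = p (finBasis ℝ F i) := by
  conv_rhs => rw [← (finDualBasis F).sum_repr p]
  rw [_root_.sum_apply]
  simp [finDualBasis_apply]

variable (E F) in
/-- The chosen basis of the model space of `A*`. -/
def modelBasis : Basis (Fin (finrank ℝ E) ⊕ Fin (finrank ℝ F)) ℝ (E × (F →L[ℝ] ℝ)) :=
  (finBasis ℝ E).prod (finDualBasis F)

theorem modelBasis_inl (i : Fin (finrank ℝ E)) :
    modelBasis E F (Sum.inl i) = (finBasis ℝ E i, 0) := by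
  simp [modelBasis]

theorem modelBasis_inr (j : Fin (finrank ℝ F)) :
    modelBasis E F (Sum.inr j) = (0, finDualBasis F j) := by
  simp [modelBasis]

theorem modelBasis_repr_inl (w : E × (F →L[ℝ] ℝ)) (i : Fin (finrank ℝ E)) :
    (modelBasis E F).repr w (Sum.inl i) = (finBasis ℝ E).repr w.1 i := by
  simp [modelBasis]

theorem modelBasis_repr_inr (w : E × (F →L[ℝ] ℝ)) (j : Fin (finrank ℝ F)) :
    (modelBasis E F).repr w (Sum.inr j) = w.2 (finBasis ℝ F j) := by
  simp [modelBasis, finDualBasis_repr]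

variable (E F) in
/-- The determinant form of the chosen basis of the model space of `A*`. -/
def modelDet : (E × (F →L[ℝ] ℝ)) [⋀^Fin (finrank ℝ E) ⊕ Fin (finrank ℝ F)]→L[ℝ] ℝ :=
  { (modelBasis E F).det with
    cont := by
      show Continuous fun v : Fin (finrank ℝ E) ⊕ Fin (finrank ℝ F) → E × (F →L[ℝ] ℝ) =>
        (modelBasis E F).det v
      simp only [Basis.det_apply]
      refine Continuous.matrix_det (continuous_matrix fun i j => ?_)
      have h := ((modelBasis E F).coord i).continuous_of_finiteDimensional
      exact h.comp (continuous_apply j) }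

theorem modelDet_apply (v : Fin (finrank ℝ E) ⊕ Fin (finrank ℝ F) → E × (F →L[ℝ] ℝ)) :
    modelDet E F v = (modelBasis E F).det v := rfl

variable (E) in
/-- The coordinate vector fields on `Q` near `q`. -/
def baseFrame (q : Q) (i : Fin (finrank ℝ E)) (y : Q) : TangentSpace 𝓘(ℝ, E) y :=
  haveI : IsManifold 𝓘(ℝ, E) 1 Q := IsManifold.of_le (n := ∞) (by simp)
  (trivializationAt E (TangentSpace 𝓘(ℝ, E)) q).localFrame (finBasis ℝ E) i y

theorem smoothFieldAt_baseFrame (q : Q) (i : Fin (finrank ℝ E)) :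
    SmoothFieldAt 𝓘(ℝ, E) (baseFrame E q i) q := by
  haveI : IsManifold 𝓘(ℝ, E) 1 Q := IsManifold.of_le (n := ∞) (by simp)
  haveI : IsManifold 𝓘(ℝ, E) (∞ + 1) Q := inferInstanceAs (IsManifold 𝓘(ℝ, E) ∞ Q)
  haveI : ContMDiffVectorBundle ∞ E (TangentSpace 𝓘(ℝ, E) : Q → Type _) 𝓘(ℝ, E) :=
    TangentBundle.contMDiffVectorBundle
  exact contMDiffAt_localFrame_of_mem ∞ (trivializationAt E (TangentSpace 𝓘(ℝ, E)) q) (finBasis ℝ E) i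
    (FiberBundle.mem_baseSet_trivializationAt' q)

/-- On the chart domain the preferred trivialization of `TQ` is the derivative of the chart. -/
theorem mfderiv_extChartAt_baseFrame (q y : Q) (hy : y ∈ (extChartAt 𝓘(ℝ, E) q).source)
    (i : Fin (finrank ℝ E)) :
    mfderiv 𝓘(ℝ, E) 𝓘(ℝ, E) (extChartAt 𝓘(ℝ, E) q) y (baseFrame E q i y) = finBasis ℝ E i := by
  haveI : IsManifold 𝓘(ℝ, E) 1 Q := IsManifold.of_le (n := ∞) (by simp)
  have hy2 : y ∈ (chartAt E q).source := by simpa using hy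
  have hy3 : y ∈ (trivializationAt E (TangentSpace 𝓘(ℝ, E)) q).baseSet := by
    rwa [TangentBundle.trivializationAt_baseSet]
  rw [← TangentBundle.continuousLinearMapAt_trivializationAt hy2]
  unfold baseFrame
  rw [Trivialization.localFrame_apply_of_mem_baseSet _ _ hy3]
  simp only [Trivialization.basisAt, Basis.map_apply]
  have h := Trivialization.continuousLinearMapAt_symmL (R := ℝ)
    (trivializationAt E (TangentSpace 𝓘(ℝ, E)) q) hy3 (finBasis ℝ E i)
  rw [Trivialization.symmL_apply _ hy3] at h
  exact h

/-- The sections of `A*` near `q` that are constant in the preferred trivialization. -/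
def dualFrame (q : Q) (j : Fin (finrank ℝ F)) (y : Q) : DualFib A y :=
  (trivializationAt (F →L[ℝ] ℝ) (DualFib A) q).localFrame (finDualBasis F) j y

theorem contMDiffAt_dualFrame (q : Q) (j : Fin (finrank ℝ F)) :
    ContMDiffAt 𝓘(ℝ, E) (dualModel E F) ∞ (fun y => (⟨y, dualFrame q j y⟩ : DualTot F A)) q :=
  contMDiffAt_localFrame_of_mem ∞ (trivializationAt (F →L[ℝ] ℝ) (DualFib A) q) (finDualBasis F) j
    (FiberBundle.mem_baseSet_trivializationAt' q)

theorem triv_dualFrame (q y : Q) (hy : y ∈ (trivializationAt (F →L[ℝ] ℝ) (DualFib A) q).baseSet)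
    (j : Fin (finrank ℝ F)) :
    (trivializationAt (F →L[ℝ] ℝ) (DualFib A) q ⟨y, dualFrame q j y⟩).2 = finDualBasis F j := by
  unfold dualFrame
  rw [Trivialization.localFrame_apply_of_mem_baseSet _ _ hy]
  simp only [Trivialization.basisAt, Basis.map_apply]
  exact congrArg Prod.snd
    ((trivializationAt (F →L[ℝ] ℝ) (DualFib A) q).apply_mk_symm hy (finDualBasis F j))

theorem vertProj_vertLift (α : ∀ q, DualFib A q) (γ : DualTot F A) :
    vertProj (E := E) γ (vertLift α γ) = α γ.proj := by
  have hy : γ.proj ∈ (trivializationAt (F →L[ℝ] ℝ) (DualFib A) γ.proj).baseSet :=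
    FiberBundle.mem_baseSet_trivializationAt' γ.proj
  show (trivializationAt (F →L[ℝ] ℝ) (DualFib A) γ.proj).symmL ℝ γ.proj
    (mfderiv (dualModel E F) 𝓘(ℝ, F →L[ℝ] ℝ) (fun β : DualTot F A =>
      (trivializationAt (F →L[ℝ] ℝ) (DualFib A) γ.proj β).2) γ (vertLift α γ)) = _
  rw [mfderiv_triv_vertLift γ.proj α γ hy]
  rw [Trivialization.symmL_apply _ hy]
  exact (trivializationAt (F →L[ℝ] ℝ) (DualFib A) γ.proj).symm_apply_apply_mk hy (α γ.proj)

/-- The density of `ν ∧ Λ` in the preferred coordinates over a neighbourhood of `q`. -/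
def wedgeDensity (ν : ∀ q : Q, TangentSpace 𝓘(ℝ, E) q [⋀^Fin (finrank ℝ E)]→ₗ[ℝ] ℝ)
    (Λ : ∀ q : Q, DualFib A q [⋀^Fin (finrank ℝ F)]→ₗ[ℝ] ℝ) (q y : Q) : ℝ :=
  ν y (fun i => baseFrame E q i y) * Λ y (fun j => dualFrame q j y)

/-- A top-degree form is determined by its value on one basis. On the coordinate basis of `T_γ A*`,
whose base vectors project to the coordinate fields of `Q` and whose fibre vectors are vertical
lifts, `mul'_domCoprod_apply` gives the product of the two densities. In particular the density is
constant along the fibres. -/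
theorem wedgeVol_hasCoordForm (ν : ∀ q : Q, TangentSpace 𝓘(ℝ, E) q [⋀^Fin (finrank ℝ E)]→ₗ[ℝ] ℝ)
    (Λ : ∀ q : Q, DualFib A q [⋀^Fin (finrank ℝ F)]→ₗ[ℝ] ℝ) (α : DualTot F A) :
    HasCoordForm (I := dualModel E F) (wedgeVol ν Λ)
      (fun γ => wedgeDensity ν Λ α.proj γ.proj) (modelDet E F) α := by
  haveI : IsManifold 𝓘(ℝ, E) 1 Q := IsManifold.of_le (n := ∞) (by simp)
  haveI : IsManifold (dualModel E F) 1 (DualTot F A) := IsManifold.of_le (n := ∞) (by simp)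
  set e := trivializationAt (F →L[ℝ] ℝ) (DualFib A) α.proj
  have hproj := (FiberBundle.continuous_proj (F →L[ℝ] ℝ) (DualFib A)).tendsto α
  filter_upwards [extChartAt_source_mem_nhds (I := dualModel E F) α,
    hproj (e.open_baseSet.mem_nhds (FiberBundle.mem_baseSet_trivializationAt' α.proj)),
    hproj (extChartAt_source_mem_nhds (I := 𝓘(ℝ, E)) α.proj)] with γ hγ hγe hγc z
  obtain ⟨T, hTz⟩ : ∃ T : TangentSpace (dualModel E F) γ ≃L[ℝ] (E × (F →L[ℝ] ℝ)), ∀ z,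
      (mfderiv (dualModel E F) 𝓘(ℝ, E × (F →L[ℝ] ℝ)) (extChartAt (dualModel E F) α) γ z :
      E × (F →L[ℝ] ℝ)) = T z := by
    obtain ⟨T, hT⟩ := isInvertible_mfderiv_extChartAt (I := dualModel E F) hγ
    exact ⟨T, fun z => by rw [← hT]; rfl⟩
  have hK := (isInvertible_mfderiv_extChartAt (I := 𝓘(ℝ, E)) hγc).injective
  have hD := mfderiv_extChartAt_dual α γ hγ hγe hγc
  simp only [hTz] at hD ⊢
  -- The coordinate basis of `T_γ A*`: the model basis transported by the inverse of the derivative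
  -- `T` of the chart.
  let b' : Basis (Fin (finrank ℝ E) ⊕ Fin (finrank ℝ F)) ℝ (TangentSpace (dualModel E F) γ) :=
    (modelBasis E F).map T.symm.toLinearEquiv
  have hTb : ∀ k, T (b' k) = modelBasis E F k := fun k => by
    show T (T.symm _) = _
    exact T.apply_symm_apply _
  have hr : ∀ j, b' (Sum.inr j) = vertLift (dualFrame α.proj j) γ := by
    intro j
    apply T.injective
    refine (hTb _).trans ((hD _).trans ?_).symm
    rw [mfderiv_proj_vertLift, mfderiv_triv_vertLift _ _ _ hγe, triv_dualFrame _ _ hγe,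
      modelBasis_inr]
    refine Prod.ext ?_ rfl
    exact ContinuousLinearMap.map_zero _
  have hl : ∀ i, mfderiv (dualModel E F) 𝓘(ℝ, E) (fun β : DualTot F A => β.proj) γ (b' (Sum.inl i))
      = baseFrame E α.proj i γ.proj := by
    intro i
    apply hK
    refine Eq.trans ?_ (mfderiv_extChartAt_baseFrame _ _ hγc i).symm
    have h1 := congrArg Prod.fst ((hD (b' (Sum.inl i))).symm.trans (hTb _))
    rw [modelBasis_inl] at h1
    exact h1
  have h0 := (wedgeVol ν Λ γ).eq_smul_basis_det b'
  have h1 : b'.det z = modelDet E F (fun i => T (z i)) := by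
    show ((modelBasis E F).map T.symm.toLinearEquiv).det z = (modelBasis E F).det _
    rw [Basis.det_map]
    rfl
  rw [h0]
  show wedgeVol ν Λ γ b' * b'.det z = _
  rw [h1]
  congr 1
  unfold wedgeVol wedgeDensity
  rw [mul'_domCoprod_apply]
  · congr 1
    · show ν γ.proj (fun i => mfderiv (dualModel E F) 𝓘(ℝ, E) (fun β : DualTot F A => β.proj) γ
        (b' (Sum.inl i))) = _
      simp only [hl]
    · show Λ γ.proj (fun j => vertProj γ (b' (Sum.inr j))) = _
      simp only [hr, vertProj_vertLift]
  · rintro u ⟨i, j, hij⟩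
    refine (ν γ.proj).map_coord_zero i ?_
    show mfderiv (dualModel E F) 𝓘(ℝ, E) (fun β : DualTot F A => β.proj) γ (u i) = 0
    rw [hij, hr, mfderiv_proj_vertLift]

theorem contMDiffAt_wedgeDensity {ν : ∀ q : Q, TangentSpace 𝓘(ℝ, E) q [⋀^Fin (finrank ℝ E)]→ₗ[ℝ] ℝ}
    (hν : IsVolumeForm 𝓘(ℝ, E) ν)
    {Λ : ∀ q : Q, DualFib A q [⋀^Fin (finrank ℝ F)]→ₗ[ℝ] ℝ} (hΛ : IsVolumeSection E F Λ) (q : Q) :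
    ContMDiffAt 𝓘(ℝ, E) 𝓘(ℝ, ℝ) ∞ (wedgeDensity ν Λ q) q :=
  (hν.smooth q _ (smoothFieldAt_baseFrame q)).mul (hΛ.smooth q _ (contMDiffAt_dualFrame q))

theorem baseFrame_ne_zero {ν : ∀ q : Q, TangentSpace 𝓘(ℝ, E) q [⋀^Fin (finrank ℝ E)]→ₗ[ℝ] ℝ}
    (hν : IsVolumeForm 𝓘(ℝ, E) ν) (q y : Q) (hy : y ∈ (extChartAt 𝓘(ℝ, E) q).source) :
    ν y (fun i => baseFrame E q i y) ≠ 0 := by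
  haveI : IsManifold 𝓘(ℝ, E) 1 Q := IsManifold.of_le (n := ∞) (by simp)
  have hy2 : y ∈ (chartAt E q).source := by simpa using hy
  have hy3 : y ∈ (trivializationAt E (TangentSpace 𝓘(ℝ, E)) q).baseSet := by
    rwa [TangentBundle.trivializationAt_baseSet]
  intro h
  apply hν.ne_zero y
  let b := (trivializationAt E (TangentSpace 𝓘(ℝ, E)) q).basisAt (finBasis ℝ E) hy3
  have hb : (fun i => baseFrame E q i y) = b := by
    funext i
    exact Trivialization.localFrame_apply_of_mem_baseSet _ _ hy3
  rw [hb] at h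
  rw [(ν y).eq_smul_basis_det b, h, zero_smul]

theorem dualFrame_ne_zero {Λ : ∀ q : Q, DualFib A q [⋀^Fin (finrank ℝ F)]→ₗ[ℝ] ℝ} (q y : Q)
    (hΛ : Λ y ≠ 0) (hy : y ∈ (trivializationAt (F →L[ℝ] ℝ) (DualFib A) q).baseSet) :
    Λ y (fun j => dualFrame q j y) ≠ 0 := by
  intro h
  apply hΛ
  let b := (trivializationAt (F →L[ℝ] ℝ) (DualFib A) q).basisAt (finDualBasis F) hy
  have hb : (fun i => dualFrame q i y) = b := by
    funext i
    exact Trivialization.localFrame_apply_of_mem_baseSet _ _ hy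
  rw [hb] at h
  rw [(Λ y).eq_smul_basis_det b, h, zero_smul]

theorem wedgeDensity_self_ne_zero
    {ν : ∀ q : Q, TangentSpace 𝓘(ℝ, E) q [⋀^Fin (finrank ℝ E)]→ₗ[ℝ] ℝ}
    (hν : IsVolumeForm 𝓘(ℝ, E) ν)
    {Λ : ∀ q : Q, DualFib A q [⋀^Fin (finrank ℝ F)]→ₗ[ℝ] ℝ} (hΛ : IsVolumeSection E F Λ) (q : Q) :
    wedgeDensity ν Λ q q ≠ 0 :=
  mul_ne_zero (baseFrame_ne_zero hν q q (mem_extChartAt_source q))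
    (dualFrame_ne_zero q q (hΛ.ne_zero q) (FiberBundle.mem_baseSet_trivializationAt' q))

theorem expWedgeVol_hasCoordForm (μ : Q → ℝ)
    (ν : ∀ q : Q, TangentSpace 𝓘(ℝ, E) q [⋀^Fin (finrank ℝ E)]→ₗ[ℝ] ℝ)
    (Λ : ∀ q : Q, DualFib A q [⋀^Fin (finrank ℝ F)]→ₗ[ℝ] ℝ) (α : DualTot F A) :
    HasCoordForm (I := dualModel E F) (expWedgeVol μ ν Λ)
      (fun γ => Real.exp (μ γ.proj) * wedgeDensity ν Λ α.proj γ.proj) (modelDet E F) α := by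
  filter_upwards [wedgeVol_hasCoordForm ν Λ α] with γ hγ z
  show Real.exp (μ γ.proj) * wedgeVol ν Λ γ z = _
  rw [hγ, mul_assoc]

theorem isVolumeForm_expWedgeVol (μ : C^∞⟮𝓘(ℝ, E), Q; ℝ⟯)
    {ν : ∀ q : Q, TangentSpace 𝓘(ℝ, E) q [⋀^Fin (finrank ℝ E)]→ₗ[ℝ] ℝ}
    (hν : IsVolumeForm 𝓘(ℝ, E) ν)
    {Λ : ∀ q : Q, DualFib A q [⋀^Fin (finrank ℝ F)]→ₗ[ℝ] ℝ} (hΛ : IsVolumeSection E F Λ) :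
    IsVolumeForm (dualModel E F) (expWedgeVol μ ν Λ) where
  top_degree := by
    have : finrank ℝ (F →L[ℝ] ℝ) = finrank ℝ F := by
      simpa using finrank_eq_card_basis (finDualBasis F)
    simp [this]
  smooth α Z hZ := by
    refine (expWedgeVol_hasCoordForm μ ν Λ α).contMDiffAt ?_ hZ
    have h1 : ContMDiffAt 𝓘(ℝ, E) 𝓘(ℝ, ℝ) ∞
        (fun y => Real.exp (μ y) * wedgeDensity ν Λ α.proj y) α.proj :=
      (Real.contDiff_exp.contMDiff.comp μ.contMDiff).contMDiffAt.mul
        (contMDiffAt_wedgeDensity hν hΛ α.proj)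
    exact h1.comp α (contMDiffAt_proj _)
  -- On the model basis the determinant is `1`, so the value of the form there is its density.
  ne_zero α h := by
    have h1 := (expWedgeVol_hasCoordForm μ ν Λ α).apply_self (modelBasis E F)
    rw [h, modelDet_apply, Basis.det_self, mul_one] at h1
    exact mul_ne_zero (Real.exp_ne_zero _) (wedgeDensity_self_ne_zero hν hΛ α.proj) h1.symm

end Density

/-! ### The trace of the derivative of a hamiltonian vector field. -/

section Calculus

/-- The divergence of a hamiltonian vector field does not contain second derivatives of the hamiltonian
function. -/
theorem trace_fderiv_of_skew {W ι : Type*} [NormedAddCommGroup W] [NormedSpace ℝ W] [Fintype ι]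
    [FiniteDimensional ℝ W] (b : Basis ι ℝ W) {P : ι → ι → W → ℝ} {φ : W → ℝ} {V : W → W} {w : W}
    (hP : ∀ i j, DifferentiableAt ℝ (P i j) w) (hskew : ∀ i j, P i j w = -P j i w)
    (hφ : ContDiffAt ℝ 2 φ w)
    (hV : ∀ᶠ w' in nhds w, ∀ i, b.repr (V w') i = ∑ j, P i j w' * fderiv ℝ φ w' (b j)) :
    ∑ i, b.repr (fderiv ℝ V w (b i)) i
      = ∑ i, ∑ j, fderiv ℝ (P i j) w (b i) * fderiv ℝ φ w (b j) := by
  have hφ' : DifferentiableAt ℝ (fderiv ℝ φ) w :=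
    (hφ.fderiv_right (m := 1) (by norm_num)).differentiableAt (by simp)
  have hφj : ∀ j, HasFDerivAt (fun w' => fderiv ℝ φ w' (b j))
      ((ContinuousLinearMap.apply ℝ ℝ (b j)).comp (fderiv ℝ (fderiv ℝ φ) w)) w := fun j =>
    (ContinuousLinearMap.apply ℝ ℝ (b j)).hasFDerivAt.comp w hφ'.hasFDerivAt
  have hsum : ∀ i, HasFDerivAt (fun w' => ∑ j, P i j w' * fderiv ℝ φ w' (b j))
      (∑ j, (P i j w • (ContinuousLinearMap.apply ℝ ℝ (b j)).comp (fderiv ℝ (fderiv ℝ φ) w)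
        + fderiv ℝ φ w (b j) • fderiv ℝ (P i j) w)) w := fun i =>
    HasFDerivAt.fun_sum fun j _ => (hP i j).hasFDerivAt.mul (hφj j)
  -- Differentiability of `V` is not a hypothesis; it is read off from the formula for its
  -- components.
  have hVd : DifferentiableAt ℝ V w := by
    have h1 : V =ᶠ[nhds w] fun w' => ∑ i, (∑ j, P i j w' * fderiv ℝ φ w' (b j)) • b i := by
      filter_upwards [hV] with w' hw'
      conv_lhs => rw [← b.sum_repr (V w')]
      simp only [hw']
    refine DifferentiableAt.congr_of_eventuallyEq ?_ h1
    exact DifferentiableAt.fun_sum fun i _ => (hsum i).differentiableAt.smul_const (b i)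
  have hcoord : ∀ i, b.repr (fderiv ℝ V w (b i)) i
      = ∑ j, (P i j w * fderiv ℝ (fderiv ℝ φ) w (b i) (b j)
        + fderiv ℝ φ w (b j) * fderiv ℝ (P i j) w (b i)) := by
    intro i
    have h1 := (LinearMap.toContinuousLinearMap (b.coord i)).hasFDerivAt.comp w hVd.hasFDerivAt
    have h2 : (LinearMap.toContinuousLinearMap (b.coord i)) ∘ V =ᶠ[nhds w]
        fun w' => ∑ j, P i j w' * fderiv ℝ φ w' (b j) := by
      filter_upwards [hV] with w' hw'
      exact hw' i
    have h3 := (h1.congr_of_eventuallyEq h2.symm).unique (hsum i)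
    have h4 := congrArg (fun l : W →L[ℝ] ℝ => l (b i)) h3
    simp only [_root_.sum_apply] at h4
    exact h4
  simp only [hcoord, Finset.sum_add_distrib]
  have hsymm : IsSymmSndFDerivAt ℝ φ w := hφ.isSymmSndFDerivAt (by simp)
  -- The Hessian is symmetric and `P` is skew at `w`, so their contraction equals its own negative.
  have hzero : ∑ i, ∑ j, P i j w * fderiv ℝ (fderiv ℝ φ) w (b i) (b j) = 0 := by
    have h1 : ∑ i, ∑ j, P i j w * fderiv ℝ (fderiv ℝ φ) w (b i) (b j)
        = - ∑ i, ∑ j, P i j w * fderiv ℝ (fderiv ℝ φ) w (b i) (b j) := by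
      conv_lhs => rw [Finset.sum_comm]
      simp only [← Finset.sum_neg_distrib]
      refine Finset.sum_congr rfl fun i _ => Finset.sum_congr rfl fun j _ => ?_
      rw [hskew j i, hsymm.eq (b j) (b i)]
      ring
    linarith
  rw [hzero, zero_add]
  exact Finset.sum_congr rfl fun i _ => Finset.sum_congr rfl fun j _ => mul_comm _ _

end Calculus

/-! ### Coordinates of `A*` as fibrewise affine functions. -/

section Coordinates

variable {E : Type*} [NormedAddCommGroup E] [NormedSpace ℝ E]
  {Q : Type*} [TopologicalSpace Q] [ChartedSpace E Q]
  {F : Type*} [NormedAddCommGroup F] [NormedSpace ℝ F]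
  {A : Q → Type*} [∀ q, AddCommGroup (A q)] [∀ q, Module ℝ (A q)] [∀ q, TopologicalSpace (A q)]
  [∀ q, IsTopologicalAddGroup (A q)] [∀ q, ContinuousSMul ℝ (A q)]
  [TopologicalSpace (TotalSpace F A)] [FiberBundle F A] [VectorBundle ℝ F A]
  [IsManifold 𝓘(ℝ, E) ∞ Q] [ContMDiffVectorBundle ∞ F A 𝓘(ℝ, E)]
  [FiniteDimensional ℝ E] [FiniteDimensional ℝ F] [T2Space Q]

/-- Fibrewise affine functions on `A*` that restrict to the preferred coordinates over a neighbourhood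
of `q`. -/
theorem exists_affine_coordinates (q : Q) :
    ∃ (X : Fin (finrank ℝ E) ⊕ Fin (finrank ℝ F) → Cₛ^∞⟮𝓘(ℝ, E); F, A⟯)
      (f : Fin (finrank ℝ E) ⊕ Fin (finrank ℝ F) → C^∞⟮𝓘(ℝ, E), Q; ℝ⟯),
      (∀ i, X (Sum.inl i) = 0) ∧ (∀ j, f (Sum.inr j) = 0) ∧
      ∀ α : DualTot F A, α.proj = q → ∀ᶠ β in nhds α, ∀ i, linFun (X i) β + f i β.proj
        = (modelBasis E F).repr (extChartAt (dualModel E F) α β) i := by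
  let t := trivializationAt F A q
  have hq : q ∈ t.baseSet := FiberBundle.mem_baseSet_trivializationAt' q
  -- The bracket acts on global sections, so base coordinates and the local frame of `A` are
  -- multiplied by a bump function equal to `1` near `q`.
  obtain ⟨c, hc⟩ := LieAlgebroid.exists_bump (E := E) (t.open_baseSet.mem_nhds hq)
  let l : Fin (finrank ℝ E) → E →L[ℝ] ℝ := fun i =>
    LinearMap.toContinuousLinearMap ((finBasis ℝ E).coord i)
  let f₁ : Fin (finrank ℝ E) → C^∞⟮𝓘(ℝ, E), Q; ℝ⟯ := fun i =>
    ⟨fun y => c y • l i (extChartAt 𝓘(ℝ, E) q y),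
      c.contMDiff_smul ((l i).contMDiff.comp_contMDiffOn contMDiffOn_extChartAt)⟩
  let X₁ : Fin (finrank ℝ F) → Cₛ^∞⟮𝓘(ℝ, E); F, A⟯ := fun j =>
    ⟨(c : Q → ℝ) • t.localFrame (finBasis ℝ F) j,
      c.contMDiff.contMDiffOn.smul_section_of_tsupport t.open_baseSet hc
      (t.contMDiffOn_localFrame_baseSet _ _ j)⟩
  refine ⟨Sum.elim 0 X₁, Sum.elim f₁ 0, fun _ => rfl, fun _ => rfl, ?_⟩
  rintro α rfl
  have hproj := (FiberBundle.continuous_proj (F →L[ℝ] ℝ) (DualFib A)).tendsto α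
  filter_upwards [hproj.eventually c.eventuallyEq_one, hproj (t.open_baseSet.mem_nhds hq),
    hproj ((trivializationAt (F →L[ℝ] ℝ) (DualFib A) α.proj).open_baseSet.mem_nhds
      (FiberBundle.mem_baseSet_trivializationAt' α.proj))] with β hβ hβ' hβe i
  rw [extChartAt_dual_apply α β hβe]
  rcases i with i | j
  · rw [modelBasis_repr_inl]
    have h0 : linFun (0 : Cₛ^∞⟮𝓘(ℝ, E); F, A⟯) β = 0 := map_zero β.2
    show linFun (0 : Cₛ^∞⟮𝓘(ℝ, E); F, A⟯) β + c β.proj • l i (extChartAt 𝓘(ℝ, E) α.proj β.proj) = _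
    rw [h0, hβ, zero_add, Pi.one_apply, one_smul]
    rfl
  · rw [modelBasis_repr_inr]
    show β.2 (c β.proj • t.localFrame (finBasis ℝ F) j β.proj) + 0 = _
    rw [hβ]
    simp only [Pi.one_apply, one_smul, add_zero, hom_trivializationAt_apply,
      ContinuousLinearMap.inCoordinates]
    rw [Trivialization.localFrame_apply_of_mem_baseSet _ _ hβ']
    simp
    congr 1
    simp only [Trivialization.basisAt, Basis.map_apply]
    exact (Trivialization.symmL_apply _ hβ' _).symm

namespace LieAlgebroid

variable (L : LieAlgebroid E F A)

/-- The function `ρ(X)(f)`. -/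
def anchorDeriv (X : Cₛ^∞⟮𝓘(ℝ, E); F, A⟯) (f : C^∞⟮𝓘(ℝ, E), Q; ℝ⟯) (q : Q) : ℝ :=
  dirDeriv 𝓘(ℝ, E) f q (L.anchor q (X q))

/-- The function is the fibre component of the composite of `X`, the anchor and the tangent map of
`f`. -/
theorem contMDiff_anchorDeriv (X : Cₛ^∞⟮𝓘(ℝ, E); F, A⟯) (f : C^∞⟮𝓘(ℝ, E), Q; ℝ⟯) :
    ContMDiff 𝓘(ℝ, E) 𝓘(ℝ, ℝ) ∞ (L.anchorDeriv X f) := by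
  haveI : IsManifold 𝓘(ℝ, E) 1 Q := IsManifold.of_le (n := ∞) (by simp)
  have h1 := L.anchor_smooth.comp X.contMDiff
  have h2 := f.contMDiff.contMDiff_tangentMap (m := ∞) (by simp)
  exact (contMDiff_snd_tangentBundle_modelSpace ℝ 𝓘(ℝ, ℝ)).comp (h2.comp h1)

theorem affB_apply (α : DualTot F A) (X Y : Cₛ^∞⟮𝓘(ℝ, E); F, A⟯) (f g : C^∞⟮𝓘(ℝ, E), Q; ℝ⟯) :
    L.affB α Y g (X, f) = -linFun (L.bracket X Y) α + L.anchorDeriv Y f α.proj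
      - L.anchorDeriv X g α.proj := rfl

theorem contMDiff_affB (X Y : Cₛ^∞⟮𝓘(ℝ, E); F, A⟯) (f g : C^∞⟮𝓘(ℝ, E), Q; ℝ⟯) :
    ContMDiff (dualModel E F) 𝓘(ℝ, ℝ) ∞ (fun α => L.affB α Y g (X, f)) :=
  ((linFun_smooth _).neg.add ((L.contMDiff_anchorDeriv Y f).comp (contMDiff_proj _))).sub
    ((L.contMDiff_anchorDeriv X g).comp (contMDiff_proj _))

end LieAlgebroid

end Coordinates

/-! ### Hamiltonian vector fields in coordinates. -/

section Hamiltonian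

variable {E : Type*} [NormedAddCommGroup E] [NormedSpace ℝ E]
  {Q : Type*} [TopologicalSpace Q] [ChartedSpace E Q]
  {F : Type*} [NormedAddCommGroup F] [NormedSpace ℝ F]
  {A : Q → Type*} [∀ q, AddCommGroup (A q)] [∀ q, Module ℝ (A q)] [∀ q, TopologicalSpace (A q)]
  [∀ q, IsTopologicalAddGroup (A q)] [∀ q, ContinuousSMul ℝ (A q)]
  [TopologicalSpace (TotalSpace F A)] [FiberBundle F A] [VectorBundle ℝ F A]
  [IsManifold 𝓘(ℝ, E) ∞ Q] [ContMDiffVectorBundle ∞ F A 𝓘(ℝ, E)]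
  [FiniteDimensional ℝ E] [FiniteDimensional ℝ F] [T2Space Q]

/-- At `α` the preferred chart identifies `T_α A*` with `E × F*`, and the derivative of the bundle
projection becomes the first projection. -/
theorem dirDeriv_proj (R : Q → ℝ) (α : DualTot F A)
    (hR : MDifferentiableAt 𝓘(ℝ, E) 𝓘(ℝ, ℝ) R α.proj) (v : TangentSpace (dualModel E F) α) :
    dirDeriv (dualModel E F) (fun β : DualTot F A => R β.proj) α v
      = dirDeriv 𝓘(ℝ, E) R α.proj (v : E × (F →L[ℝ] ℝ)).1 := by
  haveI : IsManifold 𝓘(ℝ, E) 1 Q := IsManifold.of_le (n := ∞) (by simp)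
  haveI : IsManifold (dualModel E F) 1 (DualTot F A) := IsManifold.of_le (n := ∞) (by simp)
  have hp : MDifferentiableAt (dualModel E F) 𝓘(ℝ, E) (fun β : DualTot F A => β.proj) α :=
    (contMDiffAt_proj (n := ∞) _).mdifferentiableAt (by simp)
  refine (LieAlgebroid.dirDeriv_comp rfl hR hp v).trans ?_
  have h := congrArg Prod.fst (mfderiv_extChartAt_dual α α (mem_extChartAt_source α)
    (FiberBundle.mem_baseSet_trivializationAt' α.proj) (mem_extChartAt_source α.proj) v)
  rw [mfderiv_extChartAt_self, mfderiv_extChartAt_self] at h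
  exact congrArg (dirDeriv 𝓘(ℝ, E) R α.proj) h.symm

theorem vertLift_dualFrame (α : DualTot F A) (j : Fin (finrank ℝ F)) :
    (vertLift (E := E) (dualFrame α.proj j) α : E × (F →L[ℝ] ℝ)) = modelBasis E F (Sum.inr j) := by
  haveI : IsManifold 𝓘(ℝ, E) 1 Q := IsManifold.of_le (n := ∞) (by simp)
  haveI : IsManifold (dualModel E F) 1 (DualTot F A) := IsManifold.of_le (n := ∞) (by simp)
  have hb := FiberBundle.mem_baseSet_trivializationAt' (F := F →L[ℝ] ℝ) (E := DualFib A) α.proj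
  have h := mfderiv_extChartAt_dual α α (mem_extChartAt_source α) hb
    (mem_extChartAt_source α.proj) (vertLift (E := E) (dualFrame α.proj j) α)
  rw [mfderiv_extChartAt_self, mfderiv_proj_vertLift, mfderiv_triv_vertLift _ _ _ hb,
    triv_dualFrame _ _ hb, map_zero] at h
  rw [modelBasis_inr]
  exact h

theorem affD_vertLift (X : Cₛ^∞⟮𝓘(ℝ, E); F, A⟯) (f : C^∞⟮𝓘(ℝ, E), Q; ℝ⟯) (α : DualTot F A)
    (s : ∀ q, DualFib A q) :
    LieAlgebroid.affD α (X, f) (vertLift s α) = s α.proj (X α.proj) := by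
  have h := LieAlgebroid.dirDeriv_vertLift α (LieAlgebroid.affine_mdiff X f α) s
  refine h.trans ?_
  have h : (fun t : ℝ => linFun X (⟨α.proj, α.2 + t • s α.proj⟩ : DualTot F A) + f α.proj)
      = fun t : ℝ => α.2 (X α.proj) + t * s α.proj (X α.proj) + f α.proj := rfl
  show deriv (fun t : ℝ => linFun X (⟨α.proj, α.2 + t • s α.proj⟩ : DualTot F A) + f α.proj) 0 = _
  rw [h]
  simp

theorem dirDeriv_linFun_vertLift (X : Cₛ^∞⟮𝓘(ℝ, E); F, A⟯) (α : DualTot F A)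
    (s : ∀ q, DualFib A q) :
    dirDeriv (dualModel E F) (linFun X) α (vertLift s α) = s α.proj (X α.proj) := by
  rw [← affD_vertLift X 0]
  have h : linFun (F := F) X = fun β => linFun X β + (0 : C^∞⟮𝓘(ℝ, E), Q; ℝ⟯) β.proj := by
    funext β
    exact (add_zero _).symm
  conv_lhs => rw [h]
  rfl

/-- Differentials of fibrewise affine functions separate tangent vectors. Identities between
vertical lifts then reduce, through `affD_vertLift`, to identities between covectors. -/
theorem eq_of_affD {α : DualTot F A} {v w : TangentSpace (dualModel E F) α}
    (h : ∀ (X : Cₛ^∞⟮𝓘(ℝ, E); F, A⟯) (f : C^∞⟮𝓘(ℝ, E), Q; ℝ⟯),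
      LieAlgebroid.affD α (X, f) v = LieAlgebroid.affD α (X, f) w) : v = w := by
  refine sub_eq_zero.mp (LieAlgebroid.eq_zero_of_affine α _ fun X f => ?_)
  show LieAlgebroid.affD α (X, f) (v - w) = 0
  rw [map_sub, h, sub_self]

theorem vertLift_sum {ι : Type*} [Fintype ι] (c : ι → ℝ) (s : ι → ∀ q, DualFib A q) (α : DualTot F A) :
    ∑ i, c i • vertLift (E := E) (s i) α = vertLift (fun q => ∑ i, c i • s i q) α := by
  refine eq_of_affD fun X f => ?_
  rw [map_sum, affD_vertLift, _root_.sum_apply]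
  refine Finset.sum_congr rfl fun i _ => ?_
  rw [map_smul, affD_vertLift]
  rfl

namespace LieAlgebroid

variable (L : LieAlgebroid E F A)

/-- The expression of a hamiltonian vector field in coordinates: `{x_i, φ} = ∑ j, {x_i, x_j} ∂_j φ`. -/
theorem eventually_repr_coordRep_hamVF
    {X : Fin (finrank ℝ E) ⊕ Fin (finrank ℝ F) → Cₛ^∞⟮𝓘(ℝ, E); F, A⟯}
    {f : Fin (finrank ℝ E) ⊕ Fin (finrank ℝ F) → C^∞⟮𝓘(ℝ, E), Q; ℝ⟯} {α : DualTot F A}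
    (hX : ∀ᶠ β in nhds α, ∀ i, linFun (X i) β + f i β.proj
        = (modelBasis E F).repr (extChartAt (dualModel E F) α β) i)
    {φ : DualTot F A → ℝ} (hφ : ContMDiff (dualModel E F) 𝓘(ℝ, ℝ) ∞ φ) :
    ∀ᶠ w in nhds (extChartAt (dualModel E F) α α), ∀ i,
      (modelBasis E F).repr (coordRep (dualModel E F) α (L.hamVF φ) w) i
        = ∑ j, L.affB ((extChartAt (dualModel E F) α).symm w) (X j) (f j) (X i, f i)
          * fderiv ℝ (φ ∘ (extChartAt (dualModel E F) α).symm) w (modelBasis E F j) := by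
  haveI : IsManifold (dualModel E F) 1 (DualTot F A) := IsManifold.of_le (n := ∞) (by simp)
  set ψ := extChartAt (dualModel E F) α
  -- The brackets live on `A*`, so the identity is proved at points `β` near `α` and carried to the
  -- model space by continuity of the inverse chart.
  suffices h : ∀ᶠ β in nhds α, ∀ i,
      (modelBasis E F).repr (coordRep (dualModel E F) α (L.hamVF φ) (ψ β)) i
        = ∑ j, L.affB β (X j) (f j) (X i, f i)
          * fderiv ℝ (φ ∘ ψ.symm) (ψ β) (modelBasis E F j) by
    have hc : Filter.Tendsto ψ.symm (nhds (ψ α)) (nhds α) := by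
      have := continuousAt_extChartAt_symm (I := dualModel E F) α
      rw [ContinuousAt, extChartAt_to_inv] at this
      exact this
    filter_upwards [hc.eventually h, extChartAt_target_mem_nhds (I := dualModel E F) α] with w hw hwt
    rw [ψ.right_inv hwt] at hw
    exact hw
  filter_upwards [hX.eventually_nhds, extChartAt_source_mem_nhds (I := dualModel E F) α]
    with β hβ hβs i
  have hψ : MDifferentiableAt (dualModel E F) 𝓘(ℝ, E × (F →L[ℝ] ℝ)) ψ β :=
    mdifferentiableAt_extChartAt (by simpa [ψ] using hβs)
  have hcoord : ∀ j (v : TangentSpace (dualModel E F) β),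
      affD β (X j, f j) v = (modelBasis E F).repr
        (mfderiv (dualModel E F) 𝓘(ℝ, E × (F →L[ℝ] ℝ)) ψ β v) j := by
    intro j v
    let l : E × (F →L[ℝ] ℝ) →L[ℝ] ℝ := LinearMap.toContinuousLinearMap ((modelBasis E F).coord j)
    have h1 : (fun β => linFun (X j) β + f j β.proj) =ᶠ[nhds β] l ∘ ψ := by
      filter_upwards [hβ] with β' hβ'
      exact hβ' j
    show mfderiv (dualModel E F) 𝓘(ℝ, ℝ) (fun β => linFun (X j) β + f j β.proj) β v = _
    rw [h1.mfderiv_eq]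
    have h2 := mfderiv_comp β (I'' := 𝓘(ℝ, ℝ)) l.mdifferentiableAt hψ
    rw [ContinuousLinearMap.mfderiv_eq] at h2
    exact congrArg (fun T : TangentSpace (dualModel E F) β →L[ℝ] ℝ => T v) h2
  have hwt : ψ β ∈ ψ.target := ψ.map_source hβs
  have hφs : DifferentiableAt ℝ (φ ∘ ψ.symm) (ψ β) := by
    have h1 := (contMDiffOn_extChartAt_symm (I := dualModel E F) (n := ∞) α).contMDiffAt
      ((isOpen_extChartAt_target α).mem_nhds hwt)
    exact ((hφ.contMDiffAt.comp (ψ β) h1).contDiffAt).differentiableAt (by simp)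
  let c : Fin (finrank ℝ E) ⊕ Fin (finrank ℝ F) → ℝ := fun j =>
    fderiv ℝ (φ ∘ ψ.symm) (ψ β) (modelBasis E F j)
  -- With the partial derivatives at `β` frozen as constants `c j`, the differential of `φ` at `β`
  -- is that of a single affine function; this is the form that `poissonBracket_eq` accepts.
  have hdφ : ∀ v : TangentSpace (dualModel E F) β, dirDeriv (dualModel E F) φ β v
      = affD β (∑ j, c j • (X j, f j)) v := by
    intro v
    have h1 : φ =ᶠ[nhds β] (φ ∘ ψ.symm) ∘ ψ := by
      filter_upwards [(isOpen_extChartAt_source (I := dualModel E F) α).mem_nhds hβs] with β' hβ'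
      simp only [Function.comp_apply]
      rw [ψ.left_inv hβ']
    have h2 := mfderiv_comp β (I'' := 𝓘(ℝ, ℝ)) hφs.mdifferentiableAt hψ
    rw [mfderiv_eq_fderiv, ← h1.mfderiv_eq] at h2
    refine (congrArg (fun T : TangentSpace (dualModel E F) β →L[ℝ] ℝ => T v) h2).trans ?_
    set u : E × (F →L[ℝ] ℝ) := mfderiv (dualModel E F) 𝓘(ℝ, E × (F →L[ℝ] ℝ)) ψ β v with hu
    rw [map_sum, LinearMap.sum_apply]
    have h3 : ∀ j, affD β (c j • (X j, f j)) v = c j * (modelBasis E F).repr u j := fun j => by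
      rw [map_smul, LinearMap.smul_apply, hcoord, smul_eq_mul]
    rw [Finset.sum_congr rfl fun j _ => h3 j]
    show fderiv ℝ (φ ∘ ψ.symm) (ψ β) u = _
    conv_lhs => rw [← (modelBasis E F).sum_repr u]
    rw [map_sum]
    refine Finset.sum_congr rfl fun j _ => ?_
    rw [map_smul, smul_eq_mul, mul_comm]
  rw [coordRep_apply hβs, ← hcoord]
  let wi : C^∞⟮dualModel E F, DualTot F A; ℝ⟯ := ⟨fun β => linFun (X i) β + f i β.proj,
    (linFun_smooth (X i)).add ((f i).contMDiff.comp (contMDiff_proj _))⟩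
  have h4 : affD β (X i, f i) (L.hamVF φ β) = L.poissonBracket wi φ β := L.dirDeriv_hamVF φ β wi
  rw [h4, L.poissonBracket_eq (φ := wi) (X := X i) (f := f i) (fun _ => rfl)
    (Y := (∑ j, c j • (X j, f j)).1) (g := (∑ j, c j • (X j, f j)).2) hdφ]
  show L.affB β (∑ j, c j • (X j, f j)).1 (∑ j, c j • (X j, f j)).2 (X i, f i) = _
  -- `affB` is bundled as linear only in its last argument, so the sum is moved there by
  -- skew-symmetry, expanded, and moved back.
  rw [affB_skew]
  show - L.affB β (X i) (f i) (∑ j, c j • (X j, f j)) = _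
  rw [map_sum, ← Finset.sum_neg_distrib]
  refine Finset.sum_congr rfl fun j _ => ?_
  rw [map_smul, L.affB_skew β (X i) (X j), smul_eq_mul]
  ring

end LieAlgebroid

end Hamiltonian

/-! ### The divergence of a hamiltonian vector field is a vertical derivative. -/

section Divergence

variable {E : Type*} [NormedAddCommGroup E] [NormedSpace ℝ E]
  {Q : Type*} [TopologicalSpace Q] [ChartedSpace E Q]
  {F : Type*} [NormedAddCommGroup F] [NormedSpace ℝ F]
  {A : Q → Type*} [∀ q, AddCommGroup (A q)] [∀ q, Module ℝ (A q)] [∀ q, TopologicalSpace (A q)]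
  [∀ q, IsTopologicalAddGroup (A q)] [∀ q, ContinuousSMul ℝ (A q)]
  [TopologicalSpace (TotalSpace F A)] [FiberBundle F A] [VectorBundle ℝ F A]
  [IsManifold 𝓘(ℝ, E) ∞ Q] [ContMDiffVectorBundle ∞ F A 𝓘(ℝ, E)]
  [FiniteDimensional ℝ E] [FiniteDimensional ℝ F] [T2Space Q]

theorem linFun_zero (α : DualTot F A) : linFun (0 : Cₛ^∞⟮𝓘(ℝ, E); F, A⟯) α = 0 := map_zero α.2

theorem dirDeriv_neg (g : DualTot F A → ℝ) (α : DualTot F A) (v : TangentSpace (dualModel E F) α) :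
    dirDeriv (dualModel E F) (fun β => -g β) α v = -dirDeriv (dualModel E F) g α v := by
  have h : mfderiv (dualModel E F) 𝓘(ℝ, ℝ) (-g) α = -mfderiv (dualModel E F) 𝓘(ℝ, ℝ) g α :=
    mfderiv_neg
  exact congrArg (fun T : TangentSpace (dualModel E F) α →L[ℝ] ℝ => T v) h

theorem fderiv_comp_extChartAt_symm {g : DualTot F A → ℝ} {α : DualTot F A}
    (hg : ContMDiff (dualModel E F) 𝓘(ℝ, ℝ) ∞ g) :
    ContDiffAt ℝ ∞ (g ∘ (extChartAt (dualModel E F) α).symm) (extChartAt (dualModel E F) α α) ∧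
    ∀ v : E × (F →L[ℝ] ℝ), fderiv ℝ (g ∘ (extChartAt (dualModel E F) α).symm)
      (extChartAt (dualModel E F) α α) v = dirDeriv (dualModel E F) g α v := by
  have h1 := (contMDiffOn_extChartAt_symm (I := dualModel E F) (n := ∞) α).contMDiffAt
    (extChartAt_target_mem_nhds α)
  have h2 := (hg.contMDiffAt.comp (extChartAt (dualModel E F) α α) h1).contDiffAt
  refine ⟨h2, fun v => (dirDeriv_eq_fderiv (h2.differentiableAt (by simp)) ?_ v).symm⟩
  filter_upwards [extChartAt_source_mem_nhds (I := dualModel E F) α] with β hβ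
  simp only [Function.comp_apply]
  rw [(extChartAt (dualModel E F) α).left_inv hβ]

namespace LieAlgebroid

variable (L : LieAlgebroid E F A)

theorem anchorDeriv_zero_left (f : C^∞⟮𝓘(ℝ, E), Q; ℝ⟯) (q : Q) : L.anchorDeriv 0 f q = 0 := by
  unfold anchorDeriv dirDeriv
  have h : L.anchor q ((0 : Cₛ^∞⟮𝓘(ℝ, E); F, A⟯) q) = 0 := map_zero _
  rw [h]
  exact map_zero _

theorem anchorDeriv_zero_right (X : Cₛ^∞⟮𝓘(ℝ, E); F, A⟯) (q : Q) : L.anchorDeriv X 0 q = 0 := by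
  unfold anchorDeriv dirDeriv
  have h : mfderiv 𝓘(ℝ, E) 𝓘(ℝ, ℝ) (0 : C^∞⟮𝓘(ℝ, E), Q; ℝ⟯) q = 0 := mfderiv_const
  rw [h]
  rfl

/-- The divergence of the hamiltonian vector field of `φ` with respect to `e^{μ ∘ τ} ν ∧ Λ` is the
derivative of `φ` along the vertical lift of a section of `A*`. -/
theorem exists_lieDerivForm_hamVF (μ : C^∞⟮𝓘(ℝ, E), Q; ℝ⟯)
    {ν : ∀ q : Q, TangentSpace 𝓘(ℝ, E) q [⋀^Fin (finrank ℝ E)]→ₗ[ℝ] ℝ}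
    (hν : IsVolumeForm 𝓘(ℝ, E) ν)
    {Λ : ∀ q : Q, DualFib A q [⋀^Fin (finrank ℝ F)]→ₗ[ℝ] ℝ} (hΛ : IsVolumeSection E F Λ) (q : Q) :
    ∃ s : ∀ y, DualFib A y, ∀ α : DualTot F A, α.proj = q →
      ∀ (φ : C^∞⟮dualModel E F, DualTot F A; ℝ⟯)
        (Z : Fin (finrank ℝ E) ⊕ Fin (finrank ℝ F) → ∀ β, TangentSpace (dualModel E F) β),
        (∀ i, SmoothFieldAt (dualModel E F) (Z i) α) →
        lieDerivForm (dualModel E F) (L.hamVF φ) (expWedgeVol μ ν Λ) Z α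
          = dirDeriv (dualModel E F) φ α (vertLift s α)
            * expWedgeVol μ ν Λ α (fun i => Z i α) := by
  obtain ⟨X, f, hX0, hf0, hXf⟩ := exists_affine_coordinates (E := E) (F := F) (A := A) q
  let h : Q → ℝ := fun y => Real.exp (μ y) * wedgeDensity ν Λ q y
  have hh : ContMDiffAt 𝓘(ℝ, E) 𝓘(ℝ, ℝ) ∞ h q :=
    (Real.contDiff_exp.contMDiff.comp μ.contMDiff).contMDiffAt.mul (contMDiffAt_wedgeDensity hν hΛ q)
  have hhd : MDifferentiableAt 𝓘(ℝ, E) 𝓘(ℝ, ℝ) h q := hh.mdifferentiableAt (by simp)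
  have hq0 : h q ≠ 0 := mul_ne_zero (Real.exp_ne_zero _) (wedgeDensity_self_ne_zero hν hΛ q)
  let ε : Fin (finrank ℝ E) → TangentSpace 𝓘(ℝ, E) q := fun i => finBasis ℝ E i
  -- With `ρ_b^i` the anchor coefficients, `C_{ab}^c` the structure functions and `h` the density,
  -- this is `∑ i, (∂_i ρ_b^i + ρ_b^i ∂_i log |h|) - ∑ a, C_{ab}^a`, evaluated at `q`.
  let n : Fin (finrank ℝ F) → ℝ := fun b =>
    (∑ i, (dirDeriv 𝓘(ℝ, E) (L.anchorDeriv (X (Sum.inr b)) (f (Sum.inl i))) q (ε i)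
      + (h q)⁻¹ * dirDeriv 𝓘(ℝ, E) h q (ε i) * L.anchorDeriv (X (Sum.inr b)) (f (Sum.inl i)) q))
    - ∑ a, dualFrame q a q (L.bracket (X (Sum.inr a)) (X (Sum.inr b)) q)
  -- The coefficients are frozen at `q`: vertical lifts at points over `q` see only the value of the
  -- section there.
  refine ⟨fun y => ∑ b, n b • dualFrame q b y, ?_⟩
  rintro α rfl φ Z hZ
  have hcf := expWedgeVol_hasCoordForm μ ν Λ α
  have hhα : MDifferentiableAt (dualModel E F) 𝓘(ℝ, ℝ) (fun β : DualTot F A => h β.proj) α :=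
    (hh.comp α (contMDiffAt_proj _)).mdifferentiableAt (by simp)
  rw [hcf.lieDerivForm_eq (modelBasis E F) hhα hZ, hcf.apply_self]
  set Δ := modelDet E F fun i => Z i α
  set ψ := extChartAt (dualModel E F) α with hψ
  let B : Fin (finrank ℝ E) ⊕ Fin (finrank ℝ F) → TangentSpace (dualModel E F) α :=
    fun i => modelBasis E F i
  let c : Fin (finrank ℝ E) ⊕ Fin (finrank ℝ F) → ℝ := fun j => dirDeriv (dualModel E F) φ α (B j)
  have hφ := fderiv_comp_extChartAt_symm (α := α) φ.contMDiff
  have hP := fun i j => fderiv_comp_extChartAt_symm (α := α) (L.contMDiff_affB (X i) (X j) (f i) (f j))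
  have hV := L.eventually_repr_coordRep_hamVF (hXf α rfl) φ.contMDiff
  have htr := trace_fderiv_of_skew (modelBasis E F)
    (P := fun i j => (fun β => L.affB β (X j) (f j) (X i, f i)) ∘ ψ.symm)
    (fun i j => (hP i j).1.differentiableAt (by simp))
    (fun i j => L.affB_skew _ (X i) (X j) (f i) (f j))
    (hφ.1.of_le (WithTop.coe_le_coe.mpr le_top)) hV
  have hham : ∀ i, (modelBasis E F).repr (L.hamVF φ α) i
      = ∑ j, L.affB α (X j) (f j) (X i, f i) * c j := by
    intro i
    have h1 := hV.self_of_nhds i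
    rw [coordRep_self, extChartAt_to_inv] at h1
    simp only [hφ.2] at h1
    exact h1
  -- The blocks of the Poisson matrix: zero between base coordinates, anchor coefficients pulled
  -- back from `Q` in the mixed blocks, minus the linear function of the bracket between fibre
  -- coordinates.
  have Pll : ∀ i k β, L.affB β (X (Sum.inl k)) (f (Sum.inl k)) (X (Sum.inl i), f (Sum.inl i)) = 0 := by
    intro i k β
    rw [affB_apply, hX0, hX0, map_zero, linFun_zero, anchorDeriv_zero_left, anchorDeriv_zero_left]
    simp
  have Plr : ∀ i b β, L.affB β (X (Sum.inr b)) (f (Sum.inr b)) (X (Sum.inl i), f (Sum.inl i))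
      = L.anchorDeriv (X (Sum.inr b)) (f (Sum.inl i)) β.proj := by
    intro i b β
    rw [affB_apply, hX0, hf0, map_zero, LinearMap.zero_apply, linFun_zero, anchorDeriv_zero_left]
    simp
  have Prl : ∀ a k β, L.affB β (X (Sum.inl k)) (f (Sum.inl k)) (X (Sum.inr a), f (Sum.inr a))
      = -L.anchorDeriv (X (Sum.inr a)) (f (Sum.inl k)) β.proj := by
    intro a k β
    rw [affB_skew, Plr]
  have Prr : ∀ a b β, L.affB β (X (Sum.inr b)) (f (Sum.inr b)) (X (Sum.inr a), f (Sum.inr a))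
      = -linFun (L.bracket (X (Sum.inr a)) (X (Sum.inr b))) β := by
    intro a b β
    rw [affB_apply, hf0, hf0, anchorDeriv_zero_right, anchorDeriv_zero_right]
    simp
  have hr : ∀ b i, MDifferentiableAt 𝓘(ℝ, E) 𝓘(ℝ, ℝ)
      (L.anchorDeriv (X (Sum.inr b)) (f (Sum.inl i))) α.proj := fun b i =>
    (L.contMDiff_anchorDeriv _ _).contMDiffAt.mdifferentiableAt (by simp)
  have Bl : ∀ i, (B (Sum.inl i) : E × (F →L[ℝ] ℝ)).1 = finBasis ℝ E i := fun i =>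
    congrArg Prod.fst (modelBasis_inl i)
  have Br : ∀ a, (B (Sum.inr a) : E × (F →L[ℝ] ℝ)).1 = 0 := fun a =>
    congrArg Prod.fst (modelBasis_inr a)
  have Bv : ∀ a, B (Sum.inr a) = vertLift (dualFrame α.proj a) α := fun a =>
    (vertLift_dualFrame α a).symm
  have Dll : ∀ i k v, dirDeriv (dualModel E F) (fun β => L.affB β (X (Sum.inl k)) (f (Sum.inl k))
      (X (Sum.inl i), f (Sum.inl i))) α v = 0 := by
    intro i k v
    simp only [Pll]
    unfold dirDeriv
    rw [mfderiv_const]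
    rfl
  have Dlr : ∀ i b, dirDeriv (dualModel E F) (fun β => L.affB β (X (Sum.inr b)) (f (Sum.inr b))
      (X (Sum.inl i), f (Sum.inl i))) α (B (Sum.inl i))
      = dirDeriv 𝓘(ℝ, E) (L.anchorDeriv (X (Sum.inr b)) (f (Sum.inl i))) α.proj (ε i) := by
    intro i b
    simp only [Plr]
    rw [dirDeriv_proj _ _ (hr b i), Bl]
  -- A fibre derivative of a function pulled back from `Q`.
  have Drl : ∀ a k, dirDeriv (dualModel E F) (fun β => L.affB β (X (Sum.inl k)) (f (Sum.inl k))
      (X (Sum.inr a), f (Sum.inr a))) α (B (Sum.inr a)) = 0 := by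
    intro a k
    simp only [Prl]
    rw [dirDeriv_neg, dirDeriv_proj _ _ (hr a k), Br, neg_eq_zero]
    exact map_zero (mfderiv 𝓘(ℝ, E) 𝓘(ℝ, ℝ) (L.anchorDeriv (X (Sum.inr a)) (f (Sum.inl k))) α.proj)
  have Drr : ∀ a b, dirDeriv (dualModel E F) (fun β => L.affB β (X (Sum.inr b)) (f (Sum.inr b))
      (X (Sum.inr a), f (Sum.inr a))) α (B (Sum.inr a))
      = -dualFrame α.proj a α.proj (L.bracket (X (Sum.inr a)) (X (Sum.inr b)) α.proj) := by
    intro a b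
    simp only [Prr]
    rw [dirDeriv_neg, Bv, dirDeriv_linFun_vertLift]
  -- As `Dll` and `Drl` vanish, no base derivative of `φ` enters the trace.
  have htr2 : ∑ i, (modelBasis E F).repr (fderiv ℝ (coordRep (dualModel E F) α (L.hamVF φ)) (ψ α)
      (modelBasis E F i)) i
      = ∑ b, ((∑ i, dirDeriv 𝓘(ℝ, E) (L.anchorDeriv (X (Sum.inr b)) (f (Sum.inl i))) α.proj (ε i))
        - ∑ a, dualFrame α.proj a α.proj (L.bracket (X (Sum.inr a)) (X (Sum.inr b)) α.proj))
        * c (Sum.inr b) := by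
    refine htr.trans ((Finset.sum_congr rfl fun i _ => Finset.sum_congr rfl fun j _ =>
      congrArg₂ (· * ·) ((hP i j).2 _) (hφ.2 _)).trans ?_)
    show ∑ i, ∑ j, dirDeriv (dualModel E F) (fun β => L.affB β (X j) (f j) (X i, f i)) α (B i) * c j = _
    simp only [Fintype.sum_sum_type, Dll, Dlr, Drl, Drr, zero_mul, Finset.sum_const_zero, zero_add]
    refine (congrArg₂ (· + ·) Finset.sum_comm Finset.sum_comm).trans ?_
    rw [← Finset.sum_add_distrib]
    refine Finset.sum_congr rfl fun b _ => ?_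
    rw [sub_mul, Finset.sum_mul, Finset.sum_mul, sub_eq_add_neg, ← Finset.sum_neg_distrib]
    simp only [neg_mul]
  -- The density sees only the base components of the hamiltonian field, and by `Pll` these involve
  -- only fibre derivatives of `φ`.
  have hdh : dirDeriv (dualModel E F) (fun β : DualTot F A => h β.proj) α (L.hamVF φ α)
      = ∑ b, (∑ i, dirDeriv 𝓘(ℝ, E) h α.proj (ε i)
        * L.anchorDeriv (X (Sum.inr b)) (f (Sum.inl i)) α.proj) * c (Sum.inr b) := by
    rw [dirDeriv_proj _ _ hhd]
    have h1 : ∀ v : E × (F →L[ℝ] ℝ), dirDeriv 𝓘(ℝ, E) h α.proj v.1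
        = ∑ i, (modelBasis E F).repr v (Sum.inl i) * dirDeriv 𝓘(ℝ, E) h α.proj (ε i) := by
      intro v
      have h2 : v.1 = ∑ i, (modelBasis E F).repr v (Sum.inl i) • finBasis ℝ E i := by
        simp only [modelBasis_repr_inl]
        exact ((finBasis ℝ E).sum_repr v.1).symm
      refine (congrArg (mfderiv 𝓘(ℝ, E) 𝓘(ℝ, ℝ) h α.proj) h2).trans ?_
      refine (map_sum (mfderiv 𝓘(ℝ, E) 𝓘(ℝ, ℝ) h α.proj) _ _).trans ?_
      exact Finset.sum_congr rfl fun i _ => map_smul (mfderiv 𝓘(ℝ, E) 𝓘(ℝ, ℝ) h α.proj) _ _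
    refine (h1 _).trans ?_
    simp only [hham, Fintype.sum_sum_type, Pll, Plr, zero_mul, Finset.sum_const_zero, zero_add,
      Finset.sum_mul]
    rw [Finset.sum_comm]
    refine Finset.sum_congr rfl fun b _ => Finset.sum_congr rfl fun i _ => ?_
    ring
  have hs : dirDeriv (dualModel E F) φ α (vertLift (fun y => ∑ b, n b • dualFrame α.proj b y) α)
      = ∑ b, n b * c (Sum.inr b) := by
    rw [← vertLift_sum]
    refine (map_sum (mfderiv (dualModel E F) 𝓘(ℝ, ℝ) φ α) _ _).trans ?_
    refine Finset.sum_congr rfl fun b _ => ?_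
    rw [← Bv]
    exact map_smul (mfderiv (dualModel E F) 𝓘(ℝ, ℝ) φ α) _ _
  rw [htr2, hs]
  show (dirDeriv (dualModel E F) (fun β : DualTot F A => h β.proj) α (L.hamVF φ α)
    + h α.proj * _) * Δ = _ * (h α.proj * Δ)
  rw [hdh, ← mul_assoc]
  congr 1
  rw [Finset.mul_sum, ← Finset.sum_add_distrib, Finset.sum_mul]
  refine Finset.sum_congr rfl fun b _ => ?_
  have hn : h α.proj * n b = (∑ i, dirDeriv 𝓘(ℝ, E) h α.proj (ε i)
        * L.anchorDeriv (X (Sum.inr b)) (f (Sum.inl i)) α.proj)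
      + h α.proj * ((∑ i, dirDeriv 𝓘(ℝ, E) (L.anchorDeriv (X (Sum.inr b)) (f (Sum.inl i))) α.proj (ε i))
        - ∑ a, dualFrame α.proj a α.proj (L.bracket (X (Sum.inr a)) (X (Sum.inr b)) α.proj)) := by
    simp only [n]
    have h1 : h α.proj * ∑ i, (h α.proj)⁻¹ * dirDeriv 𝓘(ℝ, E) h α.proj (ε i)
          * L.anchorDeriv (X (Sum.inr b)) (f (Sum.inl i)) α.proj
        = ∑ i, dirDeriv 𝓘(ℝ, E) h α.proj (ε i)
          * L.anchorDeriv (X (Sum.inr b)) (f (Sum.inl i)) α.proj := by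
      rw [Finset.mul_sum]
      refine Finset.sum_congr rfl fun i _ => ?_
      rw [← mul_assoc, ← mul_assoc, mul_inv_cancel₀ hq0, one_mul]
    rw [Finset.sum_add_distrib]
    linear_combination h1
  linear_combination (-c (Sum.inr b)) * hn

end LieAlgebroid

end Divergence

/-! ### Orthonormal frames, the metric volume and the mechanical hamiltonian. -/

section Metric

variable {E : Type*} [NormedAddCommGroup E] [NormedSpace ℝ E]
  {Q : Type*} [TopologicalSpace Q] [ChartedSpace E Q]
  {F : Type*} [NormedAddCommGroup F] [NormedSpace ℝ F]
  {A : Q → Type*} [∀ q, AddCommGroup (A q)] [∀ q, Module ℝ (A q)] [∀ q, TopologicalSpace (A q)]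
  [∀ q, IsTopologicalAddGroup (A q)] [∀ q, ContinuousSMul ℝ (A q)]
  [TopologicalSpace (TotalSpace F A)] [FiberBundle F A] [VectorBundle ℝ F A]
  [IsManifold 𝓘(ℝ, E) ∞ Q] [ContMDiffVectorBundle ∞ F A 𝓘(ℝ, E)]
  [FiniteDimensional ℝ E] [FiniteDimensional ℝ F] [T2Space Q]


variable (𝒢 : ContMDiffRiemannianMetric 𝓘(ℝ, E) ∞ F A)

theorem contMDiffAt_dual_apply {s : ∀ q, A q} {α : DualTot F A}
    (hs : ContMDiffAt 𝓘(ℝ, E) (𝓘(ℝ, E).prod 𝓘(ℝ, F)) ∞ (fun y => TotalSpace.mk' F y (s y)) α.proj) :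
    ContMDiffAt (dualModel E F) 𝓘(ℝ, ℝ) ∞ (fun β : DualTot F A => β.2 (s β.proj)) α := by
  have h1 : ContMDiffAt (dualModel E F) (𝓘(ℝ, E).prod 𝓘(ℝ, F →L[ℝ] ℝ)) ∞
      (fun m : DualTot F A => TotalSpace.mk' (F →L[ℝ] ℝ)
        (E := fun x : Q => (A x →L[ℝ] Bundle.Trivial Q ℝ x)) m.proj m.2) α := contMDiffAt_id
  have h2 : ContMDiffAt (dualModel E F) (𝓘(ℝ, E).prod 𝓘(ℝ, F)) ∞
      (fun m : DualTot F A => TotalSpace.mk' F (E := A) m.proj (s m.proj)) α :=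
    hs.comp α (contMDiffAt_proj _)
  exact (contMDiffAt_totalSpace.mp (h1.clm_bundle_apply h2)).2

theorem contMDiffAt_flat {s : ∀ q, A q} {q : Q}
    (hs : ContMDiffAt 𝓘(ℝ, E) (𝓘(ℝ, E).prod 𝓘(ℝ, F)) ∞ (fun y => TotalSpace.mk' F y (s y)) q) :
    ContMDiffAt 𝓘(ℝ, E) (dualModel E F) ∞ (fun y => (⟨y, 𝒢.inner y (s y)⟩ : DualTot F A)) q :=
  (𝒢.contMDiff q).clm_bundle_apply hs

theorem contMDiffAt_inner {s t : ∀ q, A q} {q : Q}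
    (hs : ContMDiffAt 𝓘(ℝ, E) (𝓘(ℝ, E).prod 𝓘(ℝ, F)) ∞ (fun y => TotalSpace.mk' F y (s y)) q)
    (ht : ContMDiffAt 𝓘(ℝ, E) (𝓘(ℝ, E).prod 𝓘(ℝ, F)) ∞ (fun y => TotalSpace.mk' F y (t y)) q) :
    ContMDiffAt 𝓘(ℝ, E) 𝓘(ℝ, ℝ) ∞ (fun y => 𝒢.inner y (s y) (t y)) q := by
  have h := contMDiffAt_dual_apply (α := (⟨q, 𝒢.inner q (s q)⟩ : DualTot F A)) ht
  exact h.comp q (contMDiffAt_flat 𝒢 hs)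

/-- Gram–Schmidt with smooth dependence on the base point. The span condition at `q` serves the
induction: it ensures that the next section, minus its projection, does not vanish at `q`. -/
theorem exists_orthonormal_sections (q : Q) {k : ℕ} (f : Fin k → ∀ y, A y)
    (hf : ∀ i, ContMDiffAt 𝓘(ℝ, E) (𝓘(ℝ, E).prod 𝓘(ℝ, F)) ∞
      (fun y => TotalSpace.mk' F y (f i y)) q)
    (hli : LinearIndependent ℝ (fun i => f i q)) :
    ∃ e : Fin k → ∀ y, A y,
      (∀ i, ContMDiffAt 𝓘(ℝ, E) (𝓘(ℝ, E).prod 𝓘(ℝ, F)) ∞ (fun y => TotalSpace.mk' F y (e i y)) q) ∧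
      (∀ᶠ y in nhds q, ∀ i j, 𝒢.inner y (e i y) (e j y) = if i = j then 1 else 0) ∧
      ∀ i, e i q ∈ Submodule.span ℝ (Set.range fun i => f i q) := by
  induction k with
  | zero => exact ⟨fun i => i.elim0, fun i => i.elim0, .of_forall fun _ i => i.elim0, fun i => i.elim0⟩
  | succ k ih =>
    obtain ⟨e, he, ho, hsp⟩ := ih (fun i => f i.castSucc) (fun i => hf _)
      (hli.comp _ (Fin.castSucc_injective k))
    let u : ∀ y, A y := f (Fin.last k)
    let g : ∀ y, A y := fun y => u y - ∑ i, 𝒢.inner y (e i y) (u y) • e i y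
    have hu := hf (Fin.last k)
    have hg : ContMDiffAt 𝓘(ℝ, E) (𝓘(ℝ, E).prod 𝓘(ℝ, F)) ∞ (fun y => TotalSpace.mk' F y (g y)) q :=
      hu.sub_section (ContMDiffAt.sum_section fun i _ =>
        (contMDiffAt_inner 𝒢 (he i) hu).smul_section (he i))
    have hgq : g q ≠ 0 := by
      intro h0
      have h1 : f (Fin.last k) q ∈ Submodule.span ℝ (Set.range fun i : Fin k => f i.castSucc q) := by
        have h2 : u q = ∑ i, 𝒢.inner q (e i q) (u q) • e i q := sub_eq_zero.mp h0
        show u q ∈ _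
        rw [h2]
        exact Submodule.sum_mem _ fun i _ => Submodule.smul_mem _ _ (hsp i)
      have h2 := hli.notMem_span_image (s := Set.range Fin.castSucc) (x := Fin.last k) (by
        rintro ⟨i, hi⟩
        exact (Fin.castSucc_lt_last i).ne hi)
      rw [← Set.range_comp] at h2
      exact h2 h1
    have hN := contMDiffAt_inner 𝒢 hg hg
    -- Independence is assumed only at `q`; continuity of the squared norm extends nonvanishing to a
    -- neighbourhood.
    have hpos : ∀ᶠ y in nhds q, 0 < 𝒢.inner y (g y) (g y) :=
      hN.continuousAt.eventually (lt_mem_nhds (𝒢.pos q _ hgq))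
    let r : Q → ℝ := fun y => (Real.sqrt (𝒢.inner y (g y) (g y)))⁻¹
    have hr : ContMDiffAt 𝓘(ℝ, E) 𝓘(ℝ, ℝ) ∞ r q := by
      have h1 : ContDiffAt ℝ ∞ (fun x : ℝ => (Real.sqrt x)⁻¹) (𝒢.inner q (g q) (g q)) :=
        (contDiffAt_id.sqrt (𝒢.pos q _ hgq).ne').inv (Real.sqrt_pos.mpr (𝒢.pos q _ hgq)).ne'
      exact ContMDiffAt.comp (I' := 𝓘(ℝ, ℝ)) (g := fun x : ℝ => (Real.sqrt x)⁻¹) q h1.contMDiffAt hN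
    refine ⟨Fin.snoc (α := fun _ => ∀ y, A y) e (fun y => r y • g y), ?_, ?_, ?_⟩
    · intro i
      refine Fin.lastCases ?_ (fun i => ?_) i
      · simp only [Fin.snoc_last]
        exact hr.smul_section hg
      · simp only [Fin.snoc_castSucc]
        exact he i
    · filter_upwards [ho, hpos] with y hy hpy
      have hge : ∀ j, 𝒢.inner y (g y) (e j y) = 0 := by
        intro j
        simp only [g, map_sub, map_sum, map_smul, _root_.sub_apply, _root_.sum_apply,
          _root_.smul_apply, hy, smul_eq_mul, mul_ite, mul_one, mul_zero, Finset.sum_ite_eq',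
          Finset.mem_univ, if_true]
        rw [𝒢.symm, sub_self]
      intro i j
      refine Fin.lastCases ?_ (fun i => ?_) i <;> refine Fin.lastCases ?_ (fun j => ?_) j
      · simp only [Fin.snoc_last, map_smul, _root_.smul_apply, smul_eq_mul, if_true, r]
        rw [← mul_assoc, ← mul_inv, Real.mul_self_sqrt hpy.le, inv_mul_cancel₀ hpy.ne']
      · simp only [Fin.snoc_last, Fin.snoc_castSucc, map_smul, _root_.smul_apply, hge, smul_zero]
        rw [if_neg (Fin.castSucc_lt_last j).ne']
      · simp only [Fin.snoc_last, Fin.snoc_castSucc, map_smul]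
        rw [𝒢.symm, hge, smul_zero, if_neg (Fin.castSucc_lt_last i).ne]
      · simp only [Fin.snoc_castSucc, hy, Fin.castSucc_inj]
    · have hle : Submodule.span ℝ (Set.range fun i : Fin k => f i.castSucc q) ≤
          Submodule.span ℝ (Set.range fun i => f i q) := by
        refine Submodule.span_mono ?_
        rintro _ ⟨i, rfl⟩
        exact ⟨i.castSucc, rfl⟩
      intro i
      refine Fin.lastCases ?_ (fun i => ?_) i
      · simp only [Fin.snoc_last]
        exact Submodule.smul_mem _ _ (Submodule.sub_mem _ (Submodule.subset_span ⟨_, rfl⟩)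
          (Submodule.sum_mem _ fun i _ => Submodule.smul_mem _ _ (hle (hsp i))))
      · simp only [Fin.snoc_castSucc]
        exact hle (hsp i)

theorem exists_orthonormal_frame (q : Q) : ∃ e : Fin (finrank ℝ F) → ∀ y, A y,
    (∀ i, ContMDiffAt 𝓘(ℝ, E) (𝓘(ℝ, E).prod 𝓘(ℝ, F)) ∞ (fun y => TotalSpace.mk' F y (e i y)) q) ∧
    ∀ᶠ y in nhds q, ∀ i j, 𝒢.inner y (e i y) (e j y) = if i = j then 1 else 0 := by
  let t := trivializationAt F A q
  have hq : q ∈ t.baseSet := FiberBundle.mem_baseSet_trivializationAt' q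
  obtain ⟨e, h1, h2, -⟩ := exists_orthonormal_sections 𝒢 q (t.localFrame (finBasis ℝ F))
    (fun i => contMDiffAt_localFrame_of_mem ∞ t (finBasis ℝ F) i hq) (by
      have h : (fun i => t.localFrame (finBasis ℝ F) i q) = t.basisAt (finBasis ℝ F) hq := by
        funext i
        exact Trivialization.localFrame_apply_of_mem_baseSet _ _ hq
      rw [h]
      exact Basis.linearIndependent _)
  exact ⟨e, h1, h2⟩

section Fibre

variable {𝒢} {q : Q} {e : Fin (finrank ℝ F) → A q}
  (he : ∀ i j, 𝒢.inner q (e i) (e j) = if i = j then 1 else 0)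
include he

theorem sum_inner_smul_of_orthonormal (w : A q) : ∑ i, 𝒢.inner q (e i) w • e i = w := by
  have : FiniteDimensional ℝ (A q) := VectorBundle.finiteDimensional ℝ F A q
  have hli : LinearIndependent ℝ e := by
    rw [Fintype.linearIndependent_iff]
    intro c hc i
    have h := congrArg (𝒢.inner q (e i)) hc
    simpa [he] using h
  have hcard : Fintype.card (Fin (finrank ℝ F)) = finrank ℝ (A q) := by
    rw [Fintype.card_fin, VectorBundle.finrank_eq ℝ F A q]
  let b := basisOfLinearIndependentOfCardEqFinrank' e hli hcard
  have hb : ∀ i, b i = e i := fun i => by simp [b]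
  have h : ∀ i, 𝒢.inner q (e i) w = b.repr w i := by
    intro i
    conv_lhs => rw [← b.sum_repr w]
    simp [hb, he]
  exact (Finset.sum_congr rfl fun i _ => by rw [h, ← hb]).trans (b.sum_repr w)

theorem dualMetric_of_orthonormal (α β : DualFib A q) :
    dualMetric 𝒢 q α β = ∑ i, α (e i) * β (e i) := by
  rw [dualMetric, inner_sharp]
  conv_lhs => rw [← sum_inner_smul_of_orthonormal he (sharp 𝒢 q β)]
  rw [map_sum]
  refine Finset.sum_congr rfl fun i _ => ?_
  rw [map_smul, 𝒢.symm, inner_sharp, smul_eq_mul, mul_comm]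

theorem exists_basis_of_orthonormal : ∃ b : Basis (Fin (finrank ℝ F)) ℝ (DualFib A q),
    (∀ i, b i = 𝒢.inner q (e i)) ∧ ∀ β i, b.repr β i = β (e i) := by
  have : FiniteDimensional ℝ (A q) := VectorBundle.finiteDimensional ℝ F A q
  have hexp : ∀ β : DualFib A q, ∑ i, β (e i) • (𝒢.inner q (e i) : DualFib A q) = β := by
    intro β
    ext w
    conv_rhs => rw [← sum_inner_smul_of_orthonormal he w]
    rw [map_sum, _root_.sum_apply]
    refine Finset.sum_congr rfl fun i _ => ?_
    rw [map_smul, _root_.smul_apply, smul_eq_mul, smul_eq_mul, mul_comm]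
  have hcard : Fintype.card (Fin (finrank ℝ F)) = finrank ℝ (DualFib A q) := by
    have h1 : finrank ℝ (DualFib A q) = finrank ℝ (F →L[ℝ] ℝ) :=
      VectorBundle.finrank_eq ℝ (F →L[ℝ] ℝ) (DualFib A) q
    rw [h1, finrank_eq_card_basis (finDualBasis F)]
  let b : Basis (Fin (finrank ℝ F)) ℝ (DualFib A q) := basisOfTopLeSpanOfCardEqFinrank
    (fun i => (𝒢.inner q (e i) : DualFib A q)) (fun β _ => by
      rw [← hexp β]
      exact Submodule.sum_mem _ fun i _ => Submodule.smul_mem _ _ (Submodule.subset_span ⟨i, rfl⟩))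
    hcard
  have hb : ∀ i, b i = 𝒢.inner q (e i) := fun i => by simp [b]
  refine ⟨b, hb, fun β i => ?_⟩
  conv_lhs => rw [← hexp β]
  simp only [← hb, b.repr_sum_self]

/-- The transition matrix between orthonormal bases is orthogonal, so its determinant is `±1`. Hence
the pointwise choice of basis in `metricVolume` is immaterial. -/
theorem abs_apply_of_orthonormal (Λ : DualFib A q [⋀^Fin (finrank ℝ F)]→ₗ[ℝ] ℝ)
    {ε : Fin (finrank ℝ F) → DualFib A q}
    (hε : ∀ i j, dualMetric 𝒢 q (ε i) (ε j) = if i = j then 1 else 0) :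
    |Λ ε| = |Λ fun i => 𝒢.inner q (e i)| := by
  obtain ⟨b, hb, hrepr⟩ := exists_basis_of_orthonormal he
  have hdet : b.det ε * b.det ε = 1 := by
    rw [b.det_apply]
    conv_lhs => enter [1]; rw [← Matrix.det_transpose]
    rw [← Matrix.det_mul]
    have : (b.toMatrix ε).transpose * b.toMatrix ε = 1 := by
      ext i j
      rw [Matrix.mul_apply, Matrix.one_apply, ← hε, dualMetric_of_orthonormal he]
      simp [Basis.toMatrix_apply, hrepr]
    rw [this, Matrix.det_one]
  have h2 : |b.det ε| = 1 := by
    rcases mul_self_eq_one_iff.mp hdet with h | h <;> simp [h]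
  have h3 : (fun i => (𝒢.inner q (e i) : DualFib A q)) = b := funext fun i => (hb i).symm
  rw [h3, Λ.eq_smul_basis_det b, AlternatingMap.smul_apply, AlternatingMap.smul_apply, smul_eq_mul,
    smul_eq_mul, abs_mul, abs_mul, h2, b.det_self, abs_one]

theorem apply_ne_zero_of_orthonormal {Λ : DualFib A q [⋀^Fin (finrank ℝ F)]→ₗ[ℝ] ℝ} (hΛ : Λ ≠ 0) :
    Λ (fun i => 𝒢.inner q (e i)) ≠ 0 := by
  obtain ⟨b, hb, -⟩ := exists_basis_of_orthonormal he
  have h3 : (fun i => (𝒢.inner q (e i) : DualFib A q)) = b := funext fun i => (hb i).symm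
  rw [h3]
  intro h
  apply hΛ
  rw [Λ.eq_smul_basis_det b, h, zero_smul]

end Fibre

/-- In a smooth local orthonormal frame the kinetic energy is half the sum of the squares of the
fibre coordinates. -/
theorem contMDiff_mechHam (V : C^∞⟮𝓘(ℝ, E), Q; ℝ⟯) :
    ContMDiff (dualModel E F) 𝓘(ℝ, ℝ) ∞ (mechHam 𝒢 V) := by
  intro α
  obtain ⟨e, he, ho⟩ := exists_orthonormal_frame 𝒢 α.proj
  have h0 : ContMDiffAt (dualModel E F) 𝓘(ℝ, ℝ) ∞ (fun β : DualTot F A =>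
      ∑ i, β.2 (e i β.proj) * β.2 (e i β.proj)) α :=
    contMDiffAt_finsetSum fun i _ => (contMDiffAt_dual_apply (he i)).mul (contMDiffAt_dual_apply (he i))
  have h2 : ContMDiffAt (dualModel E F) 𝓘(ℝ, ℝ) ∞ (fun _ : DualTot F A => (1 / 2 : ℝ)) α :=
    contMDiffAt_const
  have h1 : ContMDiffAt (dualModel E F) 𝓘(ℝ, ℝ) ∞ (fun β : DualTot F A =>
      (1 / 2) * ∑ i, β.2 (e i β.proj) * β.2 (e i β.proj) + V β.proj) α :=
    (h2.mul h0).add (V.contMDiff.contMDiffAt.comp α (contMDiffAt_proj _))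
  refine h1.congr_of_eventuallyEq ?_
  filter_upwards [((FiberBundle.continuous_proj (F →L[ℝ] ℝ) (DualFib A)).tendsto α).eventually ho]
    with β hβ
  rw [mechHam, dualMetric_of_orthonormal hβ]

/-- The arbitrary orthonormal bases can be replaced locally by a smooth orthonormal frame, on which
`Λ₀` is nonzero; the inverse of the absolute value is smooth away from zero. -/
theorem isVolumeSection_metricVolume {Λ₀ : ∀ q : Q, DualFib A q [⋀^Fin (finrank ℝ F)]→ₗ[ℝ] ℝ}
    (hΛ₀ : IsVolumeSection E F Λ₀) : IsVolumeSection E F (metricVolume 𝒢 Λ₀) := by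
  have habs : ∀ {q : Q} {e : Fin (finrank ℝ F) → A q},
      (∀ i j, 𝒢.inner q (e i) (e j) = if i = j then 1 else 0) →
      |Λ₀ q (exists_orthonormal 𝒢 q).choose| = |Λ₀ q fun i => 𝒢.inner q (e i)| := fun he =>
    abs_apply_of_orthonormal he _ (exists_orthonormal 𝒢 _).choose_spec
  constructor
  · intro q α hα
    obtain ⟨e, he, ho⟩ := exists_orthonormal_frame 𝒢 q
    have h1 := hΛ₀.smooth q _ fun i => contMDiffAt_flat 𝒢 (he i)
    have h3 := apply_ne_zero_of_orthonormal ho.self_of_nhds (hΛ₀.ne_zero q)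
    have h4 : ContDiffAt ℝ ∞ (fun x : ℝ => |x|⁻¹) (Λ₀ q fun i => 𝒢.inner q (e i q)) :=
      (contDiffAt_abs h3).inv (abs_ne_zero.mpr h3)
    refine ((h4.contMDiffAt.comp q h1).mul (hΛ₀.smooth q α hα)).congr_of_eventuallyEq ?_
    filter_upwards [ho] with y hy
    show |Λ₀ y (exists_orthonormal 𝒢 y).choose|⁻¹ * Λ₀ y (fun i => α i y) = _
    rw [habs hy]
    rfl
  · intro q
    obtain ⟨e, -, ho⟩ := exists_orthonormal_frame 𝒢 q
    refine smul_ne_zero (inv_ne_zero ?_) (hΛ₀.ne_zero q)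
    rw [habs ho.self_of_nhds]
    exact abs_ne_zero.mpr (apply_ne_zero_of_orthonormal ho.self_of_nhds (hΛ₀.ne_zero q))

theorem sharp_smul (q : Q) (c : ℝ) (α : DualFib A q) : sharp 𝒢 q (c • α) = c • sharp 𝒢 q α := by
  unfold sharp
  exact map_smul _ c α.toLinearMap

theorem eq_zero_of_dualMetric_self (q : Q) (α : DualFib A q) (h : dualMetric 𝒢 q α α = 0) : α = 0 := by
  have h1 : sharp 𝒢 q α = 0 := by
    by_contra h0
    exact (𝒢.pos q _ h0).ne' h
  ext w
  rw [← inner_sharp 𝒢, h1, map_zero]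

/-- This is Euler's identity: the curve `(1 + t) s(q)` through `s(q)` has kinetic energy `(1 + t)² /
2` times the squared norm of `s(q)`, and the potential is constant along it. -/
theorem dirDeriv_mechHam_vertLift_self (V : C^∞⟮𝓘(ℝ, E), Q; ℝ⟯) (s : ∀ q, DualFib A q) (q : Q) :
    dirDeriv (dualModel E F) (mechHam 𝒢 V) ⟨q, s q⟩ (vertLift s ⟨q, s q⟩)
      = dualMetric 𝒢 q (s q) (s q) := by
  have h := LieAlgebroid.dirDeriv_vertLift (⟨q, s q⟩ : DualTot F A)
    ((contMDiff_mechHam 𝒢 V _).mdifferentiableAt (by simp)) s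
  refine h.trans ?_
  have h2 : (fun t : ℝ => mechHam 𝒢 V (⟨q, s q + t • s q⟩ : DualTot F A))
      = fun t => (1 / 2) * (1 + t) ^ 2 * dualMetric 𝒢 q (s q) (s q) + V q := by
    funext t
    have h3 : s q + t • s q = (1 + t) • s q := by module
    show (1 / 2) * dualMetric 𝒢 q (s q + t • s q) (s q + t • s q) + V q = _
    rw [h3, dualMetric, sharp_smul, dualMetric, map_smul, map_smul, _root_.smul_apply]
    simp only [smul_eq_mul]
    ring
  show deriv (fun t : ℝ => mechHam 𝒢 V (⟨q, s q + t • s q⟩ : DualTot F A)) 0 = _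
  rw [h2]
  have h4 : HasDerivAt (fun t : ℝ => (1 / 2) * (1 + t) ^ 2 * dualMetric 𝒢 q (s q) (s q) + V q)
      ((1 / 2) * (2 * (1 + 0)) * dualMetric 𝒢 q (s q) (s q)) 0 := by
    have := ((((hasDerivAt_id (0 : ℝ)).const_add 1).pow 2).const_mul (1 / 2 : ℝ)).mul_const
      (dualMetric 𝒢 q (s q) (s q)) |>.add_const (V q)
    simpa using this
  rw [h4.deriv]
  ring

end Metric

/-! ### Change of volumes, and preservation by hamiltonian vector fields. -/

section Preservation

variable {E : Type*} [NormedAddCommGroup E] [NormedSpace ℝ E]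
  {Q : Type*} [TopologicalSpace Q] [ChartedSpace E Q]
  {F : Type*} [NormedAddCommGroup F] [NormedSpace ℝ F]
  {A : Q → Type*} [∀ q, AddCommGroup (A q)] [∀ q, Module ℝ (A q)] [∀ q, TopologicalSpace (A q)]
  [∀ q, IsTopologicalAddGroup (A q)] [∀ q, ContinuousSMul ℝ (A q)]
  [TopologicalSpace (TotalSpace F A)] [FiberBundle F A] [VectorBundle ℝ F A]
  [IsManifold 𝓘(ℝ, E) ∞ Q] [ContMDiffVectorBundle ∞ F A 𝓘(ℝ, E)]
  [FiniteDimensional ℝ E] [FiniteDimensional ℝ F] [T2Space Q]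


theorem vertLift_neg (s : ∀ q, DualFib A q) (α : DualTot F A) :
    vertLift (E := E) (fun q => -s q) α = -vertLift s α := by
  refine eq_of_affD fun X f => ?_
  rw [map_neg, affD_vertLift, affD_vertLift]
  rfl

theorem vertLift_add (s t : ∀ q, DualFib A q) (α : DualTot F A) :
    vertLift (E := E) (fun q => s q + t q) α = vertLift s α + vertLift t α := by
  refine eq_of_affD fun X f => ?_
  rw [map_add, affD_vertLift, affD_vertLift, affD_vertLift]
  rfl

theorem vertLift_eq_zero {s : ∀ q, DualFib A q} {α : DualTot F A} (h : s α.proj = 0) :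
    vertLift (E := E) s α = 0 := by
  refine eq_of_affD fun X f => ?_
  rw [map_zero, affD_vertLift, h]
  rfl

theorem vertLift_smul (c : ℝ) {s t : ∀ q, DualFib A q} {α : DualTot F A}
    (h : t α.proj = c • s α.proj) : vertLift (E := E) t α = c • vertLift s α := by
  refine eq_of_affD fun X f => ?_
  rw [map_smul, affD_vertLift, affD_vertLift, h]
  rfl

theorem exists_eq_smul_of_alternating {V ι : Type*} [AddCommGroup V] [Module ℝ V] [Fintype ι]
    [DecidableEq ι] (b : Basis ι ℝ V) (f : V [⋀^ι]→ₗ[ℝ] ℝ) {g : V [⋀^ι]→ₗ[ℝ] ℝ} (hg : g ≠ 0) :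
    ∃ c : ℝ, f = c • g := by
  have h : g b ≠ 0 := fun h => hg (by rw [g.eq_smul_basis_det b, h, zero_smul])
  have h1 : (f b / g b) • g = (f b / g b) • g b • b.det :=
    congrArg (fun k => (f b / g b) • k) (g.eq_smul_basis_det b)
  refine ⟨f b / g b, (f.eq_smul_basis_det b).trans ?_⟩
  rw [h1, smul_smul, div_mul_cancel₀ _ h]

/-- Top-degree forms are proportional at each point, and the factor is smooth as the quotient of
their values on a local coordinate frame. -/
theorem exists_smul_of_isVolumeForm
    {ν ν' : ∀ q : Q, TangentSpace 𝓘(ℝ, E) q [⋀^Fin (finrank ℝ E)]→ₗ[ℝ] ℝ}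
    (hν : IsVolumeForm 𝓘(ℝ, E) ν) (hν' : IsVolumeForm 𝓘(ℝ, E) ν') :
    ∃ a : C^∞⟮𝓘(ℝ, E), Q; ℝ⟯, (∀ q, a q ≠ 0) ∧ ∀ q, ν' q = a q • ν q := by
  have h : ∀ q, ∃ c : ℝ, ν' q = c • ν q := fun q =>
    exists_eq_smul_of_alternating (V := TangentSpace 𝓘(ℝ, E) q) (finBasis ℝ E) (ν' q) (hν.ne_zero q)
  choose a ha using h
  refine ⟨⟨a, fun q => ?_⟩, fun q h0 => hν'.ne_zero q ?_, ha⟩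
  · have hd := baseFrame_ne_zero hν q q (mem_extChartAt_source q)
    have h1 := (hν'.smooth q _ (smoothFieldAt_baseFrame q)).div₀
      (hν.smooth q _ (smoothFieldAt_baseFrame q)) hd
    refine h1.congr_of_eventuallyEq ?_
    filter_upwards [extChartAt_source_mem_nhds (I := 𝓘(ℝ, E)) q] with y hy
    rw [Pi.div_apply, ha y, AlternatingMap.smul_apply, smul_eq_mul,
      mul_div_cancel_right₀ _ (baseFrame_ne_zero hν q y hy)]
  · have h0' : a q = 0 := h0
    rw [ha, h0', zero_smul]

theorem exists_smul_of_isVolumeSection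
    {Λ Λ' : ∀ q : Q, DualFib A q [⋀^Fin (finrank ℝ F)]→ₗ[ℝ] ℝ}
    (hΛ : IsVolumeSection E F Λ) (hΛ' : IsVolumeSection E F Λ') :
    ∃ a : C^∞⟮𝓘(ℝ, E), Q; ℝ⟯, (∀ q, a q ≠ 0) ∧ ∀ q, Λ' q = a q • Λ q := by
  have h : ∀ q, ∃ c : ℝ, Λ' q = c • Λ q := fun q =>
    exists_eq_smul_of_alternating ((trivializationAt (F →L[ℝ] ℝ) (DualFib A) q).basisAt
      (finDualBasis F) (FiberBundle.mem_baseSet_trivializationAt' q)) (Λ' q) (hΛ.ne_zero q)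
  choose a ha using h
  refine ⟨⟨a, fun q => ?_⟩, fun q h0 => hΛ'.ne_zero q ?_, ha⟩
  · have hq := FiberBundle.mem_baseSet_trivializationAt' (F := F →L[ℝ] ℝ) (E := DualFib A) q
    have hd := dualFrame_ne_zero q q (hΛ.ne_zero q) hq
    have h1 := (hΛ'.smooth q _ (contMDiffAt_dualFrame q)).div₀
      (hΛ.smooth q _ (contMDiffAt_dualFrame q)) hd
    refine h1.congr_of_eventuallyEq ?_
    filter_upwards [(trivializationAt (F →L[ℝ] ℝ) (DualFib A) q).open_baseSet.mem_nhds hq] with y hy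
    rw [Pi.div_apply, ha y, AlternatingMap.smul_apply, smul_eq_mul,
      mul_div_cancel_right₀ _ (dualFrame_ne_zero q y (hΛ.ne_zero y) hy)]
  · have h0' : a q = 0 := h0
    rw [ha, h0', zero_smul]

theorem wedgeVol_smul {ν ν' : ∀ q : Q, TangentSpace 𝓘(ℝ, E) q [⋀^Fin (finrank ℝ E)]→ₗ[ℝ] ℝ}
    {Λ Λ' : ∀ q : Q, DualFib A q [⋀^Fin (finrank ℝ F)]→ₗ[ℝ] ℝ} {a b : Q → ℝ}
    (ha : ∀ q, ν' q = a q • ν q) (hb : ∀ q, Λ' q = b q • Λ q) :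
    wedgeVol (E := E) ν' Λ' = fun α : DualTot F A => (a α.proj * b α.proj) • wedgeVol ν Λ α := by
  funext α
  ext z
  rw [AlternatingMap.smul_apply, (wedgeVol_hasCoordForm ν' Λ' α).apply_self,
    (wedgeVol_hasCoordForm ν Λ α).apply_self, wedgeDensity, wedgeDensity, ha, hb,
    AlternatingMap.smul_apply, AlternatingMap.smul_apply]
  simp only [smul_eq_mul]
  ring

/-- At every point of `A*` a form which does not vanish there takes a nonzero value on some smooth
vector fields. -/
theorem exists_smoothFieldAt_apply_ne_zero (α : DualTot F A)
    {Φ : TangentSpace (dualModel E F) α [⋀^Fin (finrank ℝ E) ⊕ Fin (finrank ℝ F)]→ₗ[ℝ] ℝ}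
    (hΦ : Φ ≠ 0) :
    ∃ Z : Fin (finrank ℝ E) ⊕ Fin (finrank ℝ F) → ∀ β, TangentSpace (dualModel E F) β,
      (∀ i, SmoothFieldAt (dualModel E F) (Z i) α) ∧ Φ (fun i => Z i α) ≠ 0 := by
  haveI : IsManifold (dualModel E F) 1 (DualTot F A) := IsManifold.of_le (n := ∞) (by simp)
  haveI : IsManifold (dualModel E F) (∞ + 1) (DualTot F A) :=
    inferInstanceAs (IsManifold (dualModel E F) ∞ (DualTot F A))
  haveI : ContMDiffVectorBundle ∞ (E × (F →L[ℝ] ℝ))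
      (TangentSpace (dualModel E F) : DualTot F A → Type _) (dualModel E F) :=
    TangentBundle.contMDiffVectorBundle
  let t := trivializationAt (E × (F →L[ℝ] ℝ)) (TangentSpace (dualModel E F) : DualTot F A → Type _) α
  have hα : α ∈ t.baseSet := FiberBundle.mem_baseSet_trivializationAt' α
  refine ⟨t.localFrame (modelBasis E F),
    fun i => contMDiffAt_localFrame_of_mem ∞ t (modelBasis E F) i hα, fun h => hΦ ?_⟩
  have hb : (fun i => t.localFrame (modelBasis E F) i α) = t.basisAt (modelBasis E F) hα := by
    funext i
    exact Trivialization.localFrame_apply_of_mem_baseSet _ _ hα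
  rw [hb] at h
  rw [Φ.eq_smul_basis_det (t.basisAt (modelBasis E F) hα), h, zero_smul]

namespace LieAlgebroid

variable (L : LieAlgebroid E F A)

theorem dA_add (σ τ : C^∞⟮𝓘(ℝ, E), Q; ℝ⟯) (q : Q) : L.dA (σ + τ) q = L.dA σ q + L.dA τ q := by
  ext v
  exact dirDeriv_add ((σ.contMDiff q).mdifferentiableAt (by simp))
    ((τ.contMDiff q).mdifferentiableAt (by simp)) _

theorem dA_comp {σ τ : C^∞⟮𝓘(ℝ, E), Q; ℝ⟯} {g : ℝ → ℝ} {c : ℝ} {q : Q}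
    (hg : HasDerivAt g c (σ q)) (h : (τ : Q → ℝ) = g ∘ σ) : L.dA τ q = c • L.dA σ q := by
  have h1 := mfderiv_comp q (I'' := 𝓘(ℝ, ℝ)) (hg.differentiableAt.mdifferentiableAt)
    ((σ.contMDiff q).mdifferentiableAt (by simp))
  ext v
  show dirDeriv 𝓘(ℝ, E) τ q (L.anchor q v) = c * dirDeriv 𝓘(ℝ, E) σ q (L.anchor q v)
  unfold dirDeriv
  rw [h, h1, mfderiv_eq_fderiv]
  have h2 : ∀ r : ℝ, fderiv ℝ g (σ q) r = c * r := by
    intro r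
    rw [hg.hasFDerivAt.fderiv]
    simp [mul_comm]
  exact h2 (mfderiv 𝓘(ℝ, E) 𝓘(ℝ, ℝ) σ q (L.anchor q v))

/-- `{μ ∘ τ, φ}` is the derivative of `φ` along the vertical lift of `d^A μ`. -/
theorem dirDeriv_proj_hamVF (μ : C^∞⟮𝓘(ℝ, E), Q; ℝ⟯) (φ : DualTot F A → ℝ) (α : DualTot F A) :
    dirDeriv (dualModel E F) (fun β : DualTot F A => μ β.proj) α (L.hamVF φ α)
      = dirDeriv (dualModel E F) φ α (vertLift (L.dA μ) α) := by
  obtain ⟨Y, g, hφ⟩ := exists_affine (E := E) φ α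
  let μ' : C^∞⟮dualModel E F, DualTot F A; ℝ⟯ :=
    ⟨fun β => μ β.proj, μ.contMDiff.comp (contMDiff_proj _)⟩
  refine (L.dirDeriv_hamVF φ α μ').trans ?_
  have h0 : ∀ v, dirDeriv (dualModel E F) (μ' : DualTot F A → ℝ) α v
      = dirDeriv (dualModel E F) (fun β : DualTot F A =>
        linFun (0 : Cₛ^∞⟮𝓘(ℝ, E); F, A⟯) β + μ β.proj) α v := by
    intro v
    simp only [linFun_zero, zero_add]
    rfl
  rw [L.poissonBracket_eq h0 hφ, hφ]
  have h1 := affD_vertLift Y g α (L.dA μ)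
  refine Eq.trans ?_ h1.symm
  rw [map_zero, LinearMap.zero_apply, linFun_zero]
  have h2 := L.anchorDeriv_zero_left g α.proj
  unfold anchorDeriv at h2
  rw [h2, neg_zero, zero_add, sub_zero]
  rfl

variable {ν : ∀ q : Q, TangentSpace 𝓘(ℝ, E) q [⋀^Fin (finrank ℝ E)]→ₗ[ℝ] ℝ}
  {Λ : ∀ q : Q, DualFib A q [⋀^Fin (finrank ℝ F)]→ₗ[ℝ] ℝ}

/-- The product rule together with `𝓗_φ(ρ ∘ τ) = (d^A ρ)^v(φ)`. The hypothesis `hρ` is the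
logarithmic derivative relation, met by `τ = log |ρ|`; it covers exponential factors and changes of
volume at once. -/
theorem lieDerivForm_hamVF_smul_wedgeVol (hν : IsVolumeForm 𝓘(ℝ, E) ν) (hΛ : IsVolumeSection E F Λ)
    {ρ τ : C^∞⟮𝓘(ℝ, E), Q; ℝ⟯} (φ : DualTot F A → ℝ) {α : DualTot F A}
    (hρ : L.dA ρ α.proj = ρ α.proj • L.dA τ α.proj)
    {Z : Fin (finrank ℝ E) ⊕ Fin (finrank ℝ F) → ∀ β, TangentSpace (dualModel E F) β}
    (hZ : ∀ i, SmoothFieldAt (dualModel E F) (Z i) α) :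
    lieDerivForm (dualModel E F) (L.hamVF φ) (fun β => ρ β.proj • wedgeVol ν Λ β) Z α
      = ρ α.proj * (dirDeriv (dualModel E F) φ α (vertLift (L.dA τ) α)
          * wedgeVol ν Λ α (fun i => Z i α)
        + lieDerivForm (dualModel E F) (L.hamVF φ) (wedgeVol ν Λ) Z α) := by
  have h1 : MDifferentiableAt (dualModel E F) 𝓘(ℝ, ℝ) (fun β : DualTot F A => ρ β.proj) α :=
    (ρ.contMDiff.comp (contMDiff_proj _)).contMDiffAt.mdifferentiableAt (by simp)
  have h2 := (wedgeVol_hasCoordForm ν Λ α).contMDiffAt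
    ((contMDiffAt_wedgeDensity hν hΛ α.proj).comp α (contMDiffAt_proj _)) hZ
  rw [lieDerivForm_smul h1 (h2.mdifferentiableAt (by simp)), L.dirDeriv_proj_hamVF,
    vertLift_smul _ hρ]
  have h3 : dirDeriv (dualModel E F) φ α (ρ α.proj • vertLift (L.dA τ) α)
      = ρ α.proj * dirDeriv (dualModel E F) φ α (vertLift (L.dA τ) α) :=
    map_smul (mfderiv (dualModel E F) 𝓘(ℝ, ℝ) φ α) _ _
  rw [h3]
  ring

theorem dirDeriv_vertLift_neg (s : ∀ q, DualFib A q) (φ : DualTot F A → ℝ) (α : DualTot F A) :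
    dirDeriv (dualModel E F) φ α (vertLift (fun q => -s q) α)
      = -dirDeriv (dualModel E F) φ α (vertLift s α) := by
  rw [vertLift_neg]
  exact map_neg (mfderiv (dualModel E F) 𝓘(ℝ, ℝ) φ α) _

/-- `ℒ_{X_φ} (e^{σ ∘ τ} ν ∧ Λ)` in terms of `ℒ_{X_φ} (ν ∧ Λ)`. -/
theorem lieDerivForm_hamVF_expWedgeVol (hν : IsVolumeForm 𝓘(ℝ, E) ν) (hΛ : IsVolumeSection E F Λ)
    (σ : C^∞⟮𝓘(ℝ, E), Q; ℝ⟯) (φ : DualTot F A → ℝ) {α : DualTot F A}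
    {Z : Fin (finrank ℝ E) ⊕ Fin (finrank ℝ F) → ∀ β, TangentSpace (dualModel E F) β}
    (hZ : ∀ i, SmoothFieldAt (dualModel E F) (Z i) α) :
    lieDerivForm (dualModel E F) (L.hamVF φ) (expWedgeVol σ ν Λ) Z α
      = Real.exp (σ α.proj) * (dirDeriv (dualModel E F) φ α (vertLift (L.dA σ) α)
          * wedgeVol ν Λ α (fun i => Z i α)
        + lieDerivForm (dualModel E F) (L.hamVF φ) (wedgeVol ν Λ) Z α) := by
  let ρ : C^∞⟮𝓘(ℝ, E), Q; ℝ⟯ :=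
    ⟨fun q => Real.exp (σ q), Real.contDiff_exp.contMDiff.comp σ.contMDiff⟩
  exact L.lieDerivForm_hamVF_smul_wedgeVol hν hΛ (ρ := ρ) (τ := σ) φ
    (L.dA_comp (Real.hasDerivAt_exp _) rfl) hZ

/-- The section `-d^A σ` is the modular section of `A` if and only if all the hamiltonian vector fields
preserve `e^{σ ∘ τ} ν ∧ Λ`. -/
theorem isModularSection_neg_dA_iff (hν : IsVolumeForm 𝓘(ℝ, E) ν) (hΛ : IsVolumeSection E F Λ)
    (σ : C^∞⟮𝓘(ℝ, E), Q; ℝ⟯) :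
    L.IsModularSection ν Λ (fun q => -L.dA σ q) ↔
      ∀ φ : C^∞⟮dualModel E F, DualTot F A; ℝ⟯,
        Preserves (dualModel E F) (L.hamVF φ) (expWedgeVol σ ν Λ) := by
  refine forall_congr' fun φ => forall_congr' fun α => forall_congr' fun Z => ?_
  refine forall_congr' fun hZ => ?_
  beta_reduce
  -- The exponential factor is nonzero and drops out, leaving the divergence equation for `-d^A σ`.
  rw [L.lieDerivForm_hamVF_expWedgeVol hν hΛ σ φ hZ, dirDeriv_vertLift_neg, mul_eq_zero,
    or_iff_right (Real.exp_ne_zero _)]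
  constructor <;> intro h <;> linear_combination h

/-- The class of the modular section does not depend on the volumes. -/
theorem exists_isModularSection_neg_dA
    {ν' : ∀ q : Q, TangentSpace 𝓘(ℝ, E) q [⋀^Fin (finrank ℝ E)]→ₗ[ℝ] ℝ}
    {Λ' : ∀ q : Q, DualFib A q [⋀^Fin (finrank ℝ F)]→ₗ[ℝ] ℝ}
    (hν : IsVolumeForm 𝓘(ℝ, E) ν) (hΛ : IsVolumeSection E F Λ)
    (hν' : IsVolumeForm 𝓘(ℝ, E) ν') (hΛ' : IsVolumeSection E F Λ') {σ' : C^∞⟮𝓘(ℝ, E), Q; ℝ⟯}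
    (h : L.IsModularSection ν' Λ' (fun q => -L.dA σ' q)) :
    ∃ σ : C^∞⟮𝓘(ℝ, E), Q; ℝ⟯, L.IsModularSection ν Λ (fun q => -L.dA σ q) := by
  obtain ⟨a, ha0, ha⟩ := exists_smul_of_isVolumeForm hν hν'
  obtain ⟨b, hb0, hb⟩ := exists_smul_of_isVolumeSection hΛ hΛ'
  have hρ0 : ∀ q, (a * b) q ≠ 0 := fun q => mul_ne_zero (ha0 q) (hb0 q)
  -- `Real.log` is the logarithm of the absolute value, so the sign of `a * b` plays no role.
  let τ : C^∞⟮𝓘(ℝ, E), Q; ℝ⟯ := ⟨fun q => Real.log ((a * b) q), fun q =>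
    ContMDiffAt.comp (I' := 𝓘(ℝ, ℝ)) (g := Real.log) q (Real.contDiffAt_log.mpr (hρ0 q)).contMDiffAt
      ((a * b).contMDiff q)⟩
  -- The modular section for the primed volumes is the other one plus `d^A τ`, so the latter is
  -- `-d^A σ' - d^A τ`.
  refine ⟨σ' + τ, fun φ α Z hZ => ?_⟩
  have hρτ : L.dA (a * b) α.proj = (a * b) α.proj • L.dA τ α.proj := by
    rw [L.dA_comp (σ := a * b) (τ := τ) (Real.hasDerivAt_log (hρ0 α.proj)) rfl, smul_smul,
      mul_inv_cancel₀ (hρ0 α.proj), one_smul]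
  have h1 := h φ α Z hZ
  rw [wedgeVol_smul ha hb] at h1
  have h2 := L.lieDerivForm_hamVF_smul_wedgeVol hν hΛ (φ : DualTot F A → ℝ) hρτ hZ
  have h3 := h2.symm.trans h1
  beta_reduce at h3
  rw [AlternatingMap.smul_apply, smul_eq_mul, dirDeriv_vertLift_neg] at h3
  have h4 := mul_left_cancel₀ (hρ0 α.proj) (h3.trans (mul_left_comm _ ((a * b) α.proj) _))
  have h5 : (fun q => L.dA (σ' + τ) q) = fun q => L.dA σ' q + L.dA τ q := funext (L.dA_add σ' τ)
  have h6 : dirDeriv (dualModel E F) φ α (vertLift (fun q => L.dA (σ' + τ) q) α)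
      = dirDeriv (dualModel E F) φ α (vertLift (L.dA σ') α)
        + dirDeriv (dualModel E F) φ α (vertLift (L.dA τ) α) := by
    rw [h5, vertLift_add]
    exact map_add (mfderiv (dualModel E F) 𝓘(ℝ, ℝ) φ α) _ _
  beta_reduce
  rw [dirDeriv_vertLift_neg, h6]
  linear_combination h4

/-- If the hamiltonian vector field of one function of mechanical type preserves a volume form of basic
type, then so do all hamiltonian vector fields. -/
theorem preserves_hamVF_of_mechHam (𝒢 : ContMDiffRiemannianMetric 𝓘(ℝ, E) ∞ F A)
    (V μ : C^∞⟮𝓘(ℝ, E), Q; ℝ⟯) (hν : IsVolumeForm 𝓘(ℝ, E) ν) (hΛ : IsVolumeSection E F Λ)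
    (h : Preserves (dualModel E F) (L.hamVF (mechHam 𝒢 V)) (expWedgeVol μ ν Λ))
    (φ : C^∞⟮dualModel E F, DualTot F A; ℝ⟯) :
    Preserves (dualModel E F) (L.hamVF φ) (expWedgeVol μ ν Λ) := by
  intro β Z hZ
  obtain ⟨s, hs⟩ := L.exists_lieDerivForm_hamVF μ hν hΛ β.proj
  -- The hypothesis is used not at `β` but at the point of the same fibre given by `s` itself, where
  -- the vertical derivative of the hamiltonian is the squared norm of `s`.
  let α : DualTot F A := ⟨β.proj, s β.proj⟩
  -- Fields on which the volume is nonzero, so that it cancels from the equation.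
  obtain ⟨Z', hZ', hne⟩ := exists_smoothFieldAt_apply_ne_zero α
    ((isVolumeForm_expWedgeVol μ hν hΛ).ne_zero α)
  have h1 := (hs α rfl ⟨mechHam 𝒢 V, contMDiff_mechHam 𝒢 V⟩ Z' hZ').symm.trans (h α Z' hZ')
  have h2 : dualMetric 𝒢 β.proj (s β.proj) (s β.proj) = 0 :=
    (dirDeriv_mechHam_vertLift_self 𝒢 V s β.proj).symm.trans
      ((mul_eq_zero.mp h1).resolve_right hne)
  rw [hs β rfl φ Z hZ, vertLift_eq_zero (eq_zero_of_dualMetric_self 𝒢 _ _ h2)]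
  have h3 : dirDeriv (dualModel E F) φ β 0 = 0 :=
    (mfderiv (dualModel E F) 𝓘(ℝ, ℝ) φ β).map_zero
  rw [h3, zero_mul]

end LieAlgebroid

end Preservation

end LieAlgd

end

/-! ### The equivalence and the explicit invariant volume. -/

theorem corollary4p2 {E : Type*} [NormedAddCommGroup E] [NormedSpace ℝ E] [FiniteDimensional ℝ E]
    {Q : Type*} [TopologicalSpace Q] [T2Space Q] [SigmaCompactSpace Q] [ChartedSpace E Q]
    [IsManifold 𝓘(ℝ, E) ∞ Q]
    {F : Type*} [NormedAddCommGroup F] [NormedSpace ℝ F] [FiniteDimensional ℝ F]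
    {A : Q → Type*} [∀ q, AddCommGroup (A q)] [∀ q, Module ℝ (A q)] [∀ q, TopologicalSpace (A q)]
    [∀ q, IsTopologicalAddGroup (A q)] [∀ q, ContinuousSMul ℝ (A q)]
    [TopologicalSpace (TotalSpace F A)] [FiberBundle F A] [VectorBundle ℝ F A]
    [ContMDiffVectorBundle ∞ F A 𝓘(ℝ, E)]
    -- the Lie algebroid structure
    (L : LieAlgd.LieAlgebroid E F A)
    -- a volume form on `Q`
    (ν : ∀ q : Q, TangentSpace 𝓘(ℝ, E) q [⋀^Fin (finrank ℝ E)]→ₗ[ℝ] ℝ)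
    (hν : LieAlgd.IsVolumeForm 𝓘(ℝ, E) ν)
    -- an orientation of the vector bundle `A`
    (Λ₀ : ∀ q : Q, LieAlgd.DualFib A q [⋀^Fin (finrank ℝ F)]→ₗ[ℝ] ℝ)
    (hΛ₀ : LieAlgd.IsVolumeSection E F Λ₀)
    -- the bundle metric and the potential energy
    (𝒢 : ContMDiffRiemannianMetric 𝓘(ℝ, E) ∞ F A) (V : C^∞⟮𝓘(ℝ, E), Q; ℝ⟯) :
    (L.IsUnimodular ↔
      ∃ Φ : ∀ γ : LieAlgd.DualTot F A, TangentSpace (LieAlgd.dualModel E F) γ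
          [⋀^Fin (finrank ℝ E) ⊕ Fin (finrank ℝ F)]→ₗ[ℝ] ℝ,
        LieAlgd.IsVolumeForm (LieAlgd.dualModel E F) Φ ∧
        LieAlgd.IsBasicType ν (LieAlgd.metricVolume 𝒢 Λ₀) Φ ∧
        LieAlgd.Preserves (LieAlgd.dualModel E F) (L.hamVF (LieAlgd.mechHam 𝒢 V)) Φ) ∧
    ∀ σ : C^∞⟮𝓘(ℝ, E), Q; ℝ⟯,
      L.IsModularSection ν (LieAlgd.metricVolume 𝒢 Λ₀) (fun q => -L.dA σ q) →
      LieAlgd.IsVolumeForm (LieAlgd.dualModel E F)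
          (LieAlgd.expWedgeVol σ ν (LieAlgd.metricVolume 𝒢 Λ₀)) ∧
        LieAlgd.Preserves (LieAlgd.dualModel E F) (L.hamVF (LieAlgd.mechHam 𝒢 V))
          (LieAlgd.expWedgeVol σ ν (LieAlgd.metricVolume 𝒢 Λ₀)) := by
  have hΛ := LieAlgd.isVolumeSection_metricVolume 𝒢 hΛ₀
  have key : ∀ σ : C^∞⟮𝓘(ℝ, E), Q; ℝ⟯,
      L.IsModularSection ν (LieAlgd.metricVolume 𝒢 Λ₀) (fun q => -L.dA σ q) →
      LieAlgd.IsVolumeForm (LieAlgd.dualModel E F)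
          (LieAlgd.expWedgeVol σ ν (LieAlgd.metricVolume 𝒢 Λ₀)) ∧
        LieAlgd.Preserves (LieAlgd.dualModel E F) (L.hamVF (LieAlgd.mechHam 𝒢 V))
          (LieAlgd.expWedgeVol σ ν (LieAlgd.metricVolume 𝒢 Λ₀)) := fun σ hσ =>
    ⟨LieAlgd.isVolumeForm_expWedgeVol σ hν hΛ, (L.isModularSection_neg_dA_iff hν hΛ σ).mp hσ
      ⟨LieAlgd.mechHam 𝒢 V, LieAlgd.contMDiff_mechHam 𝒢 V⟩⟩
  refine ⟨⟨?_, ?_⟩, key⟩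
  · rintro ⟨ν', Λ', σ', hν', hΛ', h⟩
    obtain ⟨σ, hσ⟩ := L.exists_isModularSection_neg_dA hν hΛ hν' hΛ' h
    exact ⟨_, (key σ hσ).1, ⟨σ, rfl⟩, (key σ hσ).2⟩
  · rintro ⟨_, -, ⟨μ, rfl⟩, h⟩
    -- Unimodularity is witnessed by the given `ν` and the metric volume, with the exponent `μ` of
    -- the invariant volume as potential.
    exact ⟨ν, _, μ, hν, hΛ, (L.isModularSection_neg_dA_iff hν hΛ μ).mpr
      (L.preserves_hamVF_of_mechHam 𝒢 V μ hν hΛ h)⟩
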